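/- For $n\in\mathbb N=\{1,2,3,\dots\}$ let $\Omega(n)$ be the number of prime factors of $n$ counted with multiplicity, and let $\lambda(n)=(-1)^{\Omega(n)}$ be the Liouville function. For $N\ge 3$ and $n\ge1$ put $$\varphi_N(n)=\frac{\Omega(n)-\log\log N}{\sqrt{\log\log N}}.$$ (i) For every continuous compactly supported function $F:\mathbb R\to\mathbb C$, $$\lim_{N\to\infty}\frac1N\sum_{n=1}^{N}F\big(\varphi_N(n)\big)\,\lambda(n)=0.$$ (ii) $\Omega(n)$, restricted to those $n$ with $\Omega(n)$ even, is still asymptotically normal with mean and variance $\log\log N$: for all real $A\le B$, $$\lim_{N\to\infty}\frac{\big|\{1\le n\le N:\ \Omega(n)\text{ even},\ A\le\varphi_N(n)\le B\}\big|}{\big|\{1\le n\le N:\ \Omega(n)\text{ even}\}\big|}=\frac1{\sqrt{2\pi}}\int_A^B e^{-t^2/2}\,dt.$$ -/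

import Mathlib

/-- The normalised number of prime factors (counted with multiplicity) of `n`, at scale `N`:
`(Ω(n) - log log N) / √(log log N)`. -/
noncomputable def normalizedOmega (N n : ℕ) : ℝ :=
  ((ArithmeticFunction.cardFactors n : ℝ) - Real.log (Real.log (N : ℝ))) /
    Real.sqrt (Real.log (Real.log (N : ℝ)))

/-- The set of integers `1 ≤ n ≤ N` such that `Ω(n)` is even. -/
def evenOmega (N : ℕ) : Finset ℕ :=
  {n ∈ Finset.Icc 1 N | Even (ArithmeticFunction.cardFactors n)}

/-! ### Mertens' first theorem and Selberg's symmetric formula -/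

/-! Part (i). Put a_N(n) = F(φ_N(n)) λ(n). Multiplying n by a fixed prime p flips λ and moves φ_N by
1/√(log log N), so uniform continuity of F gives a_N(pn) = -a_N(n) + o(1) uniformly in n. Every
bounded family with this property has mean o(1) (`tendsto_average_of_anti_invariant`). Indeed, for a
finite set B of primes with L = Σ 1/p, Turán–Kubilius puts L Σ_{n≤x} a_N(n) within x√(2L) of Σ_p
Σ_{m≤x/p} a_N(pm). An ultralimit g(t) of the averages over n ≤ N e^{-t} is therefore 2-Lipschitz and
satisfies |L g(t) + Σ_p g(t + log p)/p| ≤ √(2L) for every B, whence g(t + log p) ≈ -g(t) for all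
primes outside a set with summable reciprocals.

Two non-exceptional primes p, q give g(t + log q - log p) ≈ g(t). As such differences occur at every
small scale, g is constant, and anti-invariance then forces g = 0 (`eq_zero_of_anti_invariant`). The
pairs exist (`exists_primes_log_sub_log_mem`) because otherwise the non-exceptional primes in (x,
4x] would lie in narrow clusters; a Brun–Titchmarsh type inequality drawn from Selberg's symmetric
formula bounds their weight by half of Chebyshev's lower bound, and the exceptional primes would be
too dense. The prime number theorem is not an input.

Part (ii). The indicator of even Ω is (1 + λ)/2. The term 1 is the Erdős–Kac theorem. The term λ is
the analogue of (i) for the indicator of [A, B], reached by trapezoids whose error is again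
controlled by Erdős–Kac. For Erdős–Kac itself, the count of prime divisors up to N^(1/log log N) has
asymptotically the moments of a sum of independent Bernoulli(1/p) variables; the characteristic
function of that sum is close to a centred Poisson one with mean asymptotic to log log N; and the
remaining part of Ω, recentred, is o(√(log log N)) in L¹. -/

theorem sum_Ioc_divisorsAntidiagonal (N : ℕ) (f : ℕ → ℕ → ℝ) :
    ∑ n ∈ Finset.Ioc 0 N, ∑ x ∈ n.divisorsAntidiagonal, f x.1 x.2 =
      ∑ d ∈ Finset.Ioc 0 N, ∑ m ∈ Finset.Ioc 0 (N / d), f d m := by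
  trans ∑ x ∈ Finset.Ioc 0 N ×ˢ Finset.Ioc 0 N with x.1 * x.2 ≤ N, f x.1 x.2
  · trans ∑ n ∈ Finset.Ioc 0 N,
      ∑ x ∈ Finset.Ioc 0 N ×ˢ Finset.Ioc 0 N with x.1 * x.2 = n, f x.1 x.2
    · refine Finset.sum_congr rfl fun n hn ↦ ?_
      simp only [Finset.mem_Ioc] at hn
      rw [Nat.divisorsAntidiagonal_eq_prod_filter_of_le hn.1.ne' hn.2]
    · simp_rw [Finset.sum_filter]
      rw [Finset.sum_comm]
      exact Finset.sum_congr rfl fun _ _ ↦ (by simp_all)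
  · rw [Finset.sum_filter, Finset.sum_product]
    refine Finset.sum_congr rfl fun d hd ↦ ?_
    rw [← Finset.sum_filter]
    refine Finset.sum_congr ?_ fun _ _ ↦ rfl
    ext m
    simp only [Finset.mem_filter, Finset.mem_Ioc] at hd ⊢
    rw [Nat.le_div_iff_mul_le hd.1, mul_comm m d]
    constructor
    · rintro ⟨⟨h1, h2⟩, h3⟩; exact ⟨h1, h3⟩
    · rintro ⟨h1, h3⟩
      exact ⟨⟨h1, le_trans (Nat.le_mul_of_pos_left m hd.1) h3⟩, h3⟩

theorem sum_Ioc_log_eq_log_factorial (N : ℕ) :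
    ∑ n ∈ Finset.Ioc 0 N, Real.log n = Real.log N.factorial := by
  induction N with
  | zero => simp
  | succ k ih =>
    rw [Finset.sum_Ioc_succ_top (Nat.zero_le k), ih, Nat.factorial_succ, Nat.cast_mul,
      Real.log_mul (by positivity) (by positivity), add_comm]

open ArithmeticFunction in
theorem sum_vonMangoldt_mul_div (N : ℕ) :
    ∑ d ∈ Finset.Ioc 0 N, vonMangoldt d * ((N / d : ℕ) : ℝ) = Real.log N.factorial := by
  rw [← sum_Ioc_log_eq_log_factorial, ← sum_Ioc_mul_zeta_eq_sum]
  simp [log_apply]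

open ArithmeticFunction in
theorem sum_psi_div (x : ℝ) :
    ∑ d ∈ Finset.Ioc 0 ⌊x⌋₊, Chebyshev.psi (x / d) = Real.log (⌊x⌋₊).factorial := by
  rw [← sum_Ioc_log_eq_log_factorial]
  have h := sum_Ioc_mul_eq_sum_sum (zeta : ArithmeticFunction ℝ) vonMangoldt ⌊x⌋₊
  simp only [zeta_mul_vonMangoldt, log_apply] at h
  rw [h]
  refine Finset.sum_congr rfl fun d hd ↦ ?_
  rw [Finset.mem_Ioc] at hd
  rw [Chebyshev.psi, Nat.floor_div_natCast]
  simp [natCoe_apply, zeta_apply, hd.1.ne']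

theorem log_factorial_le {N : ℕ} (hN : 1 ≤ N) :
    Real.log N.factorial ≤ N * Real.log N - N + Real.log N + 1 := by
  induction N, hN using Nat.le_induction with
  | base => simp
  | succ k hk ih =>
    have hk' : (0 : ℝ) < k := by exact_mod_cast hk
    rw [Nat.factorial_succ, Nat.cast_mul, Real.log_mul (by positivity) (by positivity)]
    have h1 : Real.log k ≤ Real.log (k + 1) - 1 / (k + 1) := by
      have := Real.log_le_sub_one_of_pos (x := (k : ℝ) / (k + 1)) (by positivity)
      rw [Real.log_div (by positivity) (by positivity)] at this
      have h2 : (k : ℝ) / (k + 1) - 1 = - (1 / (k + 1)) := by field_simp; ring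
      linarith
    have h3 : (k + 1 : ℝ) * Real.log k ≤ (k + 1) * Real.log (k + 1) - 1 := by
      have := mul_le_mul_of_nonneg_left h1 (by positivity : (0 : ℝ) ≤ k + 1)
      have h4 : (k + 1 : ℝ) * (1 / (k + 1)) = 1 := by field_simp
      linarith [mul_sub (k + 1 : ℝ) (Real.log (k + 1)) (1 / (k + 1))]
    push_cast
    linarith

theorem le_log_factorial {N : ℕ} (hN : 1 ≤ N) :
    N * Real.log N - N ≤ Real.log N.factorial := by
  have := Stirling.le_log_factorial_stirling (n := N) (by omega)
  have h1 : 0 ≤ Real.log N := Real.log_natCast_nonneg N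
  have h2 : 0 ≤ Real.log (2 * Real.pi) := Real.log_nonneg (by linarith [Real.pi_gt_three])
  linarith

theorem abs_log_factorial_floor_sub_le {x : ℝ} (hx : 1 ≤ x) :
    |Real.log (⌊x⌋₊).factorial - (x * Real.log x - x)| ≤ Real.log x + 2 := by
  have hN : 1 ≤ ⌊x⌋₊ := Nat.one_le_floor_iff x |>.2 hx
  have h1 := log_factorial_le hN
  have h2 := le_log_factorial hN
  have h3 : (⌊x⌋₊ : ℝ) ≤ x := Nat.floor_le (by linarith)
  have h4 : x < ⌊x⌋₊ + 1 := Nat.lt_floor_add_one x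
  set N : ℝ := (⌊x⌋₊ : ℝ)
  have hN1 : (1 : ℝ) ≤ N := by simp only [N]; exact_mod_cast hN
  have h5 : Real.log N ≤ Real.log x := Real.log_le_log (by linarith) h3
  have h0 : 0 ≤ Real.log N := Real.log_nonneg hN1
  have h6 : N * (Real.log x - Real.log N) ≤ x - N := by
    have := Real.log_le_sub_one_of_pos (x := x / N) (by positivity)
    rw [Real.log_div (by linarith) (by linarith)] at this
    have := mul_le_mul_of_nonneg_left this (by linarith : 0 ≤ N)
    have h7 : N * (x / N - 1) = x - N := by field_simp
    linarith
  have h8 : 0 ≤ (x - N) * Real.log x := mul_nonneg (by linarith) (by linarith)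
  have h9 : (x - N) * Real.log x ≤ Real.log x := by nlinarith
  have h10 : 0 ≤ N * (Real.log x - Real.log N) := mul_nonneg (by linarith) (by linarith)
  rw [abs_le]
  constructor <;> nlinarith

open ArithmeticFunction in
-- Mertens: log N! = Σ Λ(d)⌊N/d⌋, and removing the floors costs at most ψ(N) = O(N) by Chebyshev.
-- Dividing Stirling's estimate by N gives the claim; log 4 + 4 is the Chebyshev constant for ψ.
theorem exists_abs_sum_vonMangoldt_div_sub_log_le :
    ∃ C : ℝ, 0 ≤ C ∧ ∀ x : ℝ, 1 ≤ x →
      |∑ n ∈ Finset.Ioc 0 ⌊x⌋₊, vonMangoldt n / n - Real.log x| ≤ C := by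
  refine ⟨Real.log 4 + 4 + 2, by positivity, fun x hx ↦ ?_⟩
  have hN : 1 ≤ ⌊x⌋₊ := Nat.one_le_floor_iff x |>.2 hx
  have h1 := log_factorial_le hN
  have h2 := le_log_factorial hN
  have h3 : (⌊x⌋₊ : ℝ) ≤ x := Nat.floor_le (by linarith)
  have h4 : x < ⌊x⌋₊ + 1 := Nat.lt_floor_add_one x
  have hpsi := Chebyshev.psi_le_const_mul_self (x := (⌊x⌋₊ : ℝ)) (by positivity)
  rw [← sum_vonMangoldt_mul_div] at h1 h2
  have hpsi2 : Chebyshev.psi (⌊x⌋₊ : ℝ) = ∑ n ∈ Finset.Ioc 0 ⌊x⌋₊, vonMangoldt n := by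
    simp [Chebyshev.psi]
  have hN1 : (1 : ℝ) ≤ ⌊x⌋₊ := by exact_mod_cast hN
  set n := ⌊x⌋₊
  have hup : ∑ d ∈ Finset.Ioc 0 n, vonMangoldt d * ((n / d : ℕ) : ℝ) ≤
      n * ∑ d ∈ Finset.Ioc 0 n, vonMangoldt d / d := by
    rw [Finset.mul_sum]
    refine Finset.sum_le_sum fun d hd ↦ ?_
    have : ((n / d : ℕ) : ℝ) ≤ n / d := Nat.cast_div_le
    have := mul_le_mul_of_nonneg_left this (vonMangoldt_nonneg (n := d))
    calc _ ≤ _ := this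
      _ = _ := by ring
  have hlo : n * ∑ d ∈ Finset.Ioc 0 n, vonMangoldt d / d - Chebyshev.psi n ≤
      ∑ d ∈ Finset.Ioc 0 n, vonMangoldt d * ((n / d : ℕ) : ℝ) := by
    rw [Finset.mul_sum, hpsi2, ← Finset.sum_sub_distrib]
    refine Finset.sum_le_sum fun d hd ↦ ?_
    have : (n / d : ℝ) - 1 ≤ ((n / d : ℕ) : ℝ) := by
      have := Nat.lt_floor_add_one ((n : ℝ) / d)
      rw [Nat.floor_div_eq_div] at this
      linarith
    have := mul_le_mul_of_nonneg_left this (vonMangoldt_nonneg (n := d))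
    calc _ = vonMangoldt d * ((n / d : ℝ) - 1) := by ring
      _ ≤ _ := this
  set S := ∑ d ∈ Finset.Ioc 0 n, vonMangoldt d / d
  have hlogx : Real.log x ≤ Real.log n + 1 := by
    have := Real.log_le_sub_one_of_pos (x := x / n) (by positivity)
    rw [Real.log_div (by linarith) (by linarith)] at this
    have h7 : x / n ≤ 2 := by rw [div_le_iff₀ (by linarith)]; linarith
    linarith
  have hlogn : Real.log n ≤ Real.log x := Real.log_le_log (by linarith) h3
  have hlogn' : Real.log n ≤ n := by linarith [Real.log_le_sub_one_of_pos (x := (n : ℝ)) (by linarith)]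
  have hA : Real.log n - 1 ≤ S := by
    have : (n : ℝ) * (Real.log n - 1) ≤ n * S := by nlinarith
    exact le_of_mul_le_mul_left this (by linarith)
  have hB : S ≤ Real.log n + (Real.log 4 + 4) + 1 := by
    have : (n : ℝ) * S ≤ n * (Real.log n + (Real.log 4 + 4) + 1) := by nlinarith
    exact le_of_mul_le_mul_left this (by linarith)
  have : 0 ≤ Real.log 4 := by positivity
  rw [abs_le]
  constructor <;> linarith

theorem abs_harmonic_floor_sub_le {x : ℝ} (hx : 1 ≤ x) :
    |x * ∑ n ∈ Finset.Ioc 0 ⌊x⌋₊, (1 : ℝ) / n - (x * Real.log x + Real.eulerMascheroniConstant * x)|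
      ≤ 2 := by
  have hN : 1 ≤ ⌊x⌋₊ := Nat.one_le_floor_iff x |>.2 hx
  have h3 : (⌊x⌋₊ : ℝ) ≤ x := Nat.floor_le (by linarith)
  have h4 : x < ⌊x⌋₊ + 1 := Nat.lt_floor_add_one x
  have hN1 : (1 : ℝ) ≤ ⌊x⌋₊ := by exact_mod_cast hN
  have hH : ∑ n ∈ Finset.Ioc 0 ⌊x⌋₊, (1 : ℝ) / n = harmonic ⌊x⌋₊ := by
    rw [harmonic_eq_sum_Icc]
    push_cast
    simp only [one_div]
    rfl
  rw [hH]
  have h1 := Real.eulerMascheroniSeq_lt_eulerMascheroniConstant ⌊x⌋₊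
  have h2 := Real.eulerMascheroniConstant_lt_eulerMascheroniSeq' ⌊x⌋₊
  rw [Real.eulerMascheroniSeq] at h1
  rw [Real.eulerMascheroniSeq', if_neg (by omega)] at h2
  have h5 : Real.log (⌊x⌋₊ + 1) ≤ Real.log ⌊x⌋₊ + 1 / ⌊x⌋₊ := by
    have := Real.log_le_sub_one_of_pos (x := (⌊x⌋₊ + 1 : ℝ) / ⌊x⌋₊) (by positivity)
    rw [Real.log_div (by linarith) (by linarith)] at this
    have h2 : (⌊x⌋₊ + 1 : ℝ) / ⌊x⌋₊ - 1 = 1 / ⌊x⌋₊ := by field_simp; ring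
    linarith
  have h6 : Real.log ⌊x⌋₊ ≤ Real.log x := Real.log_le_log (by linarith) h3
  have h7 : Real.log x ≤ Real.log (⌊x⌋₊ + 1) := Real.log_le_log (by linarith) h4.le
  have h8 : x * (1 / ⌊x⌋₊) ≤ 2 := by
    rw [mul_one_div, div_le_iff₀ (by linarith)]; linarith
  set H : ℝ := (harmonic ⌊x⌋₊ : ℝ)
  have h9 : |H - (Real.log x + Real.eulerMascheroniConstant)| ≤ 1 / ⌊x⌋₊ := by
    rw [abs_le]; constructor <;> linarith
  have h10 : x * H - (x * Real.log x + Real.eulerMascheroniConstant * x) =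
      x * (H - (Real.log x + Real.eulerMascheroniConstant)) := by ring
  rw [h10, abs_mul, abs_of_pos (by linarith : 0 < x)]
  exact (mul_le_mul_of_nonneg_left h9 (by linarith)).trans h8

/-- The error term of `ψ`, shifted so that its sums over `x / n` are logarithmically small. -/
noncomputable def psiError (x : ℝ) : ℝ :=
  Chebyshev.psi x - x + (1 + Real.eulerMascheroniConstant)

/-- The linear terms cancel: Σ ψ(x/d) contributes x log x - x, Σ x/d contributes x log x + γx, and
the constant 1 + γ, summed over d ≤ x, restores (1 + γ)x. Only O(1 + log x) survives. -/
theorem abs_sum_psiError_le {x : ℝ} (hx : 1 ≤ x) :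
    |∑ d ∈ Finset.Ioc 0 ⌊x⌋₊, psiError (x / d)| ≤ 6 * (1 + Real.log x) := by
  have h1 := abs_harmonic_floor_sub_le hx
  have h2 := abs_log_factorial_floor_sub_le hx
  have h3 : (⌊x⌋₊ : ℝ) ≤ x := Nat.floor_le (by linarith)
  have h4 : x < ⌊x⌋₊ + 1 := Nat.lt_floor_add_one x
  have hg1 := Real.one_half_lt_eulerMascheroniConstant
  have hg2 := Real.eulerMascheroniConstant_lt_two_thirds
  have hl : 0 ≤ Real.log x := Real.log_nonneg hx
  have h5 : ∑ d ∈ Finset.Ioc 0 ⌊x⌋₊, psiError (x / d) = Real.log (⌊x⌋₊).factorial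
      - x * ∑ n ∈ Finset.Ioc 0 ⌊x⌋₊, (1 : ℝ) / n
      + (1 + Real.eulerMascheroniConstant) * ⌊x⌋₊ := by
    simp only [psiError, Finset.sum_add_distrib, Finset.sum_sub_distrib, sum_psi_div,
      Finset.mul_sum, mul_one_div]
    simp
    ring
  rw [h5]
  rw [abs_le] at h1 h2 ⊢
  constructor <;> nlinarith

open ArithmeticFunction in
-- The Tatuzawa–Iseki identity. Grouping by n = dm, the weight Σ_{d∣n} μ(d)(log x - log d) equals
-- log x at n = 1 plus Λ(n), since Σ_{d∣n} μ(d) log d = -Λ(n).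
theorem sum_moebius_mul_log_mul_sum_psiError {x : ℝ} (hx : 1 ≤ x) :
    ∑ d ∈ Finset.Ioc 0 ⌊x⌋₊, (moebius d : ℝ) * Real.log (x / d) *
        ∑ m ∈ Finset.Ioc 0 ⌊x / d⌋₊, psiError (x / d / m) =
      psiError x * Real.log x +
        ∑ n ∈ Finset.Ioc 0 ⌊x⌋₊, vonMangoldt n * psiError (x / n) := by
  have h := sum_Ioc_divisorsAntidiagonal ⌊x⌋₊
    (fun d m ↦ (moebius d : ℝ) * Real.log (x / d) * psiError (x / d / m))
  have hL : ∑ d ∈ Finset.Ioc 0 ⌊x⌋₊, (moebius d : ℝ) * Real.log (x / d) *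
        ∑ m ∈ Finset.Ioc 0 ⌊x / d⌋₊, psiError (x / d / m) =
      ∑ d ∈ Finset.Ioc 0 ⌊x⌋₊, ∑ m ∈ Finset.Ioc 0 (⌊x⌋₊ / d),
        (moebius d : ℝ) * Real.log (x / d) * psiError (x / d / m) := by
    refine Finset.sum_congr rfl fun d hd ↦ ?_
    rw [Finset.mul_sum, Nat.floor_div_natCast]
  rw [hL, ← h]
  have hlog : ∀ n : ℕ, ∑ d ∈ n.divisors, (moebius d : ℝ) * Real.log d = -vonMangoldt n :=
    fun n ↦ sum_moebius_mul_log_eq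
  have hin : ∀ n ∈ Finset.Ioc 0 ⌊x⌋₊,
      ∑ y ∈ n.divisorsAntidiagonal, (moebius y.1 : ℝ) * Real.log (x / y.1) *
        psiError (x / y.1 / y.2) =
      (if n = 1 then psiError x * Real.log x else 0) + vonMangoldt n * psiError (x / n) := by
    intro n hn
    rw [Finset.mem_Ioc] at hn
    have h1 : ∀ y ∈ n.divisorsAntidiagonal, (moebius y.1 : ℝ) * Real.log (x / y.1) *
        psiError (x / y.1 / y.2) =
        ((moebius y.1 : ℝ) * Real.log x - (moebius y.1 : ℝ) * Real.log y.1) * psiError (x / n) := by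
      intro y hy
      rw [Nat.mem_divisorsAntidiagonal] at hy
      have hy1 : (y.1 : ℝ) ≠ 0 := by
        intro h0
        have : y.1 = 0 := by exact_mod_cast h0
        rw [this, zero_mul] at hy
        exact hy.2 hy.1.symm
      rw [div_div, ← Nat.cast_mul, hy.1, Real.log_div (by linarith) hy1]
      ring
    rw [Finset.sum_congr rfl h1, ← Finset.sum_mul,
      Nat.sum_divisorsAntidiagonal
        (fun i _ ↦ (moebius i : ℝ) * Real.log x - (moebius i : ℝ) * Real.log i),
      Finset.sum_sub_distrib, hlog, ← Finset.sum_mul, ← Int.cast_sum,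
      ← coe_mul_zeta_apply, moebius_mul_coe_zeta, one_apply]
    split_ifs with h2
    · subst h2; simp [mul_comm]
    · simp
  rw [Finset.sum_congr rfl hin, Finset.sum_add_distrib]
  congr 1
  rw [Finset.sum_ite_eq' ]
  rw [if_pos]
  simp [hx]

theorem sum_Ioc_inv_sqrt_le (N : ℕ) :
    ∑ n ∈ Finset.Ioc 0 N, 1 / Real.sqrt n ≤ 2 * Real.sqrt N := by
  induction N with
  | zero => simp
  | succ k ih =>
    rw [Finset.sum_Ioc_succ_top (Nat.zero_le k)]
    have h1 : Real.sqrt k ≤ Real.sqrt (k + 1) := Real.sqrt_le_sqrt (by linarith)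
    have h2 := Real.sq_sqrt (show (0 : ℝ) ≤ k by positivity)
    have h3 := Real.sq_sqrt (show (0 : ℝ) ≤ k + 1 by positivity)
    have h4 : 0 < Real.sqrt (k + 1) := Real.sqrt_pos.2 (by positivity)
    have h5 : 1 / Real.sqrt (k + 1) ≤ 2 * Real.sqrt (k + 1) - 2 * Real.sqrt k := by
      rw [div_le_iff₀ h4]
      nlinarith
    push_cast
    linarith

theorem log_mul_one_add_log_le {u : ℝ} (hu : 1 ≤ u) :
    Real.log u * (1 + Real.log u) ≤ 8 * Real.sqrt u := by
  have h0 := Real.log_nonneg hu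
  have h := Real.quadratic_le_exp_of_nonneg (x := Real.log u / 2) (by linarith)
  rw [← Real.log_sqrt (by linarith), Real.exp_log (Real.sqrt_pos.2 (by linarith)),
    Real.log_sqrt (by linarith)] at h
  nlinarith

open ArithmeticFunction in
-- Inner sums in the Tatuzawa–Iseki identity are O(1 + log(x/d)), so each term is O(√(x/d)); summing
-- 1/√d ≤ 2√x in total leaves O(x), with no logarithm lost.
theorem abs_psiError_mul_log_add_le {x : ℝ} (hx : 1 ≤ x) :
    |psiError x * Real.log x + ∑ n ∈ Finset.Ioc 0 ⌊x⌋₊, vonMangoldt n * psiError (x / n)|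
      ≤ 96 * x := by
  rw [← sum_moebius_mul_log_mul_sum_psiError hx]
  have hterm : ∀ d ∈ Finset.Ioc 0 ⌊x⌋₊, |(moebius d : ℝ) * Real.log (x / d) *
        ∑ m ∈ Finset.Ioc 0 ⌊x / d⌋₊, psiError (x / d / m)| ≤
        48 * Real.sqrt x * (1 / Real.sqrt d) := by
    intro d hd
    rw [Finset.mem_Ioc] at hd
    have hd0 : (0 : ℝ) < d := by exact_mod_cast hd.1
    have hdx : (d : ℝ) ≤ x := (Nat.le_floor_iff (by linarith)).1 hd.2
    have hxd : 1 ≤ x / d := by rwa [le_div_iff₀ hd0, one_mul]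
    have h1 : |(moebius d : ℝ)| ≤ 1 := by exact_mod_cast abs_moebius_le_one
    have h2 := Real.log_nonneg hxd
    rw [abs_mul, abs_mul, abs_of_nonneg h2]
    calc _ ≤ 1 * Real.log (x / d) * (6 * (1 + Real.log (x / d))) := by
          gcongr
          exact abs_sum_psiError_le hxd
      _ = 6 * (Real.log (x / d) * (1 + Real.log (x / d))) := by ring
      _ ≤ 6 * (8 * Real.sqrt (x / d)) := by
          exact mul_le_mul_of_nonneg_left (log_mul_one_add_log_le hxd) (by norm_num)
      _ = _ := by rw [Real.sqrt_div (by linarith)]; ring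
  calc _ ≤ _ := Finset.abs_sum_le_sum_abs _ _
    _ ≤ _ := Finset.sum_le_sum hterm
    _ = 48 * Real.sqrt x * ∑ d ∈ Finset.Ioc 0 ⌊x⌋₊, 1 / Real.sqrt d := by rw [Finset.mul_sum]
    _ ≤ 48 * Real.sqrt x * (2 * Real.sqrt x) := by
        gcongr
        refine (sum_Ioc_inv_sqrt_le _).trans ?_
        gcongr
        exact Nat.floor_le (by linarith)
    _ = 96 * (Real.sqrt x * Real.sqrt x) := by ring
    _ = _ := by rw [Real.mul_self_sqrt (by linarith)]

open ArithmeticFunction in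
/-- **Selberg's symmetric formula**. -/
theorem exists_abs_selberg_le : ∃ C : ℝ, 0 ≤ C ∧ ∀ x : ℝ, 1 ≤ x →
    |Chebyshev.psi x * Real.log x
      + ∑ n ∈ Finset.Ioc 0 ⌊x⌋₊, vonMangoldt n * Chebyshev.psi (x / n) - 2 * x * Real.log x|
      ≤ C * x := by
  obtain ⟨K, hK0, hK⟩ := exists_abs_sum_vonMangoldt_div_sub_log_le
  refine ⟨96 + K + 2 + 2 * (Real.log 4 + 4), by positivity, fun x hx ↦ ?_⟩
  have h1 := abs_psiError_mul_log_add_le hx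
  have h2 := hK x hx
  have h3 := Chebyshev.psi_le_const_mul_self (x := x) (by linarith)
  have h4 := Chebyshev.psi_nonneg x
  have hl := Real.log_nonneg hx
  have hl' : Real.log x ≤ x := by linarith [Real.log_le_sub_one_of_pos (x := x) (by linarith)]
  have hg1 := Real.one_half_lt_eulerMascheroniConstant
  have hg2 := Real.eulerMascheroniConstant_lt_two_thirds
  -- Undoing the shift: x Σ Λ(n)/n supplies one of the two x log x by Mertens, and the terms with 1
  -- + γ are O(x).
  have h5 : ∑ n ∈ Finset.Ioc 0 ⌊x⌋₊, vonMangoldt n * psiError (x / n) =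
      ∑ n ∈ Finset.Ioc 0 ⌊x⌋₊, vonMangoldt n * Chebyshev.psi (x / n)
      - x * ∑ n ∈ Finset.Ioc 0 ⌊x⌋₊, vonMangoldt n / n
      + (1 + Real.eulerMascheroniConstant) * Chebyshev.psi x := by
    rw [Chebyshev.psi, Finset.mul_sum, Finset.mul_sum, ← Finset.sum_sub_distrib,
      ← Finset.sum_add_distrib]
    refine Finset.sum_congr rfl fun n _ ↦ ?_
    rw [psiError]; ring
  rw [h5, psiError] at h1
  have h6 : |x * ∑ n ∈ Finset.Ioc 0 ⌊x⌋₊, vonMangoldt n / n - x * Real.log x| ≤ K * x := by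
    rw [← mul_sub, abs_mul, abs_of_nonneg (by linarith : 0 ≤ x), mul_comm]
    gcongr
  set S1 := ∑ n ∈ Finset.Ioc 0 ⌊x⌋₊, vonMangoldt n * Chebyshev.psi (x / n)
  set S2 := x * ∑ n ∈ Finset.Ioc 0 ⌊x⌋₊, vonMangoldt n / n
  set g := Real.eulerMascheroniConstant
  have h7 : 0 ≤ (1 + g) * Chebyshev.psi x := mul_nonneg (by linarith) h4
  have h8 : (1 + g) * Chebyshev.psi x ≤ 2 * ((Real.log 4 + 4) * x) := by
    apply mul_le_mul (by linarith) h3 h4 (by norm_num)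
  have h9 : 0 ≤ (1 + g) * Real.log x := mul_nonneg (by linarith) hl
  have h10 : (1 + g) * Real.log x ≤ 2 * x := by
    apply mul_le_mul (by linarith) hl' hl (by norm_num)
  have hlog4 : 0 ≤ (Real.log 4 + 4) * x := by positivity
  rw [abs_le] at h1 h6 ⊢
  constructor <;> nlinarith

open ArithmeticFunction in
-- Subtract Selberg's formula at x from the one at y. The convolution sum increases with its
-- argument, so its difference may be dropped, leaving an upper bound of Brun–Titchmarsh type with
-- constant 2, valid in intervals of length a small multiple of x.
theorem exists_psi_sub_psi_le : ∃ C : ℝ, 0 ≤ C ∧ ∀ x y : ℝ, 1 < x → x ≤ y → y ≤ 4 * x →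
    Chebyshev.psi y - Chebyshev.psi x ≤ 2 * (y - x) + C * x / Real.log x := by
  obtain ⟨K, hK0, hK⟩ := exists_abs_selberg_le
  refine ⟨32 + 5 * K, by positivity, fun x y hx hxy hy ↦ ?_⟩
  have hlx : 0 < Real.log x := Real.log_pos hx
  have hlxy : Real.log x ≤ Real.log y := Real.log_le_log (by linarith) hxy
  have h1 := (abs_le.1 (hK x hx.le)).1
  have h2 := (abs_le.1 (hK y (by linarith))).2
  have hmono : ∑ n ∈ Finset.Ioc 0 ⌊x⌋₊, vonMangoldt n * Chebyshev.psi (x / n) ≤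
      ∑ n ∈ Finset.Ioc 0 ⌊y⌋₊, vonMangoldt n * Chebyshev.psi (y / n) := by
    refine (Finset.sum_le_sum fun n _ ↦ ?_).trans
      (Finset.sum_le_sum_of_subset_of_nonneg
        (Finset.Ioc_subset_Ioc_right (Nat.floor_le_floor hxy)) fun n _ _ ↦ ?_)
    · refine mul_le_mul_of_nonneg_left (Chebyshev.psi_mono ?_) vonMangoldt_nonneg
      gcongr
    · exact mul_nonneg vonMangoldt_nonneg (Chebyshev.psi_nonneg _)
  have hlogdiff : Real.log y - Real.log x ≤ 3 := by
    have := Real.log_le_sub_one_of_pos (x := y / x) (div_pos (by linarith) (by linarith))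
    rw [Real.log_div (by linarith) (by linarith)] at this
    have h7 : y / x ≤ 4 := by rw [div_le_iff₀ (by linarith)]; linarith
    linarith
  have hpy := Chebyshev.psi_nonneg y
  have hmain : (Chebyshev.psi y - Chebyshev.psi x) * Real.log x ≤
      2 * (y - x) * Real.log x + (32 + 5 * K) * x := by
    have h3 : Chebyshev.psi y * Real.log x ≤ Chebyshev.psi y * Real.log y := by gcongr
    have h4 : y * (Real.log y - Real.log x) ≤ 4 * x * 3 := by
      apply mul_le_mul hy hlogdiff (by linarith) (by linarith)
    have h5 : K * y ≤ K * (4 * x) := by gcongr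
    nlinarith
  have : Chebyshev.psi y - Chebyshev.psi x ≤ (2 * (y - x) * Real.log x + (32 + 5 * K) * x) / Real.log x := by
    rw [le_div_iff₀ hlx]; exact hmain
  refine this.trans (le_of_eq ?_)
  field_simp

/-! ### Pairs of primes with prescribed approximate ratio, outside a sparse set -/

/-- The whole cluster lies in [p₀, p₀ e^η] with p₀ its least element, an interval of length at most
8ηx, to which the short-interval bound for ψ applies. -/
theorem exists_sum_log_le_of_cluster : ∃ C : ℝ, 0 ≤ C ∧ ∀ x η : ℝ, 2 ≤ x → 0 ≤ η → η ≤ 1 →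
    ∀ S : Finset ℕ, (∀ p ∈ S, p.Prime ∧ x < p ∧ (p : ℝ) ≤ 4 * x) →
      (∀ p ∈ S, ∀ q ∈ S, Real.log q - Real.log p ≤ η) →
      ∑ p ∈ S, Real.log p ≤ 16 * η * x + C * x / Real.log x := by
  obtain ⟨C, hC0, hC⟩ := exists_psi_sub_psi_le
  refine ⟨32 + 4 * C, by positivity, fun x η hx hη0 hη1 S hS hclose ↦ ?_⟩
  have hlx : 0 < Real.log x := Real.log_pos (by linarith)
  rcases S.eq_empty_or_nonempty with rfl | hne
  · simp only [Finset.sum_empty]; positivity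
  set p₀ := S.min' hne with hp₀
  have hp₀S : p₀ ∈ S := S.min'_mem hne
  obtain ⟨hprime, hxp, hp4⟩ := hS p₀ hp₀S
  have hp₀pos : (0 : ℝ) < p₀ := by linarith
  set y : ℝ := p₀ * Real.exp η with hy
  have hexp1 : Real.exp η - 1 ≤ 2 * η := by
    have := Real.abs_exp_sub_one_le (x := η) (by rwa [abs_of_nonneg hη0])
    rw [abs_of_nonneg hη0] at this
    exact (le_abs_self _).trans this
  have hexp0 : 1 ≤ Real.exp η := Real.one_le_exp hη0
  have hy1 : (p₀ : ℝ) ≤ y := by rw [hy]; nlinarith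
  have hy4 : y ≤ 4 * p₀ := by rw [hy]; nlinarith
  have hψ := hC p₀ y (by linarith) hy1 hy4
  -- The difference ψ(y) - ψ(p₀) omits p₀ itself; its weight log p₀ is absorbed into the term x /
  -- log x.
  have hsub : S.erase p₀ ⊆ Finset.Ioc p₀ ⌊y⌋₊ := by
    intro q hq
    rw [Finset.mem_erase] at hq
    have hq' : p₀ ≤ q := S.min'_le q hq.2
    rw [Finset.mem_Ioc]
    refine ⟨by omega, Nat.le_floor ?_⟩
    have hqpos : (0 : ℝ) < q := by have := (hS q hq.2).2.1; linarith
    have h1 := hclose p₀ hp₀S q hq.2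
    rw [hy, ← Real.exp_log hp₀pos, ← Real.exp_add, ← Real.exp_log hqpos]
    exact Real.exp_le_exp.2 (by linarith)
  have hψ' : Chebyshev.psi y - Chebyshev.psi p₀ =
      ∑ n ∈ Finset.Ioc p₀ ⌊y⌋₊, ArithmeticFunction.vonMangoldt n := by
    rw [Chebyshev.psi, Chebyshev.psi, Nat.floor_natCast, sub_eq_iff_eq_add, add_comm]
    exact (Finset.sum_Ioc_consecutive _ (Nat.zero_le _) (Nat.le_floor hy1)).symm
  have h1 : ∑ p ∈ S.erase p₀, Real.log p ≤ Chebyshev.psi y - Chebyshev.psi p₀ := by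
    rw [hψ']
    calc ∑ p ∈ S.erase p₀, Real.log p
        = ∑ p ∈ S.erase p₀, ArithmeticFunction.vonMangoldt p := by
          refine Finset.sum_congr rfl fun p hp ↦ ?_
          rw [ArithmeticFunction.vonMangoldt_apply_prime (hS p (Finset.mem_of_mem_erase hp)).1]
      _ ≤ _ := Finset.sum_le_sum_of_subset_of_nonneg hsub
          fun _ _ _ ↦ ArithmeticFunction.vonMangoldt_nonneg
  have h2 : ∑ p ∈ S, Real.log p = Real.log p₀ + ∑ p ∈ S.erase p₀, Real.log p :=
    (Finset.add_sum_erase S _ hp₀S).symm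
  have h3 : Real.log p₀ ≤ 32 * x / Real.log x := by
    rw [le_div_iff₀ hlx]
    have h4 : Real.log p₀ ≤ Real.log (4 * x) := Real.log_le_log hp₀pos hp4
    have h5 : Real.log x ≤ Real.log (4 * x) := Real.log_le_log (by linarith) (by linarith)
    have h6 := log_mul_one_add_log_le (u := 4 * x) (by linarith)
    have h7 : Real.sqrt (4 * x) ≤ 4 * x := by
      rw [Real.sqrt_le_left (by linarith)]; nlinarith
    nlinarith
  have h4 : C * p₀ / Real.log p₀ ≤ C * (4 * x) / Real.log x := by
    gcongr
  have h5 : 2 * (y - p₀) ≤ 16 * η * x := by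
    have : y - p₀ = p₀ * (Real.exp η - 1) := by rw [hy]; ring
    rw [this]
    have : (p₀ : ℝ) * (Real.exp η - 1) ≤ (4 * x) * (2 * η) := by
      apply mul_le_mul hp4 hexp1 (by linarith) (by linarith)
    linarith
  have h6 : (32 + 4 * C) * x / Real.log x = 32 * x / Real.log x + C * (4 * x) / Real.log x := by
    ring
  rw [h2, h6]
  linarith

theorem log_four_lt : Real.log 4 < 1.3864 := by
  have : Real.log 4 = 2 * Real.log 2 := by
    rw [show (4 : ℝ) = 2 ^ 2 by norm_num, Real.log_pow]; norm_num
  linarith [Real.log_two_lt_d9]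

/-- Cut (log x, log 4x] into cells of length δ. Two members of S in one cell differ in logarithm by
less than δ, hence by less than δ/100, so S meets each cell in a cluster a hundred times narrower
than the cell. This gain outweighs the constants of the cluster bound. -/
theorem exists_sum_log_le_of_separated {δ : ℝ} (hδ0 : 0 < δ) (hδ1 : δ ≤ 1) :
    ∃ X : ℝ, ∀ x : ℝ, X ≤ x → ∀ S : Finset ℕ,
      (∀ p ∈ S, p.Prime ∧ x < p ∧ (p : ℝ) ≤ 4 * x) →
      (∀ p ∈ S, ∀ q ∈ S, ¬ (δ / 100 ≤ Real.log q - Real.log p ∧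
        Real.log q - Real.log p ≤ δ)) →
      ∑ p ∈ S, Real.log p ≤ x / 2 := by
  obtain ⟨C, hC0, hC⟩ := exists_sum_log_le_of_cluster
  -- Beyond this threshold C / log x ≤ δ/24, so the secondary terms of all cells together cost at
  -- most x/10.
  refine ⟨max 2 (Real.exp (24 * C / δ + 1)), fun x hX S hS hsep ↦ ?_⟩
  have hx2 : 2 ≤ x := (le_max_left _ _).trans hX
  have hx0 : 0 < x := by linarith
  have hlx : 24 * C / δ + 1 ≤ Real.log x := by
    rw [Real.le_log_iff_exp_le hx0]; exact (le_max_right _ _).trans hX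
  have hlx0 : 0 < Real.log x := by
    have : 0 ≤ 24 * C / δ := by positivity
    linarith
  set J : ℕ := ⌊Real.log 4 / δ⌋₊ + 1 with hJ
  have hJ' : (J : ℝ) ≤ 2.4 / δ := by
    have h1 : (⌊Real.log 4 / δ⌋₊ : ℝ) ≤ Real.log 4 / δ := Nat.floor_le (by positivity)
    have h2 : (J : ℝ) ≤ Real.log 4 / δ + 1 := by rw [hJ]; push_cast; linarith
    refine h2.trans ?_
    rw [div_add_one hδ0.ne']
    gcongr
    linarith [log_four_lt]
  have hmaps : ∀ p ∈ S, ⌊(Real.log p - Real.log x) / δ⌋₊ ∈ Finset.range J := by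
    intro p hp
    obtain ⟨_, h1, h2⟩ := hS p hp
    rw [Finset.mem_range, hJ, Nat.lt_add_one_iff]
    apply Nat.floor_le_floor
    gcongr
    rw [sub_le_iff_le_add, ← Real.log_mul (by norm_num) hx0.ne']
    exact Real.log_le_log (by linarith) h2
  rw [← Finset.sum_fiberwise_of_maps_to hmaps]
  have hcell : ∀ i ∈ Finset.range J,
      ∑ p ∈ S.filter (fun p : ℕ ↦ ⌊(Real.log p - Real.log x) / δ⌋₊ = i), Real.log p ≤
        16 * (δ / 100) * x + C * x / Real.log x := by
    intro i _
    refine hC x (δ / 100) hx2 (by positivity) (by linarith) _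
      (fun p hp ↦ hS p (Finset.mem_filter.1 hp).1) ?_
    intro p hp q hq
    rw [Finset.mem_filter] at hp hq
    by_contra! hlt
    refine hsep p hp.1 q hq.1 ⟨hlt.le, ?_⟩
    have hp1 := (hS p hp.1).2.1
    have hq1 := (hS q hq.1).2.1
    have hlp : 0 ≤ Real.log p - Real.log x := sub_nonneg.2 (Real.log_le_log hx0 hp1.le)
    have h3 : (i : ℝ) ≤ (Real.log p - Real.log x) / δ := by
      rw [← hp.2]; exact Nat.floor_le (by positivity)
    have h4 : (Real.log q - Real.log x) / δ < i + 1 := by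
      rw [← hq.2]; exact Nat.lt_floor_add_one _
    rw [le_div_iff₀ hδ0] at h3
    rw [div_lt_iff₀ hδ0] at h4
    linarith
  refine (Finset.sum_le_sum hcell).trans ?_
  rw [Finset.sum_const, Finset.card_range, nsmul_eq_mul]
  have hsmall : C * x / Real.log x ≤ δ / 24 * x := by
    rw [div_le_iff₀ hlx0]
    have : C ≤ δ / 24 * Real.log x := by
      have h := mul_le_mul_of_nonneg_left hlx (by positivity : 0 ≤ δ / 24)
      have h' : δ / 24 * (24 * C / δ + 1) = C + δ / 24 := by field_simp
      linarith
    nlinarith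
  -- The total is 2.4 · (0.16 + 1/24) = 0.484 < 1/2.
  calc (J : ℝ) * (16 * (δ / 100) * x + C * x / Real.log x)
      ≤ 2.4 / δ * (16 * (δ / 100) * x + δ / 24 * x) := by gcongr
    _ = (2.4 * (16 / 100 + 1 / 24)) * x := by field_simp
    _ ≤ x / 2 := by linarith

/-- The elementary bounds θ(u) ≥ u log 2 - O(√u log u) and θ(x) ≤ x log 4 leave 2x log 2 > x over
the ratio 4; over the ratio 2 their main terms would cancel. -/
theorem le_theta_sub_theta {x : ℝ} (hx : 200 ^ 4 ≤ x) :
    x ≤ Chebyshev.theta (4 * x) - Chebyshev.theta x := by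
  have h1 := Chebyshev.theta_ge' (x := 4 * x) (by linarith)
  have h2 := Chebyshev.theta_le_log4_mul_x (x := x) (by linarith)
  have hl4 : Real.log 4 = 2 * Real.log 2 := by
    rw [show (4 : ℝ) = 2 ^ 2 by norm_num, Real.log_pow]; norm_num
  have hl2 := Real.log_two_gt_d9
  have hl2' := Real.log_two_lt_d9
  set u := 4 * x with hu
  -- In terms of the fourth root w of u = 4x, the error is at most about 8w³ while the surplus is at
  -- least 0.095 w⁴; w ≥ 200 suffices.
  set w := Real.sqrt (Real.sqrt u) with hw
  have hw2 : w ^ 2 = Real.sqrt u := Real.sq_sqrt (Real.sqrt_nonneg _)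
  have hw4 : w ^ 4 = u := by
    rw [show w ^ 4 = (w ^ 2) ^ 2 by ring, hw2, Real.sq_sqrt (by linarith)]
  have hw200 : 200 ≤ w := by
    rw [hw]
    apply Real.le_sqrt_of_sq_le
    apply Real.le_sqrt_of_sq_le
    linarith
  have hlogu : Real.log u ≤ 4 * w := by
    rw [← hw4, Real.log_pow]
    have := Real.log_le_sub_one_of_pos (x := w) (by linarith)
    push_cast
    linarith
  have hlogu2 : Real.log (u + 2) ≤ 4 * w + 2 := by
    have := Real.log_le_sub_one_of_pos (x := (u + 2) / u) (div_pos (by linarith) (by linarith))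
    rw [Real.log_div (by linarith) (by linarith)] at this
    have h3 : (u + 2) / u ≤ 2 := by rw [div_le_iff₀ (by linarith)]; linarith
    linarith
  rw [← hw2] at h1
  have h5 : 2 * w ^ 2 * Real.log u ≤ 2 * w ^ 2 * (4 * w) := by gcongr
  have h6 : (0.095 : ℝ) * w ^ 4 ≥ 0.095 * 200 * w ^ 3 := by
    have : 200 * w ^ 3 ≤ w * w ^ 3 := by gcongr
    nlinarith
  have h7 : w ^ 3 ≥ 200 * 200 * w := by
    have : 200 * 200 * w ≤ w * w * w := by gcongr
    nlinarith
  rw [hl4] at h2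
  have h8 : x = w ^ 4 / 4 := by rw [hw4, hu]; ring
  have h9 : u * Real.log 2 - 2 * Real.log 2 * x - x ≥ 0.095 * w ^ 4 := by
    rw [← hw4, h8]
    have : 0 ≤ w ^ 4 := by positivity
    nlinarith
  have h10 : (u - 1) * Real.log 2 = u * Real.log 2 - Real.log 2 := by ring
  linarith

open Classical in
/-- If the reciprocals of the primes in `E` are summable, then there are primes outside `E` whose
logarithms differ by an amount comparable to `δ`. -/
theorem exists_primes_log_sub_log_mem {E : Set ℕ}
    (hE : Summable fun p : ℕ ↦ if p.Prime ∧ p ∈ E then 1 / (p : ℝ) else 0)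
    {δ : ℝ} (hδ0 : 0 < δ) (hδ1 : δ ≤ 1) :
    ∃ p q : ℕ, p.Prime ∧ q.Prime ∧ p ∉ E ∧ q ∉ E ∧
      δ / 100 ≤ Real.log q - Real.log p ∧ Real.log q - Real.log p ≤ δ := by
  by_contra! hno
  obtain ⟨X, hX⟩ := exists_sum_log_le_of_separated hδ0 hδ1
  obtain ⟨j₀, hj₀⟩ := pow_unbounded_of_one_lt (max X (200 ^ 4)) (by norm_num : (1 : ℝ) < 4)
  set f : ℕ → ℝ := fun p ↦ if p.Prime ∧ p ∈ E then 1 / (p : ℝ) else 0 with hf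
  have hf0 : ∀ p, 0 ≤ f p := fun p ↦ by simp only [hf]; split_ifs <;> positivity
  -- With x = 4^j, the primes of the window weigh at least x and those outside E at most x/2. Those
  -- in E thus weigh at least x/2, and each satisfies log p ≤ (j + 1) log 4 and 1/p ≥ 1/(4x); since
  -- log 4 < 2, their reciprocals sum to at least 1/(16(j + 1)).
  have hwin : ∀ j, j₀ ≤ j → 1 / 16 * (1 / ((j : ℝ) + 1)) ≤
      ∑ p ∈ Finset.Ioc (4 ^ j) (4 ^ (j + 1)), f p := by
    intro j hj
    set x : ℝ := 4 ^ j with hx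
    have hxj : (4 : ℝ) ^ j₀ ≤ x := pow_le_pow_right₀ (by norm_num) hj
    have hxX : X ≤ x := (le_max_left _ _).trans (hj₀.le.trans hxj)
    have hx200 : 200 ^ 4 ≤ x := (le_max_right _ _).trans (hj₀.le.trans hxj)
    have hx0 : 0 < x := by positivity
    set W := (Finset.Ioc (4 ^ j) (4 ^ (j + 1))).filter Nat.Prime with hW
    have hWmem : ∀ p ∈ W, p.Prime ∧ x < p ∧ (p : ℝ) ≤ 4 * x := by
      intro p hp
      rw [hW, Finset.mem_filter, Finset.mem_Ioc] at hp
      refine ⟨hp.2, ?_, ?_⟩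
      · rw [hx]; exact_mod_cast hp.1.1
      · rw [hx, ← pow_succ']; exact_mod_cast hp.1.2
    have hθ : ∑ p ∈ W, Real.log p = Chebyshev.theta (4 * x) - Chebyshev.theta x := by
      have e1 : ⌊x⌋₊ = 4 ^ j := by rw [hx]; exact_mod_cast Nat.floor_natCast (4 ^ j)
      have e2 : ⌊4 * x⌋₊ = 4 ^ (j + 1) := by
        rw [hx, ← pow_succ']; exact_mod_cast Nat.floor_natCast (4 ^ (j + 1))
      rw [Chebyshev.theta, Chebyshev.theta, e1, e2, hW, Finset.sum_filter, Finset.sum_filter,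
        Finset.sum_filter, eq_sub_iff_add_eq, add_comm]
      exact Finset.sum_Ioc_consecutive _ (Nat.zero_le _) (Nat.pow_le_pow_right (by norm_num) (by omega))
    have hmass := le_theta_sub_theta hx200
    rw [← hθ, ← Finset.sum_filter_add_sum_filter_not W (· ∈ E)] at hmass
    have hgood : ∑ p ∈ W with p ∉ E, Real.log p ≤ x / 2 := by
      refine hX x hxX _ (fun p hp ↦ hWmem p (Finset.mem_filter.1 hp).1) ?_
      intro p hp q hq h
      rw [Finset.mem_filter] at hp hq
      exact absurd h.2 (not_le.2 (hno p q (hWmem p hp.1).1 (hWmem q hq.1).1 hp.2 hq.2 h.1))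
    have hbad : x / 2 ≤ ∑ p ∈ W with p ∈ E, Real.log p := by linarith
    have hlog : Real.log (4 * x) = (j + 1) * Real.log 4 := by
      rw [hx, ← pow_succ', Real.log_pow]; push_cast; ring
    have hterm : ∑ p ∈ W with p ∈ E, Real.log p ≤
        ∑ p ∈ W with p ∈ E, (4 * x * Real.log (4 * x)) * (1 / (p : ℝ)) := by
      refine Finset.sum_le_sum fun p hp ↦ ?_
      obtain ⟨_, h1, h2⟩ := hWmem p (Finset.mem_filter.1 hp).1
      have hp0 : (0 : ℝ) < p := by linarith
      have h3 : Real.log p ≤ Real.log (4 * x) := Real.log_le_log hp0 h2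
      have h4 : 0 ≤ Real.log (4 * x) := Real.log_nonneg (by linarith)
      rw [mul_one_div, le_div_iff₀ hp0]
      nlinarith
    rw [← Finset.mul_sum] at hterm
    have hfs : ∑ p ∈ W with p ∈ E, 1 / (p : ℝ) = ∑ p ∈ Finset.Ioc (4 ^ j) (4 ^ (j + 1)), f p := by
      rw [hW, Finset.filter_filter, Finset.sum_filter]
    rw [hfs, hlog] at hterm
    set s := ∑ p ∈ Finset.Ioc (4 ^ j) (4 ^ (j + 1)), f p
    have hs0 : 0 ≤ s := Finset.sum_nonneg fun p _ ↦ hf0 p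
    have h5 : x / 2 ≤ 4 * x * ((j + 1) * 2) * s := by
      refine (hbad.trans hterm).trans ?_
      gcongr
      linarith [log_four_lt]
    have h6 : 1 / 16 ≤ (j + 1) * s := by nlinarith
    rw [mul_one_div, div_le_iff₀ (by positivity)]
    linarith
  have hsum : ∀ n, 1 / 16 * ∑ j ∈ Finset.Ico j₀ (j₀ + n), 1 / ((j : ℝ) + 1) ≤
      ∑ p ∈ Finset.Ioc (4 ^ j₀) (4 ^ (j₀ + n)), f p := by
    intro n
    induction n with
    | zero => simp
    | succ n ih =>
      rw [← add_assoc, Finset.sum_Ico_succ_top (by omega), mul_add,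
        ← Finset.sum_Ioc_consecutive f (Nat.pow_le_pow_right (by norm_num) (by omega : j₀ ≤ j₀ + n))
          (Nat.pow_le_pow_right (by norm_num) (by omega : j₀ + n ≤ j₀ + n + 1))]
      exact add_le_add ih (hwin (j₀ + n) (by omega))
  -- The windows add up to a tail of the harmonic series, against the summability over E.
  have hdiv := Real.tendsto_sum_range_one_div_nat_succ_atTop
  obtain ⟨n, hn⟩ := (hdiv.eventually (Filter.eventually_gt_atTop
    (16 * ∑' p, f p + ∑ i ∈ Finset.range j₀, 1 / ((i : ℝ) + 1)))).and
      (Filter.eventually_ge_atTop j₀) |>.exists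
  obtain ⟨m, rfl⟩ := Nat.exists_eq_add_of_le hn.2
  have h1 := hsum m
  have h2 : ∑ p ∈ Finset.Ioc (4 ^ j₀) (4 ^ (j₀ + m)), f p ≤ ∑' p, f p :=
    hE.sum_le_tsum _ fun p _ ↦ hf0 p
  have h3 := Finset.sum_range_add_sum_Ico (fun i : ℕ ↦ 1 / ((i : ℝ) + 1)) (by omega : j₀ ≤ j₀ + m)
  linarith [hn.1]

/-! ### Rigidity of functions anti-invariant under almost all prime dilations -/

open Classical in
-- If the defect g(t) + g(t + log p) is at least ε with one fixed sign on a finite set of primes,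
-- nothing cancels and Lε ≤ √(2L), so L ≤ 2/ε². The two signs are treated separately.
theorem summable_inv_of_anti_invariance_defect {g : ℝ → ℝ}
    (hg : ∀ B : Finset ℕ, (∀ p ∈ B, p.Prime) → ∀ t : ℝ,
      |(∑ p ∈ B, 1 / (p : ℝ)) * g t + ∑ p ∈ B, 1 / (p : ℝ) * g (t + Real.log p)| ≤
        Real.sqrt (2 * ∑ p ∈ B, 1 / (p : ℝ)))
    (t : ℝ) {ε : ℝ} (hε : 0 < ε) :
    Summable fun p : ℕ ↦
      if p.Prime ∧ p ∈ {p : ℕ | ε ≤ |g t + g (t + Real.log p)|} then 1 / (p : ℝ) else 0 := by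
  have key : ∀ B : Finset ℕ, (∀ p ∈ B, p.Prime) → ∀ σ : ℝ, |σ| = 1 →
      (∀ p ∈ B, ε ≤ σ * (g t + g (t + Real.log p))) → ∑ p ∈ B, 1 / (p : ℝ) ≤ 2 / ε ^ 2 := by
    intro B hB σ hσ hBε
    have h1 := hg B hB t
    set L := ∑ p ∈ B, 1 / (p : ℝ)
    have hL0 : 0 ≤ L := Finset.sum_nonneg fun p _ ↦ by positivity
    have h2 : L * ε ≤ σ * (L * g t + ∑ p ∈ B, 1 / (p : ℝ) * g (t + Real.log p)) := by
      rw [Finset.sum_mul, Finset.sum_mul, ← Finset.sum_add_distrib, Finset.mul_sum]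
      refine Finset.sum_le_sum fun p hp ↦ ?_
      have := mul_le_mul_of_nonneg_left (hBε p hp) (by positivity : 0 ≤ 1 / (p : ℝ))
      linarith
    have h3 : L * ε ≤ Real.sqrt (2 * L) := by
      refine h2.trans ((le_abs_self _).trans ?_)
      rw [abs_mul, hσ, one_mul]
      exact h1
    have h4 : (L * ε) ^ 2 ≤ 2 * L := by
      rw [← Real.sq_sqrt (by positivity : 0 ≤ 2 * L)]
      gcongr
    rw [le_div_iff₀ (by positivity)]
    rcases hL0.eq_or_lt with h0 | h0
    · rw [← h0]; norm_num
    · have : L * (L * ε ^ 2) ≤ L * 2 := by linarith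
      exact le_of_mul_le_mul_left this h0
  refine summable_of_sum_le (c := 2 / ε ^ 2 + 2 / ε ^ 2)
    (fun p ↦ by positivity) fun u ↦ ?_
  have hle : ∀ p ∈ u, (if p.Prime ∧ p ∈ {p : ℕ | ε ≤ |g t + g (t + Real.log p)|}
      then 1 / (p : ℝ) else 0) ≤
      (if p.Prime ∧ ε ≤ 1 * (g t + g (t + Real.log p)) then 1 / (p : ℝ) else 0) +
      (if p.Prime ∧ ε ≤ -1 * (g t + g (t + Real.log p)) then 1 / (p : ℝ) else 0) := by
    intro p _
    have h0 : 0 ≤ 1 / (p : ℝ) := by positivity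
    by_cases h : p.Prime ∧ p ∈ {p : ℕ | ε ≤ |g t + g (t + Real.log p)|}
    · rw [if_pos h]
      obtain ⟨hp, h⟩ := h
      rcases le_abs.1 (show ε ≤ |g t + g (t + Real.log p)| from h) with h | h
      · rw [if_pos (c := p.Prime ∧ ε ≤ 1 * (g t + g (t + Real.log p))) ⟨hp, by linarith⟩]
        have : 0 ≤ (if p.Prime ∧ ε ≤ -1 * (g t + g (t + Real.log p)) then 1 / (p : ℝ) else 0) := by
          positivity
        linarith
      · rw [if_pos (c := p.Prime ∧ ε ≤ -1 * (g t + g (t + Real.log p))) ⟨hp, by linarith⟩]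
        have : 0 ≤ (if p.Prime ∧ ε ≤ 1 * (g t + g (t + Real.log p)) then 1 / (p : ℝ) else 0) := by
          positivity
        linarith
    · rw [if_neg h]; positivity
  refine (Finset.sum_le_sum hle).trans ?_
  rw [Finset.sum_add_distrib, ← Finset.sum_filter, ← Finset.sum_filter]
  refine add_le_add (key _ ?_ 1 (by simp) ?_) (key _ ?_ (-1) (by simp) ?_) <;>
  · intro p hp
    rw [Finset.mem_filter] at hp
    first | exact hp.2.1 | exact hp.2.2

open Classical in
theorem summable_inv_biUnion {ι : Type*} (s : Finset ι) (E : ι → Set ℕ)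
    (hE : ∀ i ∈ s, Summable fun p : ℕ ↦ if p.Prime ∧ p ∈ E i then 1 / (p : ℝ) else 0) :
    Summable fun p : ℕ ↦ if p.Prime ∧ p ∈ ⋃ i ∈ s, E i then 1 / (p : ℝ) else 0 := by
  refine Summable.of_nonneg_of_le (fun p ↦ by positivity) (fun p ↦ ?_) (summable_sum hE)
  by_cases h : p.Prime ∧ p ∈ ⋃ i ∈ s, E i
  · rw [if_pos h]
    obtain ⟨hp, h⟩ := h
    simp only [Set.mem_iUnion] at h
    obtain ⟨i, hi, hpi⟩ := h
    exact (if_pos (c := p.Prime ∧ p ∈ E i) ⟨hp, hpi⟩).symm.le.trans <| Finset.single_le_sum (f := fun i ↦ if p.Prime ∧ p ∈ E i then 1 / (p : ℝ) else 0)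
      (fun j _ ↦ by positivity) hi
  · rw [if_neg h]
    exact Finset.sum_nonneg fun j _ ↦ by positivity

/-- For non-exceptional p, q and c = log q - log p, one has g(t + c) ≈ -g(t + c + log p) = -g(t +
log q) ≈ g(t). Almost-periods at every small scale and the Lipschitz bound make g constant, and a
constant that is nearly its own negative vanishes. -/
theorem eq_zero_of_anti_invariant {g : ℝ → ℝ} (hlip : ∀ s t, |g s - g t| ≤ 2 * |s - t|)
    (hg : ∀ B : Finset ℕ, (∀ p ∈ B, p.Prime) → ∀ t : ℝ,
      |(∑ p ∈ B, 1 / (p : ℝ)) * g t + ∑ p ∈ B, 1 / (p : ℝ) * g (t + Real.log p)| ≤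
        Real.sqrt (2 * ∑ p ∈ B, 1 / (p : ℝ))) (t : ℝ) : g t = 0 := by
  have hcont : Continuous g := by
    refine (LipschitzWith.of_dist_le_mul (K := 2) fun s t ↦ ?_).continuous
    rw [Real.dist_eq, Real.dist_eq]
    exact hlip s t
  have happrox : ∀ t δ ε : ℝ, 0 < δ → δ ≤ 1 → 0 < ε →
      ∃ c ∈ Set.Icc (δ / 100) δ, |g (t + c) - g t| ≤ ε := by
    intro t δ ε hδ0 hδ1 hε
    set η := ε / 16 with hη
    have hη0 : 0 < η := by positivity
    -- The base point t + c depends on the primes still to be chosen, so exceptional primes are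
    -- discarded at every point t + iη of a grid on [t, t + 1]; the Lipschitz bound covers the
    -- distance from t + c to the grid.
    set s := Finset.range (⌊1 / η⌋₊ + 1)
    have hsum := summable_inv_biUnion s
      (fun i : ℕ ↦ {p : ℕ | ε / 8 ≤ |g (t + i * η) + g (t + i * η + Real.log p)|})
      fun i _ ↦ summable_inv_of_anti_invariance_defect hg _ (by positivity)
    obtain ⟨p, q, -, -, hpE, hqE, h1, h2⟩ := exists_primes_log_sub_log_mem hsum hδ0 hδ1
    simp only [Set.mem_iUnion, Set.mem_ofPred_eq, not_exists, not_le] at hpE hqE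
    set c := Real.log q - Real.log p with hc
    refine ⟨c, ⟨h1, h2⟩, ?_⟩
    have hc0 : 0 ≤ c := by linarith [div_pos hδ0 (by norm_num : (0 : ℝ) < 100)]
    set i := ⌊c / η⌋₊
    have hi : i ∈ s := by
      rw [Finset.mem_range, Nat.lt_add_one_iff]
      apply Nat.floor_le_floor
      gcongr
      linarith
    have hi1 : i * η ≤ c := by
      rw [← le_div_iff₀ hη0]; exact Nat.floor_le (by positivity)
    have hi2 : c - i * η ≤ η := by
      have := Nat.lt_floor_add_one (c / η)
      rw [div_lt_iff₀ hη0] at this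
      change c < (i + 1) * η at this
      linarith
    have hq0 := hqE 0 (Finset.mem_range.2 (by omega))
    have hpi := hpE i hi
    simp only [Nat.cast_zero, zero_mul, add_zero] at hq0
    have e1 := hlip (t + c) (t + i * η)
    have e2 := hlip (t + i * η + Real.log p) (t + Real.log q)
    have e3 : |t + c - (t + i * η)| ≤ η := by
      rw [abs_le]; constructor <;> linarith
    have e4 : |t + i * η + Real.log p - (t + Real.log q)| ≤ η := by
      rw [abs_le]; constructor <;> linarith
    rw [abs_le] at e1 e2 ⊢
    rw [abs_lt] at hq0 hpi
    constructor <;> linarith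
  -- By compactness of [δ/100, δ] the infimum over shifts is attained, so approximate equality for
  -- every ε becomes exact equality.
  have hexact : ∀ t δ : ℝ, 0 < δ → δ ≤ 1 → ∃ c ∈ Set.Icc (δ / 100) δ, g (t + c) = g t := by
    intro t δ hδ0 hδ1
    obtain ⟨c, hc, hmin⟩ := (isCompact_Icc (a := δ / 100) (b := δ)).exists_isMinOn
      (Set.nonempty_Icc.2 (by linarith))
      (f := fun c ↦ |g (t + c) - g t|) (by fun_prop)
    refine ⟨c, hc, ?_⟩
    have h0 : |g (t + c) - g t| ≤ 0 := by
      refine le_of_forall_pos_le_add fun ε hε ↦ ?_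
      obtain ⟨d, hd, hdε⟩ := happrox t δ ε hδ0 hδ1 hε
      have := hmin hd
      simp only [Set.mem_ofPred_eq] at this
      linarith
    have := abs_nonpos_iff.1 h0
    linarith
  -- Exact shifts from t are chained towards s. The lower bound δ/100 keeps their number finite, and
  -- the last gap, at most δ, costs 2δ.
  have hnear : ∀ δ : ℝ, 0 < δ → δ ≤ 1 → ∀ (n : ℕ) (t s : ℝ), t ≤ s → s ≤ t + n * (δ / 100) →
      |g s - g t| ≤ 2 * δ := by
    intro δ hδ0 hδ1 n
    induction n with
    | zero =>
      intro t s h1 h2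
      have : s = t := by simp only [Nat.cast_zero, zero_mul, add_zero] at h2; linarith
      rw [this]; simp; positivity
    | succ n ih =>
      intro t s h1 h2
      obtain ⟨c, hc, hgc⟩ := hexact t δ hδ0 hδ1
      rcases le_total (t + c) s with h | h
      · rw [← hgc]
        refine ih (t + c) s h ?_
        push_cast at h2
        linarith [hc.1]
      · refine (hlip s t).trans ?_
        rw [abs_of_nonneg (by linarith)]
        linarith [hc.2]
  have hconst : ∀ t s : ℝ, t ≤ s → g s = g t := by
    intro t s hts
    have h0 : |g s - g t| ≤ 0 := by
      refine le_of_forall_pos_le_add fun ε hε ↦ ?_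
      set δ := min 1 (ε / 2) with hδ
      have hδ0 : 0 < δ := by positivity
      obtain ⟨n, hn⟩ := exists_nat_ge ((s - t) / (δ / 100))
      rw [div_le_iff₀ (by positivity)] at hn
      have := hnear δ hδ0 (min_le_left _ _) n t s hts (by linarith)
      linarith [min_le_right 1 (ε / 2)]
    have := abs_nonpos_iff.1 h0
    linarith
  have h0 : |2 * g t| ≤ 0 := by
    refine le_of_forall_pos_le_add fun ε hε ↦ ?_
    obtain ⟨p, -, hp, -, hpE, -⟩ := exists_primes_log_sub_log_mem
      (summable_inv_of_anti_invariance_defect hg t hε) one_pos le_rfl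
    simp only [Set.mem_ofPred_eq, not_le] at hpE
    have hlp : 0 ≤ Real.log p := Real.log_natCast_nonneg p
    rw [hconst t (t + Real.log p) (by linarith), ← two_mul] at hpE
    linarith
  have := abs_nonpos_iff.1 h0
  linarith

/-! ### The Turán–Kubilius inequality -/

/-- Expanding the square, L²x cancels and the diagonal leaves Lx. Floors help in the second moment;
in the first they cost 2L|B|, which 2|B| ≤ x absorbs into a second Lx. -/
theorem sum_Ioc_count_dvd_sub_sq_le {B : Finset ℕ} (hB : ∀ p ∈ B, p.Prime) {x : ℝ}
    (hx : 2 * (B.card : ℝ) ≤ x) :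
    ∑ n ∈ Finset.Ioc 0 ⌊x⌋₊, ((∑ p ∈ B, if p ∣ n then (1 : ℝ) else 0) -
      ∑ p ∈ B, 1 / (p : ℝ)) ^ 2 ≤ 2 * (∑ p ∈ B, 1 / (p : ℝ)) * x := by
  have hx0 : 0 ≤ x := le_trans (by positivity) hx
  set L := ∑ p ∈ B, 1 / (p : ℝ) with hL
  have hL0 : 0 ≤ L := Finset.sum_nonneg fun p _ ↦ by positivity
  set N := ⌊x⌋₊
  have hNx : (N : ℝ) ≤ x := Nat.floor_le hx0
  have hxN : x < N + 1 := Nat.lt_floor_add_one x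
  have hcount : ∀ d : ℕ, ∑ n ∈ Finset.Ioc 0 N, (if d ∣ n then (1 : ℝ) else 0) = (N / d : ℕ) := by
    intro d
    rw [Finset.sum_boole, Nat.Ioc_filter_dvd_card_eq_div]
  have h1 : L * x - B.card ≤ ∑ n ∈ Finset.Ioc 0 N, ∑ p ∈ B, if p ∣ n then (1 : ℝ) else 0 := by
    rw [Finset.sum_comm, hL, Finset.sum_mul, Finset.card_eq_sum_ones, Nat.cast_sum,
      ← Finset.sum_sub_distrib]
    refine Finset.sum_le_sum fun p hp ↦ ?_
    rw [hcount, ← Nat.floor_div_natCast]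
    have := Nat.lt_floor_add_one (x / p)
    rw [Nat.cast_one, one_div_mul_eq_div]
    linarith
  have h2 : ∑ n ∈ Finset.Ioc 0 N, (∑ p ∈ B, if p ∣ n then (1 : ℝ) else 0) ^ 2 ≤
      (L ^ 2 + L) * x := by
    have e1 : ∑ n ∈ Finset.Ioc 0 N, (∑ p ∈ B, if p ∣ n then (1 : ℝ) else 0) ^ 2 =
        ∑ p ∈ B, ∑ q ∈ B, ∑ n ∈ Finset.Ioc 0 N, (if p ∣ n ∧ q ∣ n then (1 : ℝ) else 0) := by
      simp_rw [sq, Finset.sum_mul_sum]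
      rw [Finset.sum_comm]
      refine Finset.sum_congr rfl fun p _ ↦ ?_
      rw [Finset.sum_comm]
      refine Finset.sum_congr rfl fun q _ ↦ Finset.sum_congr rfl fun n _ ↦ ?_
      split_ifs <;> simp_all
    have e2 : ∀ p ∈ B, ∀ q ∈ B, ∑ n ∈ Finset.Ioc 0 N, (if p ∣ n ∧ q ∣ n then (1 : ℝ) else 0) ≤
        1 / (p : ℝ) * (1 / (q : ℝ)) * x + if p = q then 1 / (p : ℝ) * x else 0 := by
      intro p hp q hq
      have hdiv : ∀ d : ℕ, ((N / d : ℕ) : ℝ) ≤ 1 / (d : ℝ) * x := by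
        intro d
        refine Nat.cast_div_le.trans ?_
        rw [one_div_mul_eq_div]
        gcongr
      by_cases hpq : p = q
      · subst hpq
        simp only [and_self, if_true]
        rw [hcount]
        have : 0 ≤ 1 / (p : ℝ) * (1 / (p : ℝ)) * x := by positivity
        linarith [hdiv p]
      · rw [if_neg hpq, add_zero]
        have hcop : p.Coprime q := (Nat.coprime_primes (hB p hp) (hB q hq)).2 hpq
        have : ∀ n, (p ∣ n ∧ q ∣ n) ↔ p * q ∣ n := fun n ↦
          ⟨fun h ↦ hcop.mul_dvd_of_dvd_of_dvd h.1 h.2,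
            fun h ↦ ⟨(dvd_mul_right p q).trans h, (dvd_mul_left q p).trans h⟩⟩
        simp_rw [this]
        rw [hcount]
        refine (hdiv _).trans (le_of_eq ?_)
        push_cast
        rw [one_div_mul_one_div]
    rw [e1]
    refine (Finset.sum_le_sum fun p hp ↦ Finset.sum_le_sum fun q hq ↦ e2 p hp q hq).trans
      (le_of_eq ?_)
    simp_rw [Finset.sum_add_distrib]
    rw [add_mul, sq, hL, Finset.sum_mul_sum, Finset.sum_mul, Finset.sum_mul]
    congr 1
    · exact Finset.sum_congr rfl fun p _ ↦ (Finset.sum_mul _ _ _).symm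
    · refine Finset.sum_congr rfl fun p hp ↦ ?_
      rw [Finset.sum_ite_eq, if_pos hp]
  have h3 : ∑ n ∈ Finset.Ioc 0 N, ((∑ p ∈ B, if p ∣ n then (1 : ℝ) else 0) - L) ^ 2 =
      ∑ n ∈ Finset.Ioc 0 N, (∑ p ∈ B, if p ∣ n then (1 : ℝ) else 0) ^ 2
      - 2 * L * ∑ n ∈ Finset.Ioc 0 N, (∑ p ∈ B, if p ∣ n then (1 : ℝ) else 0) + N * L ^ 2 := by
    simp_rw [sub_sq]
    rw [Finset.sum_add_distrib, Finset.sum_sub_distrib, Finset.mul_sum]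
    simp only [Finset.sum_const, Nat.card_Ioc, nsmul_eq_mul, Nat.sub_zero]
    congr 2
    exact Finset.sum_congr rfl fun n _ ↦ by ring
  rw [h3]
  have h4 : (N : ℝ) * L ^ 2 ≤ x * L ^ 2 := by gcongr
  nlinarith

theorem sum_Ioc_mul_count_dvd {B : Finset ℕ} (hB : ∀ p ∈ B, p.Prime) (a : ℕ → ℝ) (x : ℝ) :
    ∑ n ∈ Finset.Ioc 0 ⌊x⌋₊, a n * ∑ p ∈ B, (if p ∣ n then (1 : ℝ) else 0) =
      ∑ p ∈ B, ∑ m ∈ Finset.Ioc 0 ⌊x / p⌋₊, a (p * m) := by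
  simp_rw [Finset.mul_sum]
  rw [Finset.sum_comm]
  refine Finset.sum_congr rfl fun p hp ↦ ?_
  have hp0 := (hB p hp).pos
  simp_rw [mul_ite, mul_one, mul_zero]
  rw [← Finset.sum_filter]
  symm
  refine Finset.sum_bij (fun m _ ↦ p * m) ?_ ?_ ?_ ?_
  · intro m hm
    rw [Finset.mem_Ioc, Nat.floor_div_natCast, Nat.le_div_iff_mul_le hp0] at hm
    rw [Finset.mem_filter, Finset.mem_Ioc]
    exact ⟨⟨Nat.mul_pos hp0 hm.1, by rw [mul_comm]; exact hm.2⟩, dvd_mul_right p m⟩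
  · intro m _ m' _ h
    exact Nat.eq_of_mul_eq_mul_left hp0 h
  · intro n hn
    rw [Finset.mem_filter, Finset.mem_Ioc] at hn
    obtain ⟨m, rfl⟩ := hn.2
    refine ⟨m, ?_, rfl⟩
    rw [Finset.mem_Ioc, Nat.floor_div_natCast, Nat.le_div_iff_mul_le hp0]
    exact ⟨Nat.pos_of_mul_pos_left hn.1.1, by rw [mul_comm]; exact hn.1.2⟩
  · intro m _; rfl

/-- The dual form: the left side is Σ a(n)(L - #{p ∈ B : p ∣ n}), and Cauchy–Schwarz reduces it to
the variance bound. -/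
theorem turan_kubilius {B : Finset ℕ} (hB : ∀ p ∈ B, p.Prime) {x : ℝ}
    (hx : 2 * (B.card : ℝ) ≤ x) {a : ℕ → ℝ} (ha : ∀ n, |a n| ≤ 1) :
    |(∑ p ∈ B, 1 / (p : ℝ)) * ∑ n ∈ Finset.Ioc 0 ⌊x⌋₊, a n -
      ∑ p ∈ B, ∑ m ∈ Finset.Ioc 0 ⌊x / p⌋₊, a (p * m)| ≤
      x * Real.sqrt (2 * ∑ p ∈ B, 1 / (p : ℝ)) := by
  have hx0 : 0 ≤ x := le_trans (by positivity) hx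
  rw [← sum_Ioc_mul_count_dvd hB, mul_comm, Finset.sum_mul, ← Finset.sum_sub_distrib]
  simp_rw [← mul_sub]
  have hvar := sum_Ioc_count_dvd_sub_sq_le hB hx
  set L := ∑ p ∈ B, 1 / (p : ℝ)
  have hL0 : 0 ≤ L := Finset.sum_nonneg fun p _ ↦ by positivity
  have hcs := Finset.sum_mul_sq_le_sq_mul_sq (Finset.Ioc 0 ⌊x⌋₊) a
    (fun n ↦ L - ∑ p ∈ B, if p ∣ n then (1 : ℝ) else 0)
  have h1 : ∑ n ∈ Finset.Ioc 0 ⌊x⌋₊, a n ^ 2 ≤ x := by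
    calc _ ≤ ∑ n ∈ Finset.Ioc 0 ⌊x⌋₊, (1 : ℝ) :=
          Finset.sum_le_sum fun n _ ↦ (sq_le_one_iff_abs_le_one _).2 (ha n)
      _ ≤ x := by simp [Nat.floor_le hx0]
  have h2 : ∑ n ∈ Finset.Ioc 0 ⌊x⌋₊, (L - ∑ p ∈ B, if p ∣ n then (1 : ℝ) else 0) ^ 2 ≤
      2 * L * x := by
    refine le_trans (le_of_eq (Finset.sum_congr rfl fun n _ ↦ ?_)) hvar
    ring
  refine abs_le_of_sq_le_sq ?_ (by positivity)
  rw [mul_pow, Real.sq_sqrt (by positivity)]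
  calc _ ≤ _ := hcs
    _ ≤ x * (2 * L * x) := mul_le_mul h1 h2 (Finset.sum_nonneg fun _ _ ↦ sq_nonneg _) hx0
    _ = _ := by ring

/-! ### Averages of asymptotically anti-invariant functions -/

/-- The average of `a` over `1 ≤ n ≤ N e⁻ᵗ`, up to the rounding of `N e⁻ᵗ`. -/
noncomputable def dilatedAverage (a : ℕ → ℝ) (N : ℕ) (t : ℝ) : ℝ :=
  Real.exp t / N * ∑ n ∈ Finset.Ioc 0 ⌊N * Real.exp (-t)⌋₊, a n

theorem abs_sum_Ioc_le_sub {a : ℕ → ℝ} (ha : ∀ n, |a n| ≤ 1) {m n : ℕ} (hmn : m ≤ n) :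
    |∑ k ∈ Finset.Ioc m n, a k| ≤ (n : ℝ) - m := by
  calc _ ≤ ∑ k ∈ Finset.Ioc m n, |a k| := Finset.abs_sum_le_sum_abs _ _
    _ ≤ ∑ k ∈ Finset.Ioc m n, (1 : ℝ) := Finset.sum_le_sum fun k _ ↦ ha k
    _ = _ := by simp [Nat.cast_sub hmn]

theorem exp_div_mul_mul_exp_neg {N : ℕ} (hN : 0 < N) (t : ℝ) :
    Real.exp t / N * (N * Real.exp (-t)) = 1 := by
  have : (N : ℝ) ≠ 0 := by positivity
  rw [Real.exp_neg]
  field_simp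

theorem abs_dilatedAverage_le {a : ℕ → ℝ} (ha : ∀ n, |a n| ≤ 1) (N : ℕ) (t : ℝ) :
    |dilatedAverage a N t| ≤ 1 := by
  rcases N.eq_zero_or_pos with rfl | hN
  · simp [dilatedAverage]
  rw [dilatedAverage, abs_mul, abs_of_nonneg (by positivity : 0 ≤ Real.exp t / N)]
  have h := abs_sum_Ioc_le_sub ha (Nat.zero_le ⌊N * Real.exp (-t)⌋₊)
  have h2 : (⌊N * Real.exp (-t)⌋₊ : ℝ) ≤ N * Real.exp (-t) := Nat.floor_le (by positivity)
  rw [← exp_div_mul_mul_exp_neg hN t]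
  gcongr
  push_cast at h
  linarith

/-- One t - s comes from the change of normalisation and one from the terms dropped; e^s/N is
rounding and disappears in the limit N → ∞. -/
theorem abs_dilatedAverage_sub_le {a : ℕ → ℝ} (ha : ∀ n, |a n| ≤ 1) {N : ℕ} (hN : 0 < N)
    {s t : ℝ} (hst : s ≤ t) :
    |dilatedAverage a N t - dilatedAverage a N s| ≤ 2 * (t - s) + Real.exp s / N := by
  have hN0 : (0 : ℝ) < N := by exact_mod_cast hN
  have hexp : 1 - Real.exp (s - t) ≤ t - s := by linarith [Real.add_one_le_exp (s - t)]
  have hfl : ⌊N * Real.exp (-t)⌋₊ ≤ ⌊N * Real.exp (-s)⌋₊ := by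
    apply Nat.floor_le_floor
    gcongr
  have h1 := abs_sum_Ioc_le_sub ha (Nat.zero_le ⌊N * Real.exp (-t)⌋₊)
  have h2 := abs_sum_Ioc_le_sub ha hfl
  have h3 : (⌊N * Real.exp (-t)⌋₊ : ℝ) ≤ N * Real.exp (-t) := Nat.floor_le (by positivity)
  have h4 : (⌊N * Real.exp (-s)⌋₊ : ℝ) ≤ N * Real.exp (-s) := Nat.floor_le (by positivity)
  have h5 : N * Real.exp (-t) < ⌊N * Real.exp (-t)⌋₊ + 1 := Nat.lt_floor_add_one _
  have hsplit := Finset.sum_Ioc_consecutive a (Nat.zero_le _) hfl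
  rw [dilatedAverage, dilatedAverage, ← hsplit]
  set T := ∑ k ∈ Finset.Ioc 0 ⌊N * Real.exp (-t)⌋₊, a k
  set D := ∑ k ∈ Finset.Ioc ⌊N * Real.exp (-t)⌋₊ ⌊N * Real.exp (-s)⌋₊, a k
  have e1 : Real.exp t / N * T - Real.exp s / N * (T + D) =
      (Real.exp t - Real.exp s) / N * T - Real.exp s / N * D := by ring
  have hts : 0 ≤ Real.exp t - Real.exp s := sub_nonneg.2 (Real.exp_le_exp.2 hst)
  have e2 : |(Real.exp t - Real.exp s) / N * T| ≤ t - s := by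
    rw [abs_mul, abs_of_nonneg (by positivity)]
    calc _ ≤ (Real.exp t - Real.exp s) / N * (N * Real.exp (-t)) := by
          gcongr
          push_cast at h1
          linarith
      _ = (Real.exp t * Real.exp (-t)) - (Real.exp s * Real.exp (-t)) := by field_simp
      _ = 1 - Real.exp (s - t) := by rw [← Real.exp_add, ← Real.exp_add]; simp [sub_eq_add_neg]
      _ ≤ _ := hexp
  have e3 : |Real.exp s / N * D| ≤ t - s + Real.exp s / N := by
    rw [abs_mul, abs_of_nonneg (by positivity : 0 ≤ Real.exp s / N)]
    calc _ ≤ Real.exp s / N * (N * Real.exp (-s) - N * Real.exp (-t) + 1) := by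
          gcongr
          linarith
      _ = (Real.exp s * Real.exp (-s)) - (Real.exp s * Real.exp (-t)) + Real.exp s / N := by
          field_simp
      _ = 1 - Real.exp (s - t) + Real.exp s / N := by
          rw [← Real.exp_add, ← Real.exp_add]; simp [sub_eq_add_neg]
      _ ≤ _ := by linarith
  rw [e1]
  refine (abs_sub _ _).trans ?_
  linarith

/-- Turán–Kubilius divided by x = N e^{-t}: passing from x to x/p is the shift t ↦ t + log p, and
anti-invariance replaces a(pm) by -a(m) up to ε. -/
theorem abs_sum_dilatedAverage_le {a : ℕ → ℝ} (ha : ∀ n, |a n| ≤ 1) {N : ℕ} (hN : 0 < N)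
    {B : Finset ℕ} (hB : ∀ p ∈ B, p.Prime) {t ε : ℝ} (hNt : 2 * (B.card : ℝ) ≤ N * Real.exp (-t))
    (hε : 0 ≤ ε) (hanti : ∀ p ∈ B, ∀ n, 0 < n → |a (p * n) + a n| ≤ ε) :
    |(∑ p ∈ B, 1 / (p : ℝ)) * dilatedAverage a N t +
        ∑ p ∈ B, 1 / (p : ℝ) * dilatedAverage a N (t + Real.log p)| ≤
      Real.sqrt (2 * ∑ p ∈ B, 1 / (p : ℝ)) + (∑ p ∈ B, 1 / (p : ℝ)) * ε := by
  have hN0 : (0 : ℝ) < N := by exact_mod_cast hN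
  have htk := turan_kubilius hB hNt ha
  set x : ℝ := N * Real.exp (-t) with hx
  have hx0 : 0 < x := by positivity
  have hinv : Real.exp t / N = 1 / x := by
    rw [eq_div_iff hx0.ne', hx, exp_div_mul_mul_exp_neg hN]
  have hp : ∀ p ∈ B, 1 / (p : ℝ) * dilatedAverage a N (t + Real.log p) =
      1 / x * ∑ m ∈ Finset.Ioc 0 ⌊x / p⌋₊, a m := by
    intro p hp
    have hp0 : (0 : ℝ) < p := by exact_mod_cast (hB p hp).pos
    have h1 : N * Real.exp (-(t + Real.log p)) = x / p := by
      rw [neg_add, Real.exp_add, Real.exp_neg (Real.log p), Real.exp_log hp0, hx]; ring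
    have h2 : 1 / (p : ℝ) * (Real.exp (t + Real.log p) / N) = 1 / x := by
      rw [Real.exp_add, Real.exp_log hp0, ← hinv]; field_simp
    rw [dilatedAverage, h1, ← mul_assoc, h2]
  rw [Finset.sum_congr rfl hp, dilatedAverage, ← hx, hinv]
  have herr : |∑ p ∈ B, ∑ m ∈ Finset.Ioc 0 ⌊x / p⌋₊, a (p * m) +
      ∑ p ∈ B, ∑ m ∈ Finset.Ioc 0 ⌊x / p⌋₊, a m| ≤ x * ((∑ p ∈ B, 1 / (p : ℝ)) * ε) := by
    rw [← Finset.sum_add_distrib, ← mul_assoc, Finset.mul_sum, Finset.sum_mul]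
    refine (Finset.abs_sum_le_sum_abs _ _).trans (Finset.sum_le_sum fun p hp ↦ ?_)
    rw [← Finset.sum_add_distrib]
    calc _ ≤ ∑ m ∈ Finset.Ioc 0 ⌊x / p⌋₊, |a (p * m) + a m| := Finset.abs_sum_le_sum_abs _ _
      _ ≤ ∑ m ∈ Finset.Ioc 0 ⌊x / p⌋₊, ε :=
          Finset.sum_le_sum fun m hm ↦ hanti p hp m (Finset.mem_Ioc.1 hm).1
      _ = ⌊x / p⌋₊ * ε := by simp
      _ ≤ x * (1 / p) * ε := by
          rw [mul_one_div]
          gcongr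
          exact Nat.floor_le (by positivity)
  set L := ∑ p ∈ B, 1 / (p : ℝ)
  rw [← Finset.mul_sum]
  set S := ∑ n ∈ Finset.Ioc 0 ⌊x⌋₊, a n
  set Q := ∑ p ∈ B, ∑ m ∈ Finset.Ioc 0 ⌊x / p⌋₊, a m
  set R := ∑ p ∈ B, ∑ m ∈ Finset.Ioc 0 ⌊x / p⌋₊, a (p * m)
  have e1 : L * (1 / x * S) + 1 / x * Q = 1 / x * ((L * S - R) + (R + Q)) := by ring
  rw [e1, abs_mul, abs_of_pos (by positivity : 0 < 1 / x), one_div_mul_eq_div, div_le_iff₀ hx0]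
  refine (abs_add_le _ _).trans ?_
  linarith

open Filter Topology in
theorem tendsto_average_of_anti_invariant {a : ℕ → ℕ → ℝ} (ha : ∀ N n, |a N n| ≤ 1)
    (hanti : ∀ p : ℕ, p.Prime → ∀ ε > 0, ∀ᶠ N in atTop, ∀ n, 0 < n →
      |a N (p * n) + a N n| ≤ ε) :
    Tendsto (fun N : ℕ ↦ (∑ n ∈ Finset.Ioc 0 N, a N n) / N) atTop (𝓝 0) := by
  have hM : (fun N : ℕ ↦ (∑ n ∈ Finset.Ioc 0 N, a N n) / N) =
      fun N ↦ dilatedAverage (a N) N 0 := by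
    funext N
    simp [dilatedAverage, div_eq_inv_mul]
  rw [hM, tendsto_iff_ultrafilter]
  intro U hU
  -- An ultrafilter gives limits for all real t at once, without extracting subsequences.
  have hlim : ∀ t, ∃ l, Tendsto (fun N ↦ dilatedAverage (a N) N t) U (𝓝 l) := by
    intro t
    obtain ⟨l, -, hl⟩ := (isCompact_Icc (a := (-1 : ℝ)) (b := 1)).ultrafilter_le_nhds
      (U.map fun N ↦ dilatedAverage (a N) N t) (by
        rw [le_principal_iff]
        exact Filter.mem_map.2 <| Filter.univ_mem' fun N : ℕ ↦ abs_le.1 (abs_dilatedAverage_le (ha N) N t))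
    exact ⟨l, hl⟩
  choose g hg using hlim
  have hpos : ∀ᶠ N : ℕ in U, 0 < N := hU (eventually_gt_atTop 0)
  have hlip' : ∀ s t, s ≤ t → |g t - g s| ≤ 2 * (t - s) := by
    intro s t hst
    have h1 : Tendsto (fun N : ℕ ↦ 2 * (t - s) + Real.exp s / N) U (𝓝 (2 * (t - s) + 0)) :=
      tendsto_const_nhds.add ((tendsto_const_div_atTop_nhds_zero_nat _).mono_left hU)
    rw [add_zero] at h1
    refine le_of_tendsto_of_tendsto ((hg t).sub (hg s)).abs h1 ?_
    filter_upwards [hpos] with N hN using abs_dilatedAverage_sub_le (ha N) hN hst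
  have hlip : ∀ s t, |g s - g t| ≤ 2 * |s - t| := by
    intro s t
    rcases le_total s t with h | h
    · rw [abs_sub_comm, abs_sub_comm s t, abs_of_nonneg (sub_nonneg.2 h)]
      exact hlip' s t h
    · rw [abs_of_nonneg (sub_nonneg.2 h)]
      exact hlip' t s h
  have hfun : ∀ B : Finset ℕ, (∀ p ∈ B, p.Prime) → ∀ t : ℝ,
      |(∑ p ∈ B, 1 / (p : ℝ)) * g t + ∑ p ∈ B, 1 / (p : ℝ) * g (t + Real.log p)| ≤
        Real.sqrt (2 * ∑ p ∈ B, 1 / (p : ℝ)) := by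
    intro B hB t
    have hL0 : 0 ≤ ∑ p ∈ B, 1 / (p : ℝ) := Finset.sum_nonneg fun p _ ↦ by positivity
    have hle : ∀ ε > 0, |(∑ p ∈ B, 1 / (p : ℝ)) * g t +
        ∑ p ∈ B, 1 / (p : ℝ) * g (t + Real.log p)| ≤
        Real.sqrt (2 * ∑ p ∈ B, 1 / (p : ℝ)) + (∑ p ∈ B, 1 / (p : ℝ)) * ε := by
      intro ε hε
      refine le_of_tendsto (((hg t).const_mul _).add
        (tendsto_finsetSum B fun p _ ↦ (hg (t + Real.log p)).const_mul _)).abs ?_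
      have hev : ∀ᶠ N : ℕ in atTop, ∀ p ∈ B, ∀ n, 0 < n → |a N (p * n) + a N n| ≤ ε := by
        rw [Filter.eventually_all_finset]
        exact fun p hp ↦ hanti p (hB p hp) ε hε
      have hlarge : ∀ᶠ N : ℕ in atTop, 2 * (B.card : ℝ) ≤ N * Real.exp (-t) :=
        (tendsto_natCast_atTop_atTop.atTop_mul_const (Real.exp_pos _)).eventually_ge_atTop _
      filter_upwards [hpos, hU hev, hU hlarge] with N hN h1 h2
      exact abs_sum_dilatedAverage_le (ha N) hN hB h2 hε.le h1
    have hlim : Tendsto (fun ε ↦ Real.sqrt (2 * ∑ p ∈ B, 1 / (p : ℝ)) +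
        (∑ p ∈ B, 1 / (p : ℝ)) * ε) (𝓝[>] 0)
        (𝓝 (Real.sqrt (2 * ∑ p ∈ B, 1 / (p : ℝ)) + (∑ p ∈ B, 1 / (p : ℝ)) * 0)) :=
      (Continuous.tendsto (by fun_prop) 0).mono_left nhdsWithin_le_nhds
    rw [mul_zero, add_zero] at hlim
    exact ge_of_tendsto hlim (eventually_mem_nhdsWithin.mono fun ε hε ↦ hle ε hε)
  have h0 := eq_zero_of_anti_invariant hlip hfun 0
  have h1 := hg 0
  rwa [h0] at h1

/-! ### Liouville-weighted averages -/

open Filter Topology in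
theorem tendsto_log_log_natCast : Tendsto (fun N : ℕ ↦ Real.log (Real.log N)) atTop atTop :=
  Real.tendsto_log_atTop.comp (Real.tendsto_log_atTop.comp tendsto_natCast_atTop_atTop)

theorem normalizedOmega_prime_mul {p n : ℕ} (hp : p.Prime) (hn : 0 < n) (N : ℕ) :
    normalizedOmega N (p * n) =
      normalizedOmega N n + 1 / Real.sqrt (Real.log (Real.log N)) := by
  rw [normalizedOmega, normalizedOmega, ArithmeticFunction.cardFactors_mul hp.ne_zero hn.ne',
    ArithmeticFunction.cardFactors_apply_prime hp]
  push_cast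
  ring

theorem abs_liouville_le_one (n : ℕ) : |(ArithmeticFunction.liouville n : ℝ)| ≤ 1 := by
  rcases eq_or_ne n 0 with rfl | hn
  · simp
  · rw [ArithmeticFunction.liouville_apply hn]; simp

open Filter Topology in
-- Stated for bounded uniformly continuous F rather than compactly supported F, so that F = 1 is
-- included; that case says that Ω is even with density 1/2.
theorem tendsto_average_mul_liouville {F : ℝ → ℝ} (hF : UniformContinuous F)
    {K : ℝ} (hK : ∀ x, |F x| ≤ K) :
    Tendsto (fun N : ℕ ↦ (∑ n ∈ Finset.Ioc 0 N,
      F (normalizedOmega N n) * (ArithmeticFunction.liouville n : ℝ)) / N) atTop (𝓝 0) := by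
  have hK0 : 0 ≤ K := (abs_nonneg _).trans (hK 0)
  -- Rescaling by K + 1 rather than K avoids division by zero when K = 0.
  have h := tendsto_average_of_anti_invariant
    (a := fun N n ↦ (K + 1)⁻¹ * (F (normalizedOmega N n) * (ArithmeticFunction.liouville n : ℝ)))
    (fun N n ↦ by
      rw [abs_mul, abs_mul, abs_of_pos (by positivity), inv_mul_le_iff₀ (by positivity), mul_one]
      calc _ ≤ K * 1 := mul_le_mul (hK _) (abs_liouville_le_one n) (abs_nonneg _) hK0
        _ ≤ _ := by linarith)
    (fun p hp ε hε ↦ by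
      obtain ⟨δ, hδ, hδF⟩ := Metric.uniformContinuous_iff.1 hF ε hε
      have hs : Tendsto (fun N : ℕ ↦ 1 / Real.sqrt (Real.log (Real.log N))) atTop (𝓝 0) := by
        simp_rw [one_div]
        exact tendsto_inv_atTop_zero.comp (Real.tendsto_sqrt_atTop.comp tendsto_log_log_natCast)
      filter_upwards [hs.eventually (Metric.ball_mem_nhds 0 hδ)] with N hN n hn
      rw [Real.dist_eq, sub_zero] at hN
      rw [ArithmeticFunction.liouville_apply_mul, normalizedOmega_prime_mul hp hn,
        ArithmeticFunction.liouville_apply hp.ne_zero,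
        ArithmeticFunction.cardFactors_apply_prime hp]
      set u := normalizedOmega N n
      set v := 1 / Real.sqrt (Real.log (Real.log N))
      have h1 : |F u - F (u + v)| ≤ ε := by
        have := hδF (a := u) (b := u + v) (by simpa [Real.dist_eq] using hN)
        rw [Real.dist_eq] at this
        exact this.le
      have e1 : (K + 1)⁻¹ * (F (u + v) *
          (((-1) ^ 1 * ArithmeticFunction.liouville n : ℤ) : ℝ)) +
          (K + 1)⁻¹ * (F u * (ArithmeticFunction.liouville n : ℝ)) =
          (K + 1)⁻¹ * ((F u - F (u + v)) * (ArithmeticFunction.liouville n : ℝ)) := by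
        push_cast; ring
      rw [e1, abs_mul, abs_mul, abs_of_pos (by positivity), inv_mul_le_iff₀ (by positivity)]
      calc _ ≤ ε * 1 := mul_le_mul h1 (abs_liouville_le_one n) (abs_nonneg _) hε.le
        _ ≤ _ := by nlinarith)
  have h2 := h.const_mul (K + 1)
  rw [mul_zero] at h2
  refine h2.congr fun N ↦ ?_
  rw [← Finset.mul_sum]
  field_simp

/-! ### Mertens' second theorem -/

theorem summable_log_div_sq : Summable fun n : ℕ ↦ Real.log n / (n : ℝ) ^ 2 := by
  have hs : Summable fun n : ℕ ↦ 2 * (1 / (n : ℝ) ^ (3 / 2 : ℝ)) :=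
    (Real.summable_one_div_nat_rpow.2 (by norm_num)).mul_left 2
  refine Summable.of_nonneg_of_le
    (fun n ↦ div_nonneg (Real.log_natCast_nonneg n) (by positivity)) (fun n ↦ ?_) hs
  rcases n.eq_zero_or_pos with rfl | hn
  · simp [Real.zero_rpow]
  have hn0 : (0 : ℝ) < n := by exact_mod_cast hn
  have h1 := Real.log_le_rpow_div hn0.le (by norm_num : (0 : ℝ) < 1 / 2)
  have h2 : (n : ℝ) ^ 2 = (n : ℝ) ^ (3 / 2 : ℝ) * (n : ℝ) ^ (1 / 2 : ℝ) := by
    rw [← Real.rpow_add hn0, ← Real.rpow_natCast]; norm_num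
  have h3 : 0 < (n : ℝ) ^ (1 / 2 : ℝ) := by positivity
  rw [h2, div_le_iff₀ (by positivity)]
  calc Real.log n ≤ (n : ℝ) ^ (1 / 2 : ℝ) / (1 / 2) := h1
    _ = _ := by field_simp

theorem sum_Icc_two_one_div_pow_le {p : ℕ} (hp : 2 ≤ p) (K : ℕ) :
    ∑ k ∈ Finset.Icc 2 K, 1 / (p : ℝ) ^ k ≤ 2 / (p : ℝ) ^ 2 := by
  have hp2 : (2 : ℝ) ≤ p := by exact_mod_cast hp
  have h : ∀ K, ∑ k ∈ Finset.Ico 2 (2 + K), 1 / (p : ℝ) ^ k ≤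
      2 / (p : ℝ) ^ 2 - 2 / (p : ℝ) ^ (2 + K) := by
    intro K
    induction K with
    | zero => simp
    | succ K ih =>
      rw [← add_assoc, Finset.sum_Ico_succ_top (by omega)]
      have h2 : 1 / (p : ℝ) ^ (2 + K) + 2 / (p : ℝ) ^ (2 + K + 1) ≤ 2 / (p : ℝ) ^ (2 + K) := by
        have h3 : 2 / (p : ℝ) ^ (2 + K + 1) ≤ 1 / (p : ℝ) ^ (2 + K) := by
          rw [div_le_div_iff₀ (by positivity) (by positivity), pow_succ, one_mul, mul_comm]
          gcongr
        have h4 : 2 / (p : ℝ) ^ (2 + K) = 1 / (p : ℝ) ^ (2 + K) + 1 / (p : ℝ) ^ (2 + K) := by ring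
        linarith
      linarith
  have hsub : Finset.Icc 2 K ⊆ Finset.Ico 2 (2 + K) := by
    intro k hk
    rw [Finset.mem_Icc] at hk
    rw [Finset.mem_Ico]
    omega
  refine (Finset.sum_le_sum_of_subset_of_nonneg hsub fun _ _ _ ↦ by positivity).trans
    ((h K).trans ?_)
  have : 0 ≤ 2 / (p : ℝ) ^ (2 + K) := by positivity
  linarith

open ArithmeticFunction in
-- Proper prime powers contribute at most Σ 2 log p / p², which converges.
theorem exists_abs_sum_prime_log_div_sub_log_le :
    ∃ C : ℝ, 0 ≤ C ∧ ∀ N : ℕ, 1 ≤ N →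
      |∑ p ∈ Finset.Ioc 0 N with p.Prime, Real.log p / p - Real.log N| ≤ C := by
  obtain ⟨C, hC0, hC⟩ := exists_abs_sum_vonMangoldt_div_sub_log_le
  set D := ∑' n : ℕ, Real.log n / (n : ℝ) ^ 2
  have hD0 : 0 ≤ D := tsum_nonneg fun n ↦ div_nonneg (Real.log_natCast_nonneg n) (by positivity)
  refine ⟨C + 2 * D, by positivity, fun N hN ↦ ?_⟩
  have h1 := hC N (by exact_mod_cast hN)
  rw [Nat.floor_natCast] at h1
  have hsplit := Finset.sum_filter_add_sum_filter_not (Finset.Ioc 0 N) Nat.Prime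
    (fun n ↦ vonMangoldt n / (n : ℝ))
  have hprime : ∑ p ∈ Finset.Ioc 0 N with p.Prime, vonMangoldt p / (p : ℝ) =
      ∑ p ∈ Finset.Ioc 0 N with p.Prime, Real.log p / p := by
    refine Finset.sum_congr rfl fun p hp ↦ ?_
    rw [vonMangoldt_apply_prime (Finset.mem_filter.1 hp).2]
  have hnn : 0 ≤ ∑ n ∈ Finset.Ioc 0 N with ¬ n.Prime, vonMangoldt n / (n : ℝ) :=
    Finset.sum_nonneg fun n _ ↦ div_nonneg vonMangoldt_nonneg (by positivity)
  have hnot : ∑ n ∈ Finset.Ioc 0 N with ¬ n.Prime, vonMangoldt n / (n : ℝ) ≤ 2 * D := by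
    set T := ((Finset.Ioc 0 N).filter Nat.Prime) ×ˢ Finset.Icc 2 N
    have hle : ∑ n ∈ Finset.Ioc 0 N with ¬ n.Prime, vonMangoldt n / (n : ℝ) ≤
        ∑ n ∈ T.image (fun y ↦ y.1 ^ y.2), vonMangoldt n / (n : ℝ) := by
      rw [← Finset.sum_filter_ne_zero (s := (Finset.Ioc 0 N).filter fun n ↦ ¬ n.Prime)]
      refine Finset.sum_le_sum_of_subset_of_nonneg ?_
        fun n _ _ ↦ div_nonneg vonMangoldt_nonneg (by positivity)
      intro n hn
      rw [Finset.mem_filter, Finset.mem_filter, Finset.mem_Ioc] at hn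
      obtain ⟨⟨⟨hn0, hnN⟩, hnp⟩, hne⟩ := hn
      have hpp : IsPrimePow n := by
        rw [← vonMangoldt_ne_zero_iff]
        intro h
        exact hne (by rw [h, zero_div])
      obtain ⟨p, k, hp, hk, rfl⟩ := (isPrimePow_nat_iff n).1 hpp
      have hk1 : k ≠ 1 := by
        rintro rfl
        exact hnp (by rwa [pow_one])
      rw [Finset.mem_image]
      refine ⟨(p, k), ?_, rfl⟩
      rw [Finset.mem_product, Finset.mem_filter, Finset.mem_Ioc, Finset.mem_Icc]
      exact ⟨⟨⟨hp.pos, (Nat.le_self_pow hk.ne' p).trans hnN⟩, hp⟩, by omega,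
        (Nat.lt_pow_self hp.one_lt).le.trans hnN⟩
    have himage : ∑ n ∈ T.image (fun y ↦ y.1 ^ y.2), vonMangoldt n / (n : ℝ) ≤
        ∑ y ∈ T, vonMangoldt (y.1 ^ y.2) / ((y.1 ^ y.2 : ℕ) : ℝ) :=
      Finset.sum_image_le_of_nonneg fun n _ ↦ div_nonneg vonMangoldt_nonneg (by positivity)
    refine hle.trans (himage.trans ?_)
    rw [Finset.sum_product]
    have hin : ∀ p ∈ (Finset.Ioc 0 N).filter Nat.Prime,
        ∑ k ∈ Finset.Icc 2 N, vonMangoldt (p ^ k) / ((p ^ k : ℕ) : ℝ) ≤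
          2 * (Real.log p / (p : ℝ) ^ 2) := by
      intro p hp
      have hp' := (Finset.mem_filter.1 hp).2
      calc _ = ∑ k ∈ Finset.Icc 2 N, Real.log p * (1 / (p : ℝ) ^ k) := by
            refine Finset.sum_congr rfl fun k hk ↦ ?_
            rw [Finset.mem_Icc] at hk
            rw [vonMangoldt_apply_pow (by omega), vonMangoldt_apply_prime hp']
            push_cast
            ring
        _ ≤ Real.log p * (2 / (p : ℝ) ^ 2) := by
            rw [← Finset.mul_sum]
            exact mul_le_mul_of_nonneg_left (sum_Icc_two_one_div_pow_le hp'.two_le N)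
              (Real.log_natCast_nonneg p)
        _ = _ := by ring
    refine (Finset.sum_le_sum hin).trans ?_
    rw [← Finset.mul_sum]
    gcongr
    exact summable_log_div_sq.sum_le_tsum _
      fun n _ ↦ div_nonneg (Real.log_natCast_nonneg n) (by positivity)
  rw [hprime] at hsplit
  rw [abs_le] at h1 ⊢
  constructor <;> linarith

/-- The error of the right-endpoint rule for ∫ du/u on one step, in a form that telescopes along u =
log N, v = log(N + 1). -/
theorem abs_log_log_sub_le {u v : ℝ} (hu : 0 < u) (huv : u ≤ v) (hv : v ≤ u + 1) :
    |(v - u) / v - (Real.log v - Real.log u)| ≤ 1 / u - 1 / v := by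
  have hv0 : 0 < v := by linarith
  have h1 := Real.log_le_sub_one_of_pos (x := v / u) (by positivity)
  have h2 := Real.log_le_sub_one_of_pos (x := u / v) (by positivity)
  rw [Real.log_div hv0.ne' hu.ne'] at h1
  rw [Real.log_div hu.ne' hv0.ne'] at h2
  have h3 : v / u - 1 - (v - u) / v ≤ 1 / u - 1 / v := by
    have : v / u - 1 - (v - u) / v = (v - u) * (1 / u - 1 / v) := by field_simp
    rw [this]
    have : 1 / v ≤ 1 / u := one_div_le_one_div_of_le hu huv
    nlinarith
  have h4 : u / v - 1 = - ((v - u) / v) := by field_simp; ring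
  rw [abs_le]
  have : 1 / v ≤ 1 / u := one_div_le_one_div_of_le hu huv
  constructor <;> linarith

theorem exists_abs_sum_prime_inv_sub_log_log_le :
    ∃ C : ℝ, 0 ≤ C ∧ ∀ x : ℝ, 2 ≤ x →
      |∑ p ∈ Finset.Ioc 0 ⌊x⌋₊ with p.Prime, 1 / (p : ℝ) - Real.log (Real.log x)| ≤ C := by
  obtain ⟨C, hC0, hC⟩ := exists_abs_sum_prime_log_div_sub_log_le
  set A : ℕ → ℝ := fun N ↦ ∑ p ∈ Finset.Ioc 0 N with p.Prime, Real.log p / p with hA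
  set S : ℕ → ℝ := fun N ↦ ∑ p ∈ Finset.Ioc 0 N with p.Prime, 1 / (p : ℝ) with hS
  set R : ℕ → ℝ := fun N ↦ A N - Real.log N with hR
  -- Partial summation in incremental form: subtracting the boundary term R(N)/log N leaves
  -- increments bounded by a telescoping quantity.
  set T : ℕ → ℝ := fun N ↦ S N - Real.log (Real.log N) - R N / Real.log N with hT
  have hl2 : 0 < Real.log 2 := Real.log_pos (by norm_num)
  have hlog : ∀ N : ℕ, 2 ≤ N → Real.log 2 ≤ Real.log N := fun N hN ↦
    Real.log_le_log (by norm_num) (by exact_mod_cast hN)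
  have hstep : ∀ N : ℕ, 2 ≤ N → |T (N + 1) - T N| ≤
      (C + 1) * (1 / Real.log N - 1 / Real.log (N + 1 : ℕ)) := by
    intro N hN
    have hu := hlog N hN
    have hv := hlog (N + 1) (by omega)
    set u := Real.log N
    set v := Real.log (N + 1 : ℕ)
    have hN0 : (0 : ℝ) < N := by positivity
    have huv : u ≤ v := Real.log_le_log hN0 (by push_cast; linarith)
    have hvu : v ≤ u + 1 := by
      have := Real.log_le_sub_one_of_pos (x := ((N + 1 : ℕ) : ℝ) / N) (by positivity)
      rw [Real.log_div (by positivity) (by positivity)] at this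
      have h2 : ((N + 1 : ℕ) : ℝ) / N ≤ 2 := by
        rw [div_le_iff₀ hN0]
        have : (2 : ℝ) ≤ N := by exact_mod_cast hN
        push_cast; linarith
      change v - u ≤ _ at this
      linarith
    have hSA : S (N + 1) - S N = (A (N + 1) - A N) / v := by
      simp only [hS, hA, Finset.sum_filter]
      rw [Finset.sum_Ioc_succ_top (Nat.zero_le N), Finset.sum_Ioc_succ_top (Nat.zero_le N),
        add_sub_cancel_left, add_sub_cancel_left]
      split_ifs
      · change _ = v / _ / v
        have : v ≠ 0 := by linarith
        field_simp
      · simp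
    have e1 : T (N + 1) - T N =
        ((v - u) / v - (Real.log v - Real.log u)) + R N * (1 / u - 1 / v) := by
      have e2 : A (N + 1) - A N = R (N + 1) - R N + (v - u) := by
        simp only [hR]; change _ = A (N + 1) - v - (A N - u) + (v - u); ring
      simp only [hT]
      change S (N + 1) - Real.log v - R (N + 1) / v - (S N - Real.log u - R N / u) = _
      have e3 : S (N + 1) = S N + (R (N + 1) - R N + (v - u)) / v := by
        rw [← e2, ← hSA]; ring
      rw [e3]
      ring
    have h1 := abs_log_log_sub_le (by linarith) huv hvu
    have h2 : |R N| ≤ C := hC N (by omega)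
    have h3 : 0 ≤ 1 / u - 1 / v :=
      sub_nonneg.2 (one_div_le_one_div_of_le (by linarith) huv)
    rw [e1]
    refine (abs_add_le _ _).trans ?_
    rw [abs_mul, abs_of_nonneg h3]
    have := mul_le_mul_of_nonneg_right h2 h3
    linarith
  have hTb : ∀ N : ℕ, 2 ≤ N → |T N| ≤ |T 2| + (C + 1) * (1 / Real.log 2 - 1 / Real.log N) := by
    intro N hN
    induction N, hN using Nat.le_induction with
    | base => simp
    | succ N hN ih =>
      have h1 := hstep N hN
      have h2 : |T (N + 1)| ≤ |T (N + 1) - T N| + |T N| := by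
        have := abs_add_le (T (N + 1) - T N) (T N)
        rwa [sub_add_cancel] at this
      linarith
  have hSb : ∀ N : ℕ, 2 ≤ N → |S N - Real.log (Real.log N)| ≤
      |T 2| + (C + 1) * (1 / Real.log 2) + C * (1 / Real.log 2) := by
    intro N hN
    have hu := hlog N hN
    have h1 := hTb N hN
    have h2 : |R N / Real.log N| ≤ C * (1 / Real.log 2) := by
      rw [abs_div, abs_of_pos (show 0 < Real.log N by linarith), div_eq_mul_one_div]
      have h3 : |R N| ≤ C := hC N (by omega)
      gcongr
    have h4 : S N - Real.log (Real.log N) = T N + R N / Real.log N := by simp only [hT]; ring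
    have h5 : 0 ≤ (C + 1) * (1 / Real.log N) :=
      mul_nonneg (by linarith) (one_div_nonneg.2 (by linarith))
    rw [h4]
    refine (abs_add_le _ _).trans ?_
    linarith
  refine ⟨|T 2| + (C + 1) * (1 / Real.log 2) + C * (1 / Real.log 2) + 1 / Real.log 2,
    by positivity, fun x hx ↦ ?_⟩
  have hN : 2 ≤ ⌊x⌋₊ := Nat.le_floor (by exact_mod_cast hx)
  have hN' : (2 : ℝ) ≤ ⌊x⌋₊ := by exact_mod_cast hN
  have h1 := hSb ⌊x⌋₊ hN
  have hu := hlog _ hN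
  have hfl : (⌊x⌋₊ : ℝ) ≤ x := Nat.floor_le (by linarith)
  have hfl2 : x < ⌊x⌋₊ + 1 := Nat.lt_floor_add_one x
  have hux : Real.log ⌊x⌋₊ ≤ Real.log x := Real.log_le_log (by linarith) hfl
  have hxu : Real.log x - Real.log ⌊x⌋₊ ≤ 1 := by
    have := Real.log_le_sub_one_of_pos (x := x / ⌊x⌋₊) (by positivity)
    rw [Real.log_div (by linarith) (by linarith)] at this
    have h7 : x / ⌊x⌋₊ ≤ 2 := by rw [div_le_iff₀ (by linarith)]; linarith
    linarith
  have h2 : Real.log (Real.log ⌊x⌋₊) ≤ Real.log (Real.log x) := Real.log_le_log (by linarith) hux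
  have h3 : Real.log (Real.log x) - Real.log (Real.log ⌊x⌋₊) ≤ 1 / Real.log 2 := by
    have h4 := Real.log_le_sub_one_of_pos (x := Real.log x / Real.log ⌊x⌋₊)
      (div_pos (by linarith) (by linarith))
    rw [Real.log_div (by linarith) (by linarith)] at h4
    have h5 : Real.log x / Real.log ⌊x⌋₊ - 1 = (Real.log x - Real.log ⌊x⌋₊) / Real.log ⌊x⌋₊ := by
      rw [sub_div, div_self (by linarith)]
    have h6 : (Real.log x - Real.log ⌊x⌋₊) / Real.log ⌊x⌋₊ ≤ 1 / Real.log 2 := by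
      gcongr
    linarith
  have h8 : ∑ p ∈ Finset.Ioc 0 ⌊x⌋₊ with p.Prime, 1 / (p : ℝ) = S ⌊x⌋₊ := rfl
  rw [h8]
  rw [abs_le] at h1 ⊢
  constructor <;> linarith

/-! ### Independent Bernoulli model for the number of prime divisors -/

/-- The derivative of each Taylor remainder is i times the previous one, so the bound follows by
induction and integration; conjugation handles negative x. -/
theorem norm_exp_mul_I_sub_sum_le (n : ℕ) (x : ℝ) :
    ‖Complex.exp (x * Complex.I) - ∑ j ∈ Finset.range n, (x * Complex.I) ^ j / (j.factorial : ℂ)‖ ≤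
      |x| ^ n / n.factorial := by
  have hpos : ∀ (n : ℕ) (x : ℝ), 0 ≤ x →
      ‖Complex.exp (x * Complex.I) -
        ∑ j ∈ Finset.range n, (x * Complex.I) ^ j / (j.factorial : ℂ)‖ ≤ x ^ n / n.factorial := by
    intro n
    induction n with
    | zero =>
      intro x _
      simp [Complex.norm_exp_ofReal_mul_I]
    | succ n ih =>
      intro x hx
      have hder : ∀ t : ℝ, HasDerivAt (fun t : ℝ ↦ Complex.exp (t * Complex.I) -
          ∑ j ∈ Finset.range (n + 1), (t * Complex.I) ^ j / (j.factorial : ℂ))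
          ((Complex.exp (t * Complex.I) -
            ∑ j ∈ Finset.range n, (t * Complex.I) ^ j / (j.factorial : ℂ)) * Complex.I) t := by
        intro t
        have hlin : HasDerivAt (fun t : ℝ ↦ (t : ℂ) * Complex.I) Complex.I t := by
          simpa using (Complex.ofRealCLM.hasDerivAt (x := t)).mul_const Complex.I
        rw [sub_mul]
        refine hlin.cexp.sub ?_
        simp_rw [Finset.sum_range_succ' _ n]
        rw [Finset.sum_mul]
        simp only [pow_zero, Nat.factorial_zero, Nat.cast_one, div_one]
        refine HasDerivAt.add_const _ (HasDerivAt.fun_sum fun j _ ↦ ?_)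
        have := (hlin.pow (j + 1)).div_const ((j + 1).factorial : ℂ)
        refine HasDerivAt.congr_deriv this ?_
        rw [Nat.factorial_succ]
        have h1 : ((j + 1 : ℕ) : ℂ) ≠ 0 := by exact_mod_cast Nat.succ_ne_zero j
        have h2 : (j.factorial : ℂ) ≠ 0 := by exact_mod_cast j.factorial_ne_zero
        simp only [add_tsub_cancel_right]
        push_cast at h1 ⊢
        field_simp
      have hint := intervalIntegral.integral_eq_sub_of_hasDerivAt (a := 0) (b := x)
        (fun t _ ↦ hder t) (Continuous.intervalIntegrable (by fun_prop) _ _)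
      have h0 : Complex.exp (((0 : ℝ) : ℂ) * Complex.I) -
          ∑ j ∈ Finset.range (n + 1), (((0 : ℝ) : ℂ) * Complex.I) ^ j / (j.factorial : ℂ) = 0 := by
        rw [Finset.sum_range_succ']
        simp
      rw [h0, sub_zero] at hint
      rw [← hint]
      have hpoly : ∫ t in (0 : ℝ)..x, t ^ n / (n.factorial : ℝ) =
          x ^ (n + 1) / ((n + 1).factorial : ℝ) := by
        rw [intervalIntegral.integral_div, integral_pow, Nat.factorial_succ]
        have h2 : (n.factorial : ℝ) ≠ 0 := by exact_mod_cast n.factorial_ne_zero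
        push_cast
        field_simp
        simp
      rw [← hpoly]
      refine intervalIntegral.norm_integral_le_of_norm_le hx ?_
        (Continuous.intervalIntegrable (by fun_prop) _ _)
      refine MeasureTheory.ae_of_all _ fun t ht ↦ ?_
      rw [norm_mul, Complex.norm_I, mul_one]
      exact ih t ht.1.le
  rcases le_total 0 x with hx | hx
  · rw [abs_of_nonneg hx]; exact hpos n x hx
  · rw [abs_of_nonpos hx]
    refine le_trans (le_of_eq ?_) (hpos n (-x) (by linarith))
    rw [← Complex.norm_conj]
    congr 1
    simp only [map_sub, map_sum, map_div₀, map_pow, map_mul, Complex.conj_I, Complex.conj_ofReal,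
      ← Complex.exp_conj, map_natCast]
    push_cast
    simp only [mul_neg, neg_mul]

/-- Truncation at the even order 2k makes the remainder an ordinary moment, with no absolute values.
-/
theorem norm_sum_exp_sub_sum_moments_le {ι : Type*} (s : Finset ι) (w X : ι → ℝ)
    (hw : ∀ i ∈ s, 0 ≤ w i) (ξ : ℝ) (k : ℕ) :
    ‖∑ i ∈ s, (w i : ℂ) * Complex.exp ((ξ * X i : ℝ) * Complex.I) -
      ∑ j ∈ Finset.range (2 * k), ((ξ * Complex.I) ^ j / (j.factorial : ℂ)) *
        ((∑ i ∈ s, w i * X i ^ j : ℝ) : ℂ)‖ ≤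
      |ξ| ^ (2 * k) / (2 * k).factorial * ∑ i ∈ s, w i * X i ^ (2 * k) := by
  have e1 : ∑ j ∈ Finset.range (2 * k), ((ξ * Complex.I) ^ j / (j.factorial : ℂ)) *
        ((∑ i ∈ s, w i * X i ^ j : ℝ) : ℂ) =
      ∑ i ∈ s, (w i : ℂ) * ∑ j ∈ Finset.range (2 * k),
        ((ξ * X i : ℝ) * Complex.I) ^ j / (j.factorial : ℂ) := by
    simp_rw [Complex.ofReal_sum, Finset.mul_sum]
    rw [Finset.sum_comm]
    refine Finset.sum_congr rfl fun i _ ↦ Finset.sum_congr rfl fun j _ ↦ ?_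
    push_cast
    ring
  rw [e1, ← Finset.sum_sub_distrib, Finset.mul_sum]
  refine (norm_sum_le _ _).trans (Finset.sum_le_sum fun i hi ↦ ?_)
  rw [← mul_sub, norm_mul, Complex.norm_real, Real.norm_of_nonneg (hw i hi)]
  refine (mul_le_mul_of_nonneg_left (norm_exp_mul_I_sub_sum_le (2 * k) (ξ * X i)) (hw i hi)).trans
    (le_of_eq ?_)
  rw [abs_mul, mul_pow, pow_mul |X i|, sq_abs, ← pow_mul]
  ring

/-- Comparison of two finitely supported characteristic functions by means of moments. -/
theorem norm_sum_exp_sub_sum_exp_le {ι κ : Type*} {s : Finset ι} {t : Finset κ} {w : ι → ℝ}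
    {v : κ → ℝ} (hw : ∀ i ∈ s, 0 ≤ w i) (hv : ∀ i ∈ t, 0 ≤ v i) (X : ι → ℝ) (Y : κ → ℝ)
    (ξ : ℝ) (k : ℕ) :
    ‖∑ i ∈ s, (w i : ℂ) * Complex.exp ((ξ * X i : ℝ) * Complex.I) -
      ∑ i ∈ t, (v i : ℂ) * Complex.exp ((ξ * Y i : ℝ) * Complex.I)‖ ≤
      ∑ j ∈ Finset.range (2 * k), |ξ| ^ j / j.factorial *
        |∑ i ∈ s, w i * X i ^ j - ∑ i ∈ t, v i * Y i ^ j| +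
      |ξ| ^ (2 * k) / (2 * k).factorial *
        (∑ i ∈ s, w i * X i ^ (2 * k) + ∑ i ∈ t, v i * Y i ^ (2 * k)) := by
  have h1 := norm_sum_exp_sub_sum_moments_le s w X hw ξ k
  have h2 := norm_sum_exp_sub_sum_moments_le t v Y hv ξ k
  have h3 : ‖∑ j ∈ Finset.range (2 * k), ((ξ * Complex.I) ^ j / (j.factorial : ℂ)) *
          ((∑ i ∈ s, w i * X i ^ j : ℝ) : ℂ) -
        ∑ j ∈ Finset.range (2 * k), ((ξ * Complex.I) ^ j / (j.factorial : ℂ)) *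
          ((∑ i ∈ t, v i * Y i ^ j : ℝ) : ℂ)‖ ≤
      ∑ j ∈ Finset.range (2 * k), |ξ| ^ j / j.factorial *
        |∑ i ∈ s, w i * X i ^ j - ∑ i ∈ t, v i * Y i ^ j| := by
    rw [← Finset.sum_sub_distrib]
    refine (norm_sum_le _ _).trans (Finset.sum_le_sum fun j _ ↦ le_of_eq ?_)
    rw [← mul_sub, ← Complex.ofReal_sub, norm_mul, Complex.norm_real, norm_div, norm_pow, norm_mul,
      Complex.norm_I, mul_one, Complex.norm_real, Complex.norm_natCast, Real.norm_eq_abs,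
      Real.norm_eq_abs]
  set a := ∑ i ∈ s, (w i : ℂ) * Complex.exp ((ξ * X i : ℝ) * Complex.I)
  set b := ∑ i ∈ t, (v i : ℂ) * Complex.exp ((ξ * Y i : ℝ) * Complex.I)
  set a' := ∑ j ∈ Finset.range (2 * k), ((ξ * Complex.I) ^ j / (j.factorial : ℂ)) *
          ((∑ i ∈ s, w i * X i ^ j : ℝ) : ℂ)
  set b' := ∑ j ∈ Finset.range (2 * k), ((ξ * Complex.I) ^ j / (j.factorial : ℂ)) *
          ((∑ i ∈ t, v i * Y i ^ j : ℝ) : ℂ)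
  calc ‖a - b‖ = ‖(a - a') + (a' - b') - (b - b')‖ := by congr 1; ring
    _ ≤ ‖a - a'‖ + ‖a' - b'‖ + ‖b - b'‖ :=
        (norm_sub_le _ _).trans (by gcongr; exact norm_add_le _ _)
    _ ≤ _ := by rw [mul_add]; linarith

/-- The probability that, in the model where each prime `p ∈ P` divides independently with
probability `1 / p`, the set of dividing primes is `S`. -/
noncomputable def divisorWeight (P S : Finset ℕ) : ℝ :=
  (∏ p ∈ S, 1 / (p : ℝ)) * ∏ p ∈ P \ S, (1 - 1 / (p : ℝ))

theorem one_sub_inv_nonneg {P : Finset ℕ} (hP : ∀ p ∈ P, p.Prime) {p : ℕ} (hp : p ∈ P) :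
    0 ≤ 1 - 1 / (p : ℝ) := by
  have : (1 : ℝ) ≤ p := by exact_mod_cast (hP p hp).one_le
  rw [sub_nonneg, div_le_one (by linarith)]
  exact this

theorem divisorWeight_nonneg {P : Finset ℕ} (hP : ∀ p ∈ P, p.Prime) (S : Finset ℕ) :
    0 ≤ divisorWeight P S :=
  mul_nonneg (Finset.prod_nonneg fun p _ ↦ by positivity)
    (Finset.prod_nonneg fun _ hp ↦ one_sub_inv_nonneg hP (Finset.mem_sdiff.1 hp).1)

theorem sum_divisorWeight_mul_pow_card (P : Finset ℕ) (z : ℂ) :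
    ∑ S ∈ P.powerset, (divisorWeight P S : ℂ) * z ^ S.card =
      ∏ p ∈ P, (1 + (z - 1) / (p : ℂ)) := by
  have h := Finset.prod_add (fun p : ℕ ↦ z / (p : ℂ)) (fun p : ℕ ↦ 1 - 1 / (p : ℂ)) P
  have e1 : ∀ p : ℕ, 1 + (z - 1) / (p : ℂ) = z / (p : ℂ) + (1 - 1 / (p : ℂ)) := fun p ↦ by ring
  simp_rw [e1, h]
  refine Finset.sum_congr rfl fun S _ ↦ ?_
  rw [divisorWeight]
  push_cast
  simp only [div_eq_mul_one_div z]
  rw [Finset.prod_mul_distrib, Finset.prod_const]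
  ring

theorem sum_divisorWeight_mul_pow_card_real (P : Finset ℕ) (z : ℝ) :
    ∑ S ∈ P.powerset, divisorWeight P S * z ^ S.card = ∏ p ∈ P, (1 + (z - 1) / (p : ℝ)) := by
  exact_mod_cast sum_divisorWeight_mul_pow_card P (z : ℂ)

theorem sum_divisorWeight_superset {P T : Finset ℕ} (hT : T ⊆ P) :
    ∑ S ∈ P.powerset, divisorWeight P S * (if T ⊆ S then 1 else 0) = ∏ p ∈ T, 1 / (p : ℝ) := by
  have h := Finset.prod_add (fun p : ℕ ↦ 1 / (p : ℝ))
    (fun p : ℕ ↦ if p ∈ T then 0 else 1 - 1 / (p : ℝ)) P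
  have h1 : ∏ p ∈ P, (1 / (p : ℝ) + if p ∈ T then 0 else 1 - 1 / (p : ℝ)) =
      ∏ p ∈ T, 1 / (p : ℝ) := by
    rw [← Finset.prod_subset hT]
    · exact Finset.prod_congr rfl fun p hp ↦ by rw [if_pos hp, add_zero]
    · intro p _ hp
      rw [if_neg hp]; ring
  rw [← h1, h]
  refine Finset.sum_congr rfl fun S hS ↦ ?_
  rw [divisorWeight, mul_assoc]
  congr 1
  split_ifs with hTS
  · rw [mul_one]
    refine Finset.prod_congr rfl fun p hp ↦ ?_
    rw [if_neg fun hpT ↦ (Finset.mem_sdiff.1 hp).2 (hTS hpT)]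
  · rw [mul_zero]
    obtain ⟨p, hpT, hpS⟩ := Finset.not_subset.1 hTS
    symm
    exact Finset.prod_eq_zero (Finset.mem_sdiff.2 ⟨hT hpT, hpS⟩) (if_pos hpT)

theorem card_pow_eq_sum {P S : Finset ℕ} (hS : S ⊆ P) (k : ℕ) :
    (S.card : ℝ) ^ k = ∑ x ∈ Fintype.piFinset fun _ : Fin k ↦ P,
      if Finset.univ.image x ⊆ S then (1 : ℝ) else 0 := by
  have h1 : (S.card : ℝ) = ∑ p ∈ P, if p ∈ S then (1 : ℝ) else 0 := by
    rw [Finset.sum_boole, Finset.filter_mem_eq_inter, Finset.inter_eq_right.2 hS]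
  have h2 := Finset.prod_univ_sum (fun _ : Fin k ↦ P) (fun _ p ↦ if p ∈ S then (1 : ℝ) else 0)
  rw [Finset.prod_const, Finset.card_univ, Fintype.card_fin, ← h1] at h2
  rw [h2]
  refine Finset.sum_congr rfl fun x _ ↦ ?_
  rw [Finset.prod_boole]
  simp [Finset.image_subset_iff]

/-- Expand the k-th power over k-tuples of primes. All primes of a tuple divide n exactly when the
product d of its distinct entries does, with frequency ⌊N/d⌋/N against 1/d in the model. Each of the
|P|^k tuples costs at most 1/N. -/
theorem abs_average_card_pow_sub_le {P : Finset ℕ} (hP : ∀ p ∈ P, p.Prime) {N : ℕ} (hN : 0 < N)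
    (k : ℕ) :
    |∑ n ∈ Finset.Ioc 0 N, 1 / (N : ℝ) * ((P.filter (· ∣ n)).card : ℝ) ^ k -
      ∑ S ∈ P.powerset, divisorWeight P S * (S.card : ℝ) ^ k| ≤ (P.card : ℝ) ^ k / N := by
  have hN0 : (0 : ℝ) < N := by exact_mod_cast hN
  have h1 : ∑ S ∈ P.powerset, divisorWeight P S * (S.card : ℝ) ^ k =
      ∑ x ∈ Fintype.piFinset fun _ : Fin k ↦ P, ∏ p ∈ Finset.univ.image x, 1 / (p : ℝ) := by
    have : ∀ S ∈ P.powerset, divisorWeight P S * (S.card : ℝ) ^ k =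
        ∑ x ∈ Fintype.piFinset fun _ : Fin k ↦ P,
          divisorWeight P S * if Finset.univ.image x ⊆ S then (1 : ℝ) else 0 := by
      intro S hS
      rw [card_pow_eq_sum (Finset.mem_powerset.1 hS), Finset.mul_sum]
    rw [Finset.sum_congr rfl this, Finset.sum_comm]
    refine Finset.sum_congr rfl fun x hx ↦ sum_divisorWeight_superset ?_
    rw [Finset.image_subset_iff]
    exact fun i _ ↦ Fintype.mem_piFinset.1 hx i
  have h2 : ∑ n ∈ Finset.Ioc 0 N, 1 / (N : ℝ) * ((P.filter (· ∣ n)).card : ℝ) ^ k =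
      ∑ x ∈ Fintype.piFinset fun _ : Fin k ↦ P,
        1 / (N : ℝ) * ((N / ∏ p ∈ Finset.univ.image x, p : ℕ) : ℝ) := by
    simp_rw [card_pow_eq_sum (Finset.filter_subset _ P), Finset.mul_sum]
    rw [Finset.sum_comm]
    refine Finset.sum_congr rfl fun x hx ↦ ?_
    have hxP : ∀ p ∈ Finset.univ.image x, p ∈ P := by
      intro p hp
      obtain ⟨i, -, rfl⟩ := Finset.mem_image.1 hp
      exact Fintype.mem_piFinset.1 hx i
    have hiff : ∀ n, Finset.univ.image x ⊆ P.filter (· ∣ n) ↔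
        ∏ p ∈ Finset.univ.image x, p ∣ n := by
      intro n
      constructor
      · intro h
        exact Finset.prod_primes_dvd n (fun p hp ↦ (hP p (hxP p hp)).prime)
          fun p hp ↦ (Finset.mem_filter.1 (h hp)).2
      · intro h p hp
        exact Finset.mem_filter.2 ⟨hxP p hp, (Finset.dvd_prod_of_mem _ hp).trans h⟩
    rw [← Finset.mul_sum]
    simp_rw [hiff]
    rw [Finset.sum_boole, Nat.Ioc_filter_dvd_card_eq_div]
  rw [h1, h2, ← Finset.sum_sub_distrib]
  have hcard : ((Fintype.piFinset fun _ : Fin k ↦ P).card : ℝ) = (P.card : ℝ) ^ k := by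
    simp
  have hconst : (P.card : ℝ) ^ k / N =
      ∑ x ∈ Fintype.piFinset fun _ : Fin k ↦ P, 1 / (N : ℝ) := by
    rw [Finset.sum_const, nsmul_eq_mul, hcard, mul_one_div]
  rw [hconst]
  refine (Finset.abs_sum_le_sum_abs _ _).trans (Finset.sum_le_sum fun x _ ↦ ?_)
  have h3 : ∏ p ∈ Finset.univ.image x, 1 / (p : ℝ) =
      1 / ((∏ p ∈ Finset.univ.image x, p : ℕ) : ℝ) := by
    rw [Finset.prod_div_distrib]
    push_cast
    simp
  rw [h3]
  set d := ∏ p ∈ Finset.univ.image x, p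
  have h4 : ((N / d : ℕ) : ℝ) ≤ N / d := Nat.cast_div_le
  have h5 : (N / d : ℝ) - 1 ≤ ((N / d : ℕ) : ℝ) := by
    have := Nat.lt_floor_add_one ((N : ℝ) / d)
    rw [Nat.floor_div_eq_div] at this
    linarith
  have h6 : 1 / (N : ℝ) * ((N / d : ℕ) : ℝ) - 1 / (d : ℝ) =
      1 / (N : ℝ) * (((N / d : ℕ) : ℝ) - N / d) := by field_simp
  rw [h6, abs_mul, abs_of_pos (by positivity : 0 < 1 / (N : ℝ))]
  have h7 : |((N / d : ℕ) : ℝ) - N / d| ≤ 1 := by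
    rw [abs_le]; constructor <;> linarith
  calc _ ≤ 1 / (N : ℝ) * 1 := by gcongr
    _ = _ := mul_one _

theorem abs_average_centered_pow_sub_le {P : Finset ℕ} (hP : ∀ p ∈ P, p.Prime) {N : ℕ}
    (hN : 0 < N) {m σ : ℝ} (hm : 0 ≤ m) (hσ : 0 < σ) (k : ℕ) :
    |∑ n ∈ Finset.Ioc 0 N, 1 / (N : ℝ) * ((((P.filter (· ∣ n)).card : ℝ) - m) / σ) ^ k -
      ∑ S ∈ P.powerset, divisorWeight P S * (((S.card : ℝ) - m) / σ) ^ k| ≤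
      ((P.card + m) / σ) ^ k / N := by
  have hexp : ∀ {ι : Type} (s : Finset ι) (w X : ι → ℝ),
      ∑ i ∈ s, w i * ((X i - m) / σ) ^ k = ∑ j ∈ Finset.range (k + 1),
        ((-m) ^ (k - j) * (k.choose j : ℝ) / σ ^ k) * ∑ i ∈ s, w i * X i ^ j := by
    intro ι s w X
    simp_rw [Finset.mul_sum]
    rw [Finset.sum_comm]
    refine Finset.sum_congr rfl fun i _ ↦ ?_
    rw [div_pow, sub_eq_add_neg, add_pow, Finset.sum_div, Finset.mul_sum]
    exact Finset.sum_congr rfl fun j _ ↦ by ring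
  rw [hexp (Finset.Ioc 0 N) (fun _ ↦ 1 / (N : ℝ)) (fun n ↦ ((P.filter (· ∣ n)).card : ℝ)),
    hexp P.powerset (divisorWeight P) (fun S ↦ (S.card : ℝ)), ← Finset.sum_sub_distrib]
  have hR : ((P.card + m) / σ) ^ k / N = ∑ j ∈ Finset.range (k + 1),
      (m ^ (k - j) * (k.choose j : ℝ) / σ ^ k) * ((P.card : ℝ) ^ j / N) := by
    rw [div_pow, add_pow, Finset.sum_div, Finset.sum_div]
    exact Finset.sum_congr rfl fun j _ ↦ by ring
  rw [hR]
  refine (Finset.abs_sum_le_sum_abs _ _).trans (Finset.sum_le_sum fun j _ ↦ ?_)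
  rw [← mul_sub, abs_mul]
  refine mul_le_mul (le_of_eq ?_) (abs_average_card_pow_sub_le hP hN j) (abs_nonneg _)
    (by positivity)
  rw [abs_div, abs_mul, abs_pow, abs_neg, abs_of_nonneg hm, abs_of_nonneg (by positivity),
    abs_of_pos (by positivity : 0 < σ ^ k)]

/-- Independence factors the exponential moment; 1 + x ≤ e^x and e^s - 1 - s ≤ s² for |s| ≤ 1 then
finish. -/
theorem sum_divisorWeight_mul_exp_le {P : Finset ℕ} (hP : ∀ p ∈ P, p.Prime) {s : ℝ}
    (hs : |s| ≤ 1) :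
    ∑ S ∈ P.powerset, divisorWeight P S * Real.exp (s * (S.card - ∑ p ∈ P, 1 / (p : ℝ))) ≤
      Real.exp ((∑ p ∈ P, 1 / (p : ℝ)) * s ^ 2) := by
  set m := ∑ p ∈ P, 1 / (p : ℝ) with hm
  have hm0 : 0 ≤ m := Finset.sum_nonneg fun p _ ↦ by positivity
  have h1 : ∑ S ∈ P.powerset, divisorWeight P S * Real.exp (s * (S.card - m)) =
      Real.exp (-(s * m)) * ∏ p ∈ P, (1 + (Real.exp s - 1) / (p : ℝ)) := by
    rw [← sum_divisorWeight_mul_pow_card_real, Finset.mul_sum]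
    refine Finset.sum_congr rfl fun S _ ↦ ?_
    rw [mul_sub, sub_eq_add_neg, Real.exp_add, ← Real.exp_nat_mul, mul_comm s]
    ring
  have h2 : ∏ p ∈ P, (1 + (Real.exp s - 1) / (p : ℝ)) ≤ Real.exp ((Real.exp s - 1) * m) := by
    rw [hm, Finset.mul_sum, Real.exp_sum]
    refine Finset.prod_le_prod (fun p hp ↦ ?_) fun p _ ↦ ?_
    · have := one_sub_inv_nonneg hP hp
      have h3 : 0 ≤ Real.exp s / p := by positivity
      rw [sub_div]; linarith
    · rw [add_comm, mul_one_div]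
      exact Real.add_one_le_exp _
  rw [h1]
  calc _ ≤ Real.exp (-(s * m)) * Real.exp ((Real.exp s - 1) * m) := by gcongr
    _ = Real.exp (m * (Real.exp s - 1 - s)) := by rw [← Real.exp_add]; ring_nf
    _ ≤ _ := by
        gcongr
        exact (le_abs_self _).trans (Real.abs_exp_sub_one_sub_id_le hs)

/-- Uses y^{2k} ≤ (2k)! r^{-2k}(e^{ry} + e^{-ry}). The free parameter r serves to beat |ξ|^{2k} in
the Taylor remainder. -/
theorem sum_divisorWeight_mul_even_pow_le {P : Finset ℕ} (hP : ∀ p ∈ P, p.Prime) {r σ : ℝ}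
    (hr : 0 < r) (hσ : r ≤ σ) (k : ℕ) :
    ∑ S ∈ P.powerset, divisorWeight P S *
        (((S.card : ℝ) - ∑ p ∈ P, 1 / (p : ℝ)) / σ) ^ (2 * k) ≤
      (2 * k).factorial / r ^ (2 * k) *
        (2 * Real.exp ((∑ p ∈ P, 1 / (p : ℝ)) * (r / σ) ^ 2)) := by
  set m := ∑ p ∈ P, 1 / (p : ℝ)
  have hσ0 : 0 < σ := hr.trans_le hσ
  have hs : |r / σ| ≤ 1 := by
    rw [abs_of_pos (by positivity), div_le_one hσ0]; exact hσ
  have h1 := sum_divisorWeight_mul_exp_le hP hs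
  have h2 := sum_divisorWeight_mul_exp_le hP (s := -(r / σ)) (by rwa [abs_neg])
  rw [neg_sq] at h2
  have hpt : ∀ y : ℝ, y ^ (2 * k) ≤ (2 * k).factorial / r ^ (2 * k) *
      (Real.exp (r * y) + Real.exp (-(r * y))) := by
    intro y
    have h3 := Real.pow_div_factorial_le_exp |r * y| (abs_nonneg _) (2 * k)
    have h4 : Real.exp |r * y| ≤ Real.exp (r * y) + Real.exp (-(r * y)) := by
      rcases abs_choice (r * y) with h | h <;> rw [h]
      · linarith [Real.exp_pos (-(r * y))]
      · linarith [Real.exp_pos (r * y)]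
    have h5 := h3.trans h4
    rw [pow_mul, sq_abs, ← pow_mul, mul_pow, div_le_iff₀ (by positivity)] at h5
    rw [div_mul_eq_mul_div, le_div_iff₀ (by positivity)]
    linarith
  calc _ ≤ ∑ S ∈ P.powerset, divisorWeight P S * ((2 * k).factorial / r ^ (2 * k) *
        (Real.exp (r * ((S.card - m) / σ)) + Real.exp (-(r * ((S.card - m) / σ))))) :=
        Finset.sum_le_sum fun S _ ↦ mul_le_mul_of_nonneg_left (hpt _) (divisorWeight_nonneg hP S)
    _ = (2 * k).factorial / r ^ (2 * k) *
        (∑ S ∈ P.powerset, divisorWeight P S * Real.exp (r / σ * (S.card - m)) +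
        ∑ S ∈ P.powerset, divisorWeight P S * Real.exp (-(r / σ) * (S.card - m))) := by
        rw [← Finset.sum_add_distrib, Finset.mul_sum]
        refine Finset.sum_congr rfl fun S _ ↦ ?_
        have e1 : r * ((S.card - m) / σ) = r / σ * (S.card - m) := by ring
        have e2 : -(r / σ * (S.card - m)) = -(r / σ) * (S.card - m) := by ring
        rw [e1, e2]
        ring
    _ ≤ _ := by
        gcongr
        linarith

theorem norm_prod_sub_prod_le_sum {ι : Type*} (s : Finset ι) (a b : ι → ℂ)
    (ha : ∀ i ∈ s, ‖a i‖ ≤ 1) (hb : ∀ i ∈ s, ‖b i‖ ≤ 1) :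
    ‖∏ i ∈ s, a i - ∏ i ∈ s, b i‖ ≤ ∑ i ∈ s, ‖a i - b i‖ := by
  classical
  induction s using Finset.induction_on with
  | empty => simp
  | insert i s hi ih =>
    rw [Finset.prod_insert hi, Finset.prod_insert hi, Finset.sum_insert hi]
    have h1 := ih (fun j hj ↦ ha j (Finset.mem_insert_of_mem hj))
      (fun j hj ↦ hb j (Finset.mem_insert_of_mem hj))
    have h2 : ‖∏ j ∈ s, b j‖ ≤ 1 := by
      rw [norm_prod]
      exact Finset.prod_le_one (fun _ _ ↦ norm_nonneg _)
        fun j hj ↦ hb j (Finset.mem_insert_of_mem hj)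
    have h3 := ha i (Finset.mem_insert_self i s)
    calc _ = ‖(a i - b i) * ∏ j ∈ s, b j + a i * (∏ j ∈ s, a j - ∏ j ∈ s, b j)‖ := by
          congr 1; ring
      _ ≤ ‖a i - b i‖ * ‖∏ j ∈ s, b j‖ + ‖a i‖ * ‖∏ j ∈ s, a j - ∏ j ∈ s, b j‖ := by
          refine (norm_add_le _ _).trans ?_
          rw [norm_mul, norm_mul]
      _ ≤ ‖a i - b i‖ * 1 + 1 * ∑ j ∈ s, ‖a j - b j‖ := by gcongr
      _ = _ := by ring

/-- Poisson approximation: with z = e^{iθ}, each factor 1 + (z - 1)/p is replaced by exp((z - 1)/p).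
All factors lie in the unit disc, so the errors, at most θ²/p² each, simply add. -/
theorem norm_sum_divisorWeight_mul_exp_sub_le {P : Finset ℕ} (hP : ∀ p ∈ P, p.Prime) {θ : ℝ}
    (hθ : |θ| ≤ 1) :
    ‖∑ S ∈ P.powerset, (divisorWeight P S : ℂ) *
        Complex.exp ((θ * (S.card - ∑ p ∈ P, 1 / (p : ℝ)) : ℝ) * Complex.I) -
      Complex.exp ((∑ p ∈ P, 1 / (p : ℝ) : ℝ) *
        (Complex.exp (θ * Complex.I) - 1 - θ * Complex.I))‖ ≤
      θ ^ 2 * ∑' n : ℕ, 1 / (n : ℝ) ^ 2 := by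
  set m := ∑ p ∈ P, 1 / (p : ℝ) with hm
  set z := Complex.exp (θ * Complex.I) with hz
  have hznorm : ‖z‖ = 1 := Complex.norm_exp_ofReal_mul_I θ
  have hz1 : ‖z - 1‖ ≤ |θ| := by
    rw [hz, mul_comm]; exact Real.norm_exp_I_mul_ofReal_sub_one_le
  set c := Complex.exp (-(θ * m : ℝ) * Complex.I) with hc
  have hcnorm : ‖c‖ = 1 := by
    rw [hc, ← Complex.ofReal_neg]; exact Complex.norm_exp_ofReal_mul_I _
  have h1 : ∑ S ∈ P.powerset, (divisorWeight P S : ℂ) *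
      Complex.exp ((θ * (S.card - m) : ℝ) * Complex.I) =
      c * ∏ p ∈ P, (1 + (z - 1) / (p : ℂ)) := by
    rw [← sum_divisorWeight_mul_pow_card, Finset.mul_sum]
    refine Finset.sum_congr rfl fun S _ ↦ ?_
    rw [mul_left_comm, hz, ← Complex.exp_nat_mul, hc, ← Complex.exp_add]
    congr 2
    push_cast
    ring
  have h2 : Complex.exp ((m : ℂ) * (z - 1 - θ * Complex.I)) =
      c * ∏ p ∈ P, Complex.exp ((z - 1) / (p : ℂ)) := by
    rw [← Complex.exp_sum, hc, ← Complex.exp_add]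
    congr 1
    rw [hm]
    push_cast
    have : ∑ p ∈ P, (z - 1) / (p : ℂ) = (z - 1) * ∑ p ∈ P, 1 / (p : ℂ) := by
      rw [Finset.mul_sum]; exact Finset.sum_congr rfl fun p _ ↦ by ring
    rw [this]
    ring
  rw [h1, h2, ← mul_sub, norm_mul, hcnorm, one_mul]
  have hp1 : ∀ p ∈ P, (1 : ℝ) ≤ p := fun p hp ↦ by exact_mod_cast (hP p hp).one_le
  refine (norm_prod_sub_prod_le_sum P _ _ (fun p hp ↦ ?_) fun p hp ↦ ?_).trans ?_
  · have e1 : 1 + (z - 1) / (p : ℂ) = ((1 - 1 / (p : ℝ) : ℝ) : ℂ) + z / (p : ℂ) := by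
      push_cast; ring
    rw [e1]
    refine (norm_add_le _ _).trans ?_
    rw [Complex.norm_real, Real.norm_of_nonneg (one_sub_inv_nonneg hP hp), norm_div, hznorm,
      Complex.norm_natCast]
    linarith
  · rw [Complex.norm_exp]
    apply Real.exp_le_one_iff.2
    have e1 : (z - 1) / (p : ℂ) = (z - 1) / ((p : ℝ) : ℂ) := by push_cast; rfl
    rw [e1, Complex.div_ofReal_re]
    refine div_nonpos_of_nonpos_of_nonneg ?_ (by positivity)
    rw [Complex.sub_re, Complex.one_re]
    linarith [Complex.re_le_norm z]
  · have hterm : ∀ p ∈ P, ‖1 + (z - 1) / (p : ℂ) - Complex.exp ((z - 1) / (p : ℂ))‖ ≤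
        θ ^ 2 * (1 / (p : ℝ) ^ 2) := by
      intro p hp
      have h3 : ‖(z - 1) / (p : ℂ)‖ ≤ |θ| / p := by
        rw [norm_div, Complex.norm_natCast]
        gcongr
      have h4 : ‖(z - 1) / (p : ℂ)‖ ≤ 1 := by
        refine h3.trans ?_
        rw [div_le_one (by linarith [hp1 p hp])]
        linarith [hp1 p hp]
      have h5 := Complex.norm_exp_sub_one_sub_id_le h4
      rw [norm_sub_rev]
      have e1 : Complex.exp ((z - 1) / (p : ℂ)) - (1 + (z - 1) / (p : ℂ)) =
          Complex.exp ((z - 1) / (p : ℂ)) - 1 - (z - 1) / (p : ℂ) := by ring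
      rw [e1]
      refine h5.trans ?_
      calc _ ≤ (|θ| / p) ^ 2 := by gcongr
        _ = _ := by rw [div_pow, sq_abs]; ring
    refine (Finset.sum_le_sum hterm).trans ?_
    rw [← Finset.mul_sum]
    gcongr
    exact (Real.summable_one_div_nat_pow.2 (by norm_num)).sum_le_tsum _ fun n _ ↦ by positivity

/-! ### The Erdős–Kac theorem -/

/-- The primes up to `N ^ (1 / log log N)`. -/
noncomputable def smallPrimes (N : ℕ) : Finset ℕ :=
  {p ∈ Finset.Ioc 0 ⌊Real.exp (Real.log N / Real.log (Real.log N))⌋₊ | p.Prime}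

/-- The sum of the reciprocals of the primes up to `N ^ (1 / log log N)`. -/
noncomputable def smallPrimesMass (N : ℕ) : ℝ :=
  ∑ p ∈ smallPrimes N, 1 / (p : ℝ)

theorem prime_of_mem_smallPrimes {N : ℕ} : ∀ p ∈ smallPrimes N, p.Prime :=
  fun _ hp ↦ (Finset.mem_filter.1 hp).2

theorem card_smallPrimes_le (N : ℕ) :
    ((smallPrimes N).card : ℝ) ≤ Real.exp (Real.log N / Real.log (Real.log N)) := by
  refine le_trans ?_ (Nat.floor_le (Real.exp_pos _).le)
  exact_mod_cast (Finset.card_filter_le _ _).trans (by simp)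

theorem smallPrimesMass_nonneg (N : ℕ) : 0 ≤ smallPrimesMass N :=
  Finset.sum_nonneg fun p _ ↦ by positivity

theorem smallPrimesMass_le_card (N : ℕ) : smallPrimesMass N ≤ (smallPrimes N).card := by
  rw [Finset.card_eq_sum_ones, Nat.cast_sum, smallPrimesMass]
  refine Finset.sum_le_sum fun p hp ↦ ?_
  have : (1 : ℝ) ≤ p := by exact_mod_cast (prime_of_mem_smallPrimes p hp).one_le
  rw [Nat.cast_one, div_le_one (by linarith)]
  exact this

open Filter Topology

theorem tendsto_sqrt_log_log :
    Tendsto (fun N : ℕ ↦ Real.sqrt (Real.log (Real.log N))) atTop atTop :=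
  Real.tendsto_sqrt_atTop.comp tendsto_log_log_natCast

theorem tendsto_log_add_const_div_sqrt (C : ℝ) :
    Tendsto (fun x : ℝ ↦ (Real.log x + C) / Real.sqrt x) atTop (𝓝 0) := by
  have h1 := (isLittleO_log_rpow_atTop (r := 1 / 2) (by norm_num)).tendsto_div_nhds_zero
  have h2 : Tendsto (fun x : ℝ ↦ C / Real.sqrt x) atTop (𝓝 0) :=
    tendsto_const_nhds.div_atTop Real.tendsto_sqrt_atTop
  have h3 := h1.add h2
  rw [add_zero] at h3
  refine h3.congr fun x ↦ ?_
  rw [← Real.sqrt_eq_rpow, add_div]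

/-- For y = N^(1/log log N), log log y = log log N - log log log N, so the truncation changes the
mean by o(√(log log N)). -/
theorem exists_abs_smallPrimesMass_sub_le : ∃ C : ℝ, 0 ≤ C ∧ ∀ᶠ N : ℕ in atTop,
    |smallPrimesMass N - Real.log (Real.log N)| ≤ Real.log (Real.log (Real.log N)) + C := by
  obtain ⟨C, hC0, hC⟩ := exists_abs_sum_prime_inv_sub_log_log_le
  refine ⟨C, hC0, ?_⟩
  have hlog : Tendsto (fun N : ℕ ↦ Real.log N) atTop atTop :=
    Real.tendsto_log_atTop.comp tendsto_natCast_atTop_atTop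
  have hy : Tendsto (fun x : ℝ ↦ x / Real.log x) atTop atTop := by
    have h1 := (Real.isLittleO_log_id_atTop).tendsto_div_nhds_zero
    have h2 : Tendsto (fun x : ℝ ↦ Real.log x / x) atTop (𝓝[>] 0) := by
      rw [tendsto_nhdsWithin_iff]
      refine ⟨h1, ?_⟩
      filter_upwards [eventually_gt_atTop 1] with x hx
      exact div_pos (Real.log_pos hx) (by linarith)
    refine (tendsto_inv_nhdsGT_zero.comp h2).congr fun x ↦ ?_
    simp
  filter_upwards [(hy.comp hlog).eventually_ge_atTop 1,
    tendsto_log_log_natCast.eventually_ge_atTop 1, hlog.eventually_gt_atTop 0] with N h1 h2 h3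
  simp only [Function.comp_apply] at h1
  have hexp : 2 ≤ Real.exp (Real.log N / Real.log (Real.log N)) := by
    linarith [Real.add_one_le_exp (Real.log N / Real.log (Real.log N))]
  have h4 := hC _ hexp
  rw [Real.log_exp, Real.log_div h3.ne' (by linarith)] at h4
  change |smallPrimesMass N - _| ≤ C at h4
  have h5 : 0 ≤ Real.log (Real.log (Real.log N)) := Real.log_nonneg h2
  rw [abs_le] at h4 ⊢
  constructor <;> linarith

theorem tendsto_smallPrimesMass_sub_div :
    Tendsto (fun N : ℕ ↦ (smallPrimesMass N - Real.log (Real.log N)) /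
      Real.sqrt (Real.log (Real.log N))) atTop (𝓝 0) := by
  obtain ⟨C, hC0, hC⟩ := exists_abs_smallPrimesMass_sub_le
  refine squeeze_zero_norm' ?_ ((tendsto_log_add_const_div_sqrt C).comp tendsto_log_log_natCast)
  filter_upwards [hC] with N hN
  rw [norm_div, Real.norm_eq_abs, Real.norm_of_nonneg (Real.sqrt_nonneg _)]
  exact div_le_div_of_nonneg_right hN (Real.sqrt_nonneg _)

theorem tendsto_smallPrimesMass_div :
    Tendsto (fun N : ℕ ↦ smallPrimesMass N / Real.log (Real.log N)) atTop (𝓝 1) := by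
  have h1 := (tendsto_smallPrimesMass_sub_div.div_atTop tendsto_sqrt_log_log).const_add 1
  rw [add_zero] at h1
  refine h1.congr' ?_
  filter_upwards [tendsto_log_log_natCast.eventually_gt_atTop 0] with N hN
  rw [div_div, Real.mul_self_sqrt hN.le]
  field_simp
  ring

/-- The reason for the cutoff: there are at most N^(1/log log N) = N^{o(1)} small primes, so the
rounding error in each fixed moment vanishes. -/
theorem tendsto_card_add_mass_pow_div (k : ℕ) :
    Tendsto (fun N : ℕ ↦ (((smallPrimes N).card + smallPrimesMass N) /
      Real.sqrt (Real.log (Real.log N))) ^ k / N) atTop (𝓝 0) := by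
  have hlog : Tendsto (fun N : ℕ ↦ Real.log N) atTop atTop :=
    Real.tendsto_log_atTop.comp tendsto_natCast_atTop_atTop
  have hlim : Tendsto (fun N : ℕ ↦ 2 ^ k * Real.exp (-(Real.log N / 2))) atTop (𝓝 0) := by
    rw [← mul_zero ((2 : ℝ) ^ k)]
    refine Tendsto.const_mul _ (Real.tendsto_exp_neg_atTop_nhds_zero.comp ?_)
    exact hlog.atTop_div_const (by norm_num)
  refine squeeze_zero' (Eventually.of_forall fun N ↦ ?_) ?_ hlim
  · have := smallPrimesMass_nonneg N
    positivity
  filter_upwards [tendsto_log_log_natCast.eventually_ge_atTop (2 * k),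
    tendsto_sqrt_log_log.eventually_ge_atTop 1, hlog.eventually_gt_atTop 0,
    tendsto_log_log_natCast.eventually_gt_atTop 0, eventually_gt_atTop 0] with N h1 h2 h3 h4 h5
  have hN0 : (0 : ℝ) < N := by exact_mod_cast h5
  set y := Real.exp (Real.log N / Real.log (Real.log N)) with hy
  have hc := card_smallPrimes_le N
  have hm := smallPrimesMass_le_card N
  have hm0 := smallPrimesMass_nonneg N
  have e1 : ((smallPrimes N).card + smallPrimesMass N) / Real.sqrt (Real.log (Real.log N)) ≤
      2 * y := by
    rw [div_le_iff₀ (by linarith)]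
    have : 0 < y := Real.exp_pos _
    nlinarith
  have e2 : y ^ k ≤ Real.exp (Real.log N / 2) := by
    rw [hy, ← Real.exp_nat_mul]
    apply Real.exp_le_exp.2
    rw [← mul_div_assoc, div_le_div_iff₀ h4 (by norm_num)]
    nlinarith
  have e3 : Real.exp (-(Real.log N / 2)) = Real.exp (Real.log N / 2) / N := by
    rw [eq_div_iff hN0.ne']
    nth_rewrite 2 [← Real.exp_log hN0]
    rw [← Real.exp_add]
    congr 1
    ring
  rw [e3, ← mul_div_assoc]
  gcongr
  calc _ ≤ (2 * y) ^ k := by gcongr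
    _ = 2 ^ k * y ^ k := mul_pow _ _ _
    _ ≤ _ := by gcongr

theorem tendsto_poissonized_charFun (ξ : ℝ) :
    Tendsto (fun N : ℕ ↦ Complex.exp ((smallPrimesMass N : ℝ) *
      (Complex.exp ((ξ / Real.sqrt (Real.log (Real.log N)) : ℝ) * Complex.I) - 1 -
        (ξ / Real.sqrt (Real.log (Real.log N)) : ℝ) * Complex.I))) atTop
      (𝓝 (Complex.exp (-(ξ ^ 2 / 2 : ℝ)))) := by
  refine (Complex.continuous_exp.tendsto _).comp ?_
  have hθ : Tendsto (fun N : ℕ ↦ ξ / Real.sqrt (Real.log (Real.log N))) atTop (𝓝 0) :=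
    tendsto_const_nhds.div_atTop tendsto_sqrt_log_log
  have hm2 : Tendsto (fun N : ℕ ↦ smallPrimesMass N *
      (ξ / Real.sqrt (Real.log (Real.log N))) ^ 2) atTop (𝓝 (ξ ^ 2)) := by
    have h1 := tendsto_smallPrimesMass_div.const_mul (ξ ^ 2)
    rw [mul_one] at h1
    refine h1.congr' ?_
    filter_upwards [tendsto_log_log_natCast.eventually_gt_atTop 0] with N hN
    rw [div_pow, Real.sq_sqrt hN.le]
    ring
  have hmain : Tendsto (fun N : ℕ ↦ ((-(smallPrimesMass N *
      (ξ / Real.sqrt (Real.log (Real.log N))) ^ 2 / 2) : ℝ) : ℂ)) atTop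
      (𝓝 (-(ξ ^ 2 / 2 : ℝ))) := by
    rw [← Complex.ofReal_neg]
    exact (Complex.continuous_ofReal.tendsto _).comp (hm2.div_const 2).neg
  have herr : Tendsto (fun N : ℕ ↦ (smallPrimesMass N : ℂ) *
      (Complex.exp ((ξ / Real.sqrt (Real.log (Real.log N)) : ℝ) * Complex.I) - 1 -
        (ξ / Real.sqrt (Real.log (Real.log N)) : ℝ) * Complex.I) -
      ((-(smallPrimesMass N * (ξ / Real.sqrt (Real.log (Real.log N))) ^ 2 / 2) : ℝ) : ℂ))
      atTop (𝓝 0) := by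
    have hb := hm2.mul hθ.abs
    rw [abs_zero, mul_zero] at hb
    refine squeeze_zero_norm (fun N ↦ ?_) hb
    set θ := ξ / Real.sqrt (Real.log (Real.log N))
    have h := norm_exp_mul_I_sub_sum_le 3 θ
    have e1 : ∑ j ∈ Finset.range 3, ((θ : ℂ) * Complex.I) ^ j / (j.factorial : ℂ) =
        1 + θ * Complex.I - (θ : ℂ) ^ 2 / 2 := by
      simp [Finset.sum_range_succ, Nat.factorial, mul_pow]
      ring
    rw [e1] at h
    have e2 : (smallPrimesMass N : ℂ) * (Complex.exp ((θ : ℝ) * Complex.I) - 1 -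
        (θ : ℝ) * Complex.I) - ((-(smallPrimesMass N * θ ^ 2 / 2) : ℝ) : ℂ) =
        (smallPrimesMass N : ℂ) * (Complex.exp ((θ : ℝ) * Complex.I) -
          (1 + θ * Complex.I - (θ : ℂ) ^ 2 / 2)) := by
      push_cast; ring
    rw [e2, norm_mul, Complex.norm_real, Real.norm_of_nonneg (smallPrimesMass_nonneg N), mul_assoc]
    refine mul_le_mul_of_nonneg_left (h.trans ?_) (smallPrimesMass_nonneg N)
    rw [← sq_abs θ, ← pow_succ]
    exact div_le_self (by positivity) (by exact_mod_cast Nat.factorial_pos 3)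
  have := herr.add hmain
  rw [zero_add] at this
  exact this.congr fun N ↦ by ring

theorem tendsto_charFun_smallPrimes_model (ξ : ℝ) :
    Tendsto (fun N : ℕ ↦ ∑ S ∈ (smallPrimes N).powerset, (divisorWeight (smallPrimes N) S : ℂ) *
      Complex.exp ((ξ * ((S.card - smallPrimesMass N) / Real.sqrt (Real.log (Real.log N))) : ℝ) *
        Complex.I)) atTop (𝓝 (Complex.exp (-(ξ ^ 2 / 2 : ℝ)))) := by
  have hθ : Tendsto (fun N : ℕ ↦ ξ / Real.sqrt (Real.log (Real.log N))) atTop (𝓝 0) :=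
    tendsto_const_nhds.div_atTop tendsto_sqrt_log_log
  have hb := (hθ.pow 2).mul_const (∑' n : ℕ, 1 / (n : ℝ) ^ 2)
  rw [zero_pow two_ne_zero, zero_mul] at hb
  have hdiff : Tendsto (fun N : ℕ ↦ ∑ S ∈ (smallPrimes N).powerset,
      (divisorWeight (smallPrimes N) S : ℂ) *
      Complex.exp ((ξ * ((S.card - smallPrimesMass N) / Real.sqrt (Real.log (Real.log N))) : ℝ) *
        Complex.I) - Complex.exp ((smallPrimesMass N : ℝ) *
      (Complex.exp ((ξ / Real.sqrt (Real.log (Real.log N)) : ℝ) * Complex.I) - 1 -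
        (ξ / Real.sqrt (Real.log (Real.log N)) : ℝ) * Complex.I))) atTop (𝓝 0) := by
    refine squeeze_zero_norm' ?_ hb
    filter_upwards [hθ.abs.eventually_le_const (show |(0 : ℝ)| < 1 by simp)] with N hN
    refine le_trans (le_of_eq ?_)
      (norm_sum_divisorWeight_mul_exp_sub_le (P := smallPrimes N) prime_of_mem_smallPrimes hN)
    congr 2
    refine Finset.sum_congr rfl fun S _ ↦ ?_
    rw [← smallPrimesMass]
    congr 4
    ring
  have := hdiff.add (tendsto_poissonized_charFun ξ)
  rw [zero_add] at this
  exact this.congr fun N ↦ by ring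

theorem tendsto_charFun_smallPrimes_count (ξ : ℝ) :
    Tendsto (fun N : ℕ ↦ ∑ n ∈ Finset.Ioc 0 N, ((1 / (N : ℝ) : ℝ) : ℂ) *
      Complex.exp ((ξ * (((((smallPrimes N).filter (· ∣ n)).card : ℝ) - smallPrimesMass N) /
        Real.sqrt (Real.log (Real.log N))) : ℝ) * Complex.I)) atTop
      (𝓝 (Complex.exp (-(ξ ^ 2 / 2 : ℝ)))) := by
  set A : ℕ → ℂ := fun N ↦ ∑ n ∈ Finset.Ioc 0 N, ((1 / (N : ℝ) : ℝ) : ℂ) *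
      Complex.exp ((ξ * (((((smallPrimes N).filter (· ∣ n)).card : ℝ) - smallPrimesMass N) /
        Real.sqrt (Real.log (Real.log N))) : ℝ) * Complex.I)
  set B : ℕ → ℂ := fun N ↦ ∑ S ∈ (smallPrimes N).powerset,
      (divisorWeight (smallPrimes N) S : ℂ) *
      Complex.exp ((ξ * ((S.card - smallPrimesMass N) / Real.sqrt (Real.log (Real.log N))) : ℝ) *
        Complex.I)
  suffices h : Tendsto (fun N ↦ A N - B N) atTop (𝓝 0) by
    have := h.add (tendsto_charFun_smallPrimes_model ξ)
    rw [zero_add] at this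
    exact this.congr fun N ↦ sub_add_cancel _ _
  rw [tendsto_zero_iff_norm_tendsto_zero]
  -- This choice gives |ξ|/r ≤ 1/2, so the Taylor remainder decays like 4^{-k}; the summand 1 keeps
  -- r positive at ξ = 0.
  set r : ℝ := 2 * |ξ| + 1 with hr
  have hr0 : 0 < r := by positivity
  set E : ℕ → ℕ → ℝ := fun j N ↦ (((smallPrimes N).card + smallPrimesMass N) /
      Real.sqrt (Real.log (Real.log N))) ^ j / N with hE
  -- the moment comparison, with the even moments of the model bounded by its exponential moments
  have hkey : ∀ k : ℕ, ∀ᶠ N in atTop, ‖A N - B N‖ ≤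
      (∑ j ∈ Finset.range (2 * k), |ξ| ^ j / j.factorial * E j N +
        |ξ| ^ (2 * k) / (2 * k).factorial * E (2 * k) N) +
      4 * Real.exp (2 * r ^ 2) * (1 / 2) ^ (2 * k) := by
    intro k
    filter_upwards [eventually_gt_atTop 0, tendsto_sqrt_log_log.eventually_ge_atTop r,
      tendsto_smallPrimesMass_div.eventually_le_const (show (1 : ℝ) < 2 by norm_num),
      tendsto_log_log_natCast.eventually_gt_atTop 0] with N hN hσ hm hv
    have hN0 : (0 : ℝ) < N := by exact_mod_cast hN
    have hσ0 : 0 < Real.sqrt (Real.log (Real.log N)) := Real.sqrt_pos.2 hv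
    have h1 := norm_sum_exp_sub_sum_exp_le (s := Finset.Ioc 0 N) (t := (smallPrimes N).powerset)
      (w := fun _ ↦ 1 / (N : ℝ)) (v := divisorWeight (smallPrimes N))
      (fun _ _ ↦ by positivity) (fun S _ ↦ divisorWeight_nonneg prime_of_mem_smallPrimes S)
      (fun n ↦ ((((smallPrimes N).filter (· ∣ n)).card : ℝ) - smallPrimesMass N) /
        Real.sqrt (Real.log (Real.log N)))
      (fun S ↦ (S.card - smallPrimesMass N) / Real.sqrt (Real.log (Real.log N))) ξ k
    refine h1.trans ?_
    have hmom := fun j ↦ abs_average_centered_pow_sub_le (P := smallPrimes N)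
      prime_of_mem_smallPrimes hN (smallPrimesMass_nonneg N) hσ0 j
    have heven := sum_divisorWeight_mul_even_pow_le (P := smallPrimes N)
      prime_of_mem_smallPrimes hr0 hσ k
    rw [← smallPrimesMass] at heven
    have hexp : Real.exp (smallPrimesMass N * (r / Real.sqrt (Real.log (Real.log N))) ^ 2) ≤
        Real.exp (2 * r ^ 2) := by
      apply Real.exp_le_exp.2
      rw [div_pow, Real.sq_sqrt hv.le, mul_div_assoc', mul_comm, ← mul_div_assoc', mul_comm]
      gcongr
    set M1 := ∑ n ∈ Finset.Ioc 0 N, 1 / (N : ℝ) *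
      ((((smallPrimes N).filter (· ∣ n)).card - smallPrimesMass N) /
        Real.sqrt (Real.log (Real.log N))) ^ (2 * k)
    set M2 := ∑ S ∈ (smallPrimes N).powerset, divisorWeight (smallPrimes N) S *
      ((S.card - smallPrimesMass N) / Real.sqrt (Real.log (Real.log N))) ^ (2 * k)
    have h2 : M1 ≤ M2 + E (2 * k) N := by
      have := (abs_le.1 (hmom (2 * k))).2
      linarith
    have hξr : |ξ| ^ (2 * k) / r ^ (2 * k) ≤ (1 / 2) ^ (2 * k) := by
      rw [← div_pow]
      refine pow_le_pow_left₀ (by positivity) ?_ _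
      rw [div_le_div_iff₀ hr0 (by norm_num), hr]
      linarith [abs_nonneg ξ]
    have h3 : |ξ| ^ (2 * k) / (2 * k).factorial * (2 * M2) ≤
        4 * Real.exp (2 * r ^ 2) * (1 / 2) ^ (2 * k) := by
      calc _ ≤ |ξ| ^ (2 * k) / (2 * k).factorial * (2 * ((2 * k).factorial / r ^ (2 * k) *
            (2 * Real.exp (2 * r ^ 2)))) := by
            gcongr
            refine heven.trans ?_
            gcongr
        _ = 4 * Real.exp (2 * r ^ 2) * (|ξ| ^ (2 * k) / r ^ (2 * k)) := by
            have : ((2 * k).factorial : ℝ) ≠ 0 := by positivity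
            field_simp
            ring
        _ ≤ _ := by gcongr
    have h4 : |ξ| ^ (2 * k) / (2 * k).factorial * (M1 + M2) ≤
        |ξ| ^ (2 * k) / (2 * k).factorial * E (2 * k) N +
          |ξ| ^ (2 * k) / (2 * k).factorial * (2 * M2) := by
      rw [← mul_add]
      exact mul_le_mul_of_nonneg_left (by linarith) (by positivity)
    have h5 : ∑ j ∈ Finset.range (2 * k), |ξ| ^ j / j.factorial *
        |∑ n ∈ Finset.Ioc 0 N, 1 / (N : ℝ) *
            ((((smallPrimes N).filter (· ∣ n)).card - smallPrimesMass N) /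
              Real.sqrt (Real.log (Real.log N))) ^ j -
          ∑ S ∈ (smallPrimes N).powerset, divisorWeight (smallPrimes N) S *
            ((S.card - smallPrimesMass N) / Real.sqrt (Real.log (Real.log N))) ^ j| ≤
        ∑ j ∈ Finset.range (2 * k), |ξ| ^ j / j.factorial * E j N :=
      Finset.sum_le_sum fun j _ ↦ mul_le_mul_of_nonneg_left (hmom j) (by positivity)
    linarith
  have hElim : ∀ j, Tendsto (E j) atTop (𝓝 0) := tendsto_card_add_mass_pow_div
  have hsmall : ∀ k : ℕ, Tendsto (fun N ↦ ∑ j ∈ Finset.range (2 * k), |ξ| ^ j / j.factorial * E j N +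
        |ξ| ^ (2 * k) / (2 * k).factorial * E (2 * k) N) atTop (𝓝 0) := by
    intro k
    have h1 := tendsto_finsetSum (Finset.range (2 * k)) fun j _ ↦
      (hElim j).const_mul (|ξ| ^ j / j.factorial)
    have h2 := h1.add ((hElim (2 * k)).const_mul (|ξ| ^ (2 * k) / (2 * k).factorial))
    simpa using h2
  have hgeom : Tendsto (fun k : ℕ ↦ 4 * Real.exp (2 * r ^ 2) * (1 / 2 : ℝ) ^ (2 * k)) atTop
      (𝓝 0) := by
    have h1 := tendsto_pow_atTop_nhds_zero_of_lt_one (by norm_num : (0 : ℝ) ≤ (1 / 2) ^ 2)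
      (by norm_num)
    have h2 := h1.const_mul (4 * Real.exp (2 * r ^ 2))
    rw [mul_zero] at h2
    exact h2.congr fun k ↦ by rw [pow_mul]
  rw [Metric.tendsto_atTop']
  intro ε hε
  -- The order k is fixed first, uniformly in N; only then does N grow and the finitely many moment
  -- differences vanish.
  obtain ⟨k, hk⟩ := (hgeom.eventually_lt_const (half_pos hε)).exists
  obtain ⟨n₀, hn₀⟩ := eventually_atTop.1
    ((hkey k).and ((hsmall k).eventually_lt_const (half_pos hε)))
  refine ⟨n₀, fun N hN ↦ ?_⟩
  obtain ⟨h1, h2⟩ := hn₀ N hN.le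
  rw [Real.dist_eq, sub_zero, abs_of_nonneg (norm_nonneg _)]
  linarith

/-! ### From the small primes to `Ω` -/

theorem cardFactors_le_sum_dvd {n N : ℕ} (hn : 0 < n) (hnN : n ≤ N) :
    (ArithmeticFunction.cardFactors n : ℝ) ≤
      ∑ p ∈ Finset.Ioc 0 N with p.Prime, ∑ k ∈ Finset.Icc 1 N, if p ^ k ∣ n then (1 : ℝ) else 0 := by
  rw [ArithmeticFunction.cardFactors_eq_sum_factorization, Finsupp.sum, Nat.support_factorization,
    Nat.cast_sum]
  have hsub : n.primeFactors ⊆ (Finset.Ioc 0 N).filter Nat.Prime := by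
    intro p hp
    rw [Nat.mem_primeFactors] at hp
    rw [Finset.mem_filter, Finset.mem_Ioc]
    exact ⟨⟨hp.1.pos, (Nat.le_of_dvd hn hp.2.1).trans hnN⟩, hp.1⟩
  refine le_trans (Finset.sum_le_sum fun p hp ↦ ?_)
    (Finset.sum_le_sum_of_subset_of_nonneg hsub
      fun p _ _ ↦ Finset.sum_nonneg fun k _ ↦ by positivity)
  rw [Nat.factorization_eq_card_pow_dvd n (Nat.prime_of_mem_primeFactors hp), Finset.sum_boole]
  refine Nat.cast_le.2 (Finset.card_le_card (Finset.filter_subset_filter _ fun k hk ↦ ?_))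
  rw [Finset.mem_Ico] at hk
  rw [Finset.mem_Icc]
  omega

theorem sum_Ioc_boole_dvd (N d : ℕ) :
    ∑ n ∈ Finset.Ioc 0 N, (if d ∣ n then (1 : ℝ) else 0) = (N / d : ℕ) := by
  rw [Finset.sum_boole, Nat.Ioc_filter_dvd_card_eq_div]

theorem exists_sum_cardFactors_le : ∃ C : ℝ, 0 ≤ C ∧ ∀ N : ℕ, 2 ≤ N →
    ∑ n ∈ Finset.Ioc 0 N, (ArithmeticFunction.cardFactors n : ℝ) ≤
      N * (Real.log (Real.log N) + C) := by
  obtain ⟨C, hC0, hC⟩ := exists_abs_sum_prime_inv_sub_log_log_le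
  have hsum : Summable fun n : ℕ ↦ 1 / (n : ℝ) ^ 2 :=
    Real.summable_one_div_nat_pow.2 (by norm_num)
  set D := ∑' n : ℕ, 1 / (n : ℝ) ^ 2
  have hD0 : 0 ≤ D := tsum_nonneg fun n ↦ by positivity
  refine ⟨C + 2 * D, by positivity, fun N hN ↦ ?_⟩
  have h1 := (abs_le.1 (hC N (by exact_mod_cast hN))).2
  rw [Nat.floor_natCast] at h1
  calc ∑ n ∈ Finset.Ioc 0 N, (ArithmeticFunction.cardFactors n : ℝ)
      ≤ ∑ n ∈ Finset.Ioc 0 N, ∑ p ∈ Finset.Ioc 0 N with p.Prime, ∑ k ∈ Finset.Icc 1 N,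
          if p ^ k ∣ n then (1 : ℝ) else 0 := Finset.sum_le_sum fun n hn ↦ by
        rw [Finset.mem_Ioc] at hn
        exact cardFactors_le_sum_dvd hn.1 hn.2
    _ = ∑ p ∈ Finset.Ioc 0 N with p.Prime, ∑ k ∈ Finset.Icc 1 N, ((N / p ^ k : ℕ) : ℝ) := by
        rw [Finset.sum_comm]
        refine Finset.sum_congr rfl fun p _ ↦ ?_
        rw [Finset.sum_comm]
        exact Finset.sum_congr rfl fun k _ ↦ sum_Ioc_boole_dvd N (p ^ k)
    _ ≤ ∑ p ∈ Finset.Ioc 0 N with p.Prime, N * (1 / (p : ℝ) + 2 * (1 / (p : ℝ) ^ 2)) := by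
        refine Finset.sum_le_sum fun p hp ↦ ?_
        have hp' := (Finset.mem_filter.1 hp).2
        have hk : ∀ k ∈ Finset.Icc 1 N, ((N / p ^ k : ℕ) : ℝ) ≤ N * (1 / (p : ℝ) ^ k) := by
          intro k _
          refine Nat.cast_div_le.trans (le_of_eq ?_)
          push_cast; ring
        refine (Finset.sum_le_sum hk).trans ?_
        rw [← Finset.mul_sum]
        gcongr
        have hsplit : Finset.Icc 1 N = insert 1 (Finset.Icc 2 N) := by
          ext k; simp only [Finset.mem_Icc, Finset.mem_insert]; omega
        rw [hsplit, Finset.sum_insert (by simp), pow_one]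
        have := sum_Icc_two_one_div_pow_le hp'.two_le N
        rw [mul_one_div]
        linarith
    _ = N * (∑ p ∈ Finset.Ioc 0 N with p.Prime, 1 / (p : ℝ) +
          2 * ∑ p ∈ Finset.Ioc 0 N with p.Prime, 1 / (p : ℝ) ^ 2) := by
        rw [← Finset.mul_sum, Finset.sum_add_distrib, ← Finset.mul_sum]
    _ ≤ N * (Real.log (Real.log N) + (C + 2 * D)) := by
        have h2 : ∑ p ∈ Finset.Ioc 0 N with p.Prime, 1 / (p : ℝ) ^ 2 ≤ D :=
          hsum.sum_le_tsum _ fun n _ ↦ by positivity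
        exact mul_le_mul_of_nonneg_left (by linarith) (Nat.cast_nonneg N)

theorem card_filter_dvd_le_cardFactors {P : Finset ℕ} (hP : ∀ p ∈ P, p.Prime) {n : ℕ}
    (hn : 0 < n) : (P.filter (· ∣ n)).card ≤ ArithmeticFunction.cardFactors n := by
  have hsub : P.filter (· ∣ n) ⊆ n.primeFactors := by
    intro p hp
    rw [Finset.mem_filter] at hp
    exact Nat.mem_primeFactors.2 ⟨hP p hp.1, hp.2, hn.ne'⟩
  refine (Finset.card_le_card hsub).trans ?_
  rw [ArithmeticFunction.cardFactors_apply]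
  exact List.toFinset_card_le _

theorem le_sum_card_filter_dvd (P : Finset ℕ) (N : ℕ) :
    N * ∑ p ∈ P, 1 / (p : ℝ) - P.card ≤
      ∑ n ∈ Finset.Ioc 0 N, ((P.filter (· ∣ n)).card : ℝ) := by
  have h1 : ∑ n ∈ Finset.Ioc 0 N, ((P.filter (· ∣ n)).card : ℝ) = ∑ p ∈ P, ((N / p : ℕ) : ℝ) := by
    simp_rw [← Finset.sum_boole]
    rw [Finset.sum_comm]
    exact Finset.sum_congr rfl fun p _ ↦ sum_Ioc_boole_dvd N p
  rw [h1, Finset.card_eq_sum_ones, Nat.cast_sum, Finset.mul_sum, ← Finset.sum_sub_distrib]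
  refine Finset.sum_le_sum fun p _ ↦ ?_
  have := Nat.lt_floor_add_one ((N : ℝ) / p)
  rw [Nat.floor_div_eq_div] at this
  rw [Nat.cast_one, mul_one_div]
  linarith

theorem norm_exp_mul_I_sub_exp_mul_I_le (a b : ℝ) :
    ‖Complex.exp (a * Complex.I) - Complex.exp (b * Complex.I)‖ ≤ |a - b| := by
  have h1 : Complex.exp (a * Complex.I) - Complex.exp (b * Complex.I) =
      Complex.exp (b * Complex.I) * (Complex.exp (Complex.I * (a - b : ℝ)) - 1) := by
    rw [mul_sub, ← Complex.exp_add, mul_one]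
    congr 2
    push_cast; ring
  rw [h1, norm_mul, Complex.norm_exp_ofReal_mul_I, one_mul]
  exact Real.norm_exp_I_mul_ofReal_sub_one_le

/-- The count of small prime divisors never exceeds Ω, so the mean absolute difference is a
difference of means, and first moments suffice: with m = `smallPrimesMass N` it is at most log log N
- m + O(1) = o(√(log log N)). Since x ↦ e^{iξx} is |ξ|-Lipschitz, the characteristic functions
merge. -/
theorem tendsto_average_exp_normalizedOmega (ξ : ℝ) :
    Tendsto (fun N : ℕ ↦ ∑ n ∈ Finset.Ioc 0 N, ((1 / (N : ℝ) : ℝ) : ℂ) *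
      Complex.exp ((ξ * normalizedOmega N n : ℝ) * Complex.I)) atTop
      (𝓝 (Complex.exp (-(ξ ^ 2 / 2 : ℝ)))) := by
  set A : ℕ → ℂ := fun N ↦ ∑ n ∈ Finset.Ioc 0 N, ((1 / (N : ℝ) : ℝ) : ℂ) *
      Complex.exp ((ξ * normalizedOmega N n : ℝ) * Complex.I)
  set B : ℕ → ℂ := fun N ↦ ∑ n ∈ Finset.Ioc 0 N, ((1 / (N : ℝ) : ℝ) : ℂ) *
      Complex.exp ((ξ * (((((smallPrimes N).filter (· ∣ n)).card : ℝ) - smallPrimesMass N) /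
        Real.sqrt (Real.log (Real.log N))) : ℝ) * Complex.I)
  suffices h : Tendsto (fun N ↦ A N - B N) atTop (𝓝 0) by
    have := h.add (tendsto_charFun_smallPrimes_count ξ)
    rw [zero_add] at this
    exact this.congr fun N ↦ sub_add_cancel _ _
  obtain ⟨C, hC0, hC⟩ := exists_sum_cardFactors_le
  have hlim : Tendsto (fun N : ℕ ↦ |ξ| * (2 * |(smallPrimesMass N - Real.log (Real.log N)) /
      Real.sqrt (Real.log (Real.log N))| + (C + 1) / Real.sqrt (Real.log (Real.log N)))) atTop
      (𝓝 0) := by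
    have h1 := (tendsto_smallPrimesMass_sub_div.abs.const_mul 2).add
      ((tendsto_const_nhds (x := C + 1)).div_atTop tendsto_sqrt_log_log)
    simpa using h1.const_mul |ξ|
  refine squeeze_zero_norm' ?_ hlim
  filter_upwards [eventually_ge_atTop 2, tendsto_log_log_natCast.eventually_ge_atTop 1,
    (Real.tendsto_log_atTop.comp tendsto_natCast_atTop_atTop).eventually_ge_atTop 0]
    with N hN hv hlogN
  simp only [Function.comp_apply] at hlogN
  have hN0 : (0 : ℝ) < N := by positivity
  have hσ0 : 0 < Real.sqrt (Real.log (Real.log N)) := Real.sqrt_pos.2 (by linarith)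
  have hcard : ((smallPrimes N).card : ℝ) ≤ N := by
    refine (card_smallPrimes_le N).trans ?_
    nth_rewrite 3 [← Real.exp_log hN0]
    exact Real.exp_le_exp.2 (div_le_self hlogN hv)
  have hΩ := hC N hN
  have hω := le_sum_card_filter_dvd (smallPrimes N) N
  rw [← smallPrimesMass] at hω
  set v := Real.log (Real.log N) with hvdef
  set σ := Real.sqrt v with hσ
  set m := smallPrimesMass N
  set w : ℕ → ℝ := fun n ↦ ((smallPrimes N).filter (· ∣ n)).card with hw
  have hterm : ∀ n ∈ Finset.Ioc 0 N, ‖((1 / (N : ℝ) : ℝ) : ℂ) *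
      Complex.exp ((ξ * normalizedOmega N n : ℝ) * Complex.I) - ((1 / (N : ℝ) : ℝ) : ℂ) *
      Complex.exp ((ξ * ((w n - m) / σ) : ℝ) * Complex.I)‖ ≤
      1 / N * (|ξ| * ((ArithmeticFunction.cardFactors n - w n) / σ + |(m - v) / σ|)) := by
    intro n hn
    have hn0 := (Finset.mem_Ioc.1 hn).1
    rw [← mul_sub, norm_mul, Complex.norm_real, Real.norm_of_nonneg (by positivity)]
    refine mul_le_mul_of_nonneg_left ?_ (by positivity)
    refine (norm_exp_mul_I_sub_exp_mul_I_le _ _).trans ?_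
    rw [← mul_sub, abs_mul]
    refine mul_le_mul_of_nonneg_left ?_ (abs_nonneg _)
    have e1 : normalizedOmega N n - (w n - m) / σ =
        (ArithmeticFunction.cardFactors n - w n) / σ + (m - v) / σ := by
      rw [normalizedOmega, ← hvdef, ← hσ]; ring
    have e2 : w n ≤ ArithmeticFunction.cardFactors n := by
      exact Nat.cast_le.2 (card_filter_dvd_le_cardFactors prime_of_mem_smallPrimes hn0)
    rw [e1]
    refine (abs_add_le _ _).trans ?_
    rw [abs_of_nonneg (div_nonneg (sub_nonneg.2 e2) hσ0.le)]
  have h1 : ‖A N - B N‖ ≤ ∑ n ∈ Finset.Ioc 0 N,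
      1 / N * (|ξ| * ((ArithmeticFunction.cardFactors n - w n) / σ + |(m - v) / σ|)) := by
    simp only [A, B]
    rw [← Finset.sum_sub_distrib]
    exact (norm_sum_le _ _).trans (Finset.sum_le_sum hterm)
  have h2 : ∑ n ∈ Finset.Ioc 0 N,
      1 / N * (|ξ| * ((ArithmeticFunction.cardFactors n - w n) / σ + |(m - v) / σ|)) =
      |ξ| * ((∑ n ∈ Finset.Ioc 0 N, (ArithmeticFunction.cardFactors n : ℝ) -
        ∑ n ∈ Finset.Ioc 0 N, w n) / N / σ + |(m - v) / σ|) := by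
    rw [← Finset.mul_sum, ← Finset.mul_sum, Finset.sum_add_distrib, ← Finset.sum_div,
      Finset.sum_sub_distrib, Finset.sum_const, Nat.card_Ioc, nsmul_eq_mul, Nat.sub_zero]
    field_simp
  rw [h2] at h1
  refine h1.trans (mul_le_mul_of_nonneg_left ?_ (abs_nonneg ξ))
  have h3 : (∑ n ∈ Finset.Ioc 0 N, (ArithmeticFunction.cardFactors n : ℝ) -
        ∑ n ∈ Finset.Ioc 0 N, w n) / N ≤ (v - m) + (C + 1) := by
    rw [div_le_iff₀ hN0]
    linarith
  have h4 : (v - m) / σ ≤ |(m - v) / σ| := by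
    rw [← abs_neg, ← neg_div, neg_sub]
    exact le_abs_self _
  calc _ ≤ ((v - m) + (C + 1)) / σ + |(m - v) / σ| := by gcongr
    _ = (v - m) / σ + (C + 1) / σ + |(m - v) / σ| := by rw [add_div]
    _ ≤ _ := by linarith

/-! ### Weak convergence to the Gaussian law -/

open MeasureTheory ProbabilityTheory

/-- The law of `normalizedOmega N n` for `n` uniform in `1, …, N`. -/
noncomputable def normalizedOmegaLaw (N : ℕ) : Measure ℝ :=
  ∑ n ∈ Finset.Ioc 0 N, ENNReal.ofReal (1 / N) • Measure.dirac (normalizedOmega N n)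

theorem isProbabilityMeasure_normalizedOmegaLaw {N : ℕ} (hN : 0 < N) :
    IsProbabilityMeasure (normalizedOmegaLaw N) := by
  have hN0 : (0 : ℝ) < N := by exact_mod_cast hN
  constructor
  rw [normalizedOmegaLaw, Measure.finsetSum_apply]
  simp only [Measure.smul_apply, measure_univ, smul_eq_mul, mul_one, Finset.sum_const,
    Nat.card_Ioc, Nat.sub_zero, nsmul_eq_mul]
  rw [← ENNReal.ofReal_natCast, ← ENNReal.ofReal_mul hN0.le, mul_one_div_cancel hN0.ne',
    ENNReal.ofReal_one]

theorem charFun_normalizedOmegaLaw (N : ℕ) (ξ : ℝ) :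
    charFun (normalizedOmegaLaw N) ξ = ∑ n ∈ Finset.Ioc 0 N, ((1 / (N : ℝ) : ℝ) : ℂ) *
      Complex.exp ((ξ * normalizedOmega N n : ℝ) * Complex.I) := by
  rw [charFun_apply_real, normalizedOmegaLaw, integral_finsetSum_measure]
  · refine Finset.sum_congr rfl fun n _ ↦ ?_
    rw [integral_smul_measure, integral_dirac, ENNReal.toReal_ofReal (by positivity)]
    simp
  · intro n _
    exact (integrable_dirac (by simp)).smul_measure ENNReal.ofReal_ne_top

theorem normalizedOmegaLaw_Icc (N : ℕ) (A B : ℝ) :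
    (normalizedOmegaLaw N (Set.Icc A B)).toReal =
      (((Finset.Ioc 0 N).filter
        fun n ↦ A ≤ normalizedOmega N n ∧ normalizedOmega N n ≤ B).card : ℝ) / N := by
  rw [normalizedOmegaLaw, Measure.finsetSum_apply, ENNReal.toReal_sum]
  · rw [Finset.card_filter, Nat.cast_sum, Finset.sum_div]
    refine Finset.sum_congr rfl fun n _ ↦ ?_
    rw [Measure.smul_apply, Measure.dirac_apply' _ measurableSet_Icc, smul_eq_mul,
      ENNReal.toReal_mul, ENNReal.toReal_ofReal (by positivity), Set.indicator_apply]
    by_cases h : A ≤ normalizedOmega N n ∧ normalizedOmega N n ≤ B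
    · rw [if_pos (Set.mem_Icc.2 h), if_pos h]; simp
    · rw [if_neg (fun h' ↦ h (Set.mem_Icc.1 h')), if_neg h]; simp
  · intro n _
    rw [Measure.smul_apply, smul_eq_mul]
    exact ENNReal.mul_ne_top ENNReal.ofReal_ne_top (measure_ne_top _ _)

theorem gaussianReal_Icc {A B : ℝ} (hAB : A ≤ B) :
    (gaussianReal 0 1 (Set.Icc A B)).toReal =
      (1 / Real.sqrt (2 * Real.pi)) * ∫ t in A..B, Real.exp (-t ^ 2 / 2) := by
  rw [gaussianReal_apply_eq_integral _ one_ne_zero, ENNReal.toReal_ofReal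
    (integral_nonneg fun x ↦ gaussianPDFReal_nonneg _ _ _), integral_Icc_eq_integral_Ioc,
    ← intervalIntegral.integral_of_le hAB, ← intervalIntegral.integral_const_mul]
  refine intervalIntegral.integral_congr fun x _ ↦ ?_
  simp [gaussianPDFReal_def]

/-- The **Erdős–Kac theorem** for `Ω`. -/
theorem tendsto_card_normalizedOmega_mem_Icc {A B : ℝ} (hAB : A ≤ B) :
    Tendsto (fun N : ℕ ↦ (((Finset.Ioc 0 N).filter
        fun n ↦ A ≤ normalizedOmega N n ∧ normalizedOmega N n ≤ B).card : ℝ) / N) atTop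
      (𝓝 ((1 / Real.sqrt (2 * Real.pi)) * ∫ t in A..B, Real.exp (-t ^ 2 / 2))) := by
  -- The shift excludes N = 0, where the law is the zero measure.
  rw [← tendsto_add_atTop_iff_nat 1, ← gaussianReal_Icc hAB]
  simp_rw [← normalizedOmegaLaw_Icc]
  set μ : ℕ → ProbabilityMeasure ℝ := fun N ↦
    ⟨normalizedOmegaLaw (N + 1), isProbabilityMeasure_normalizedOmegaLaw N.succ_pos⟩
  set γ : ProbabilityMeasure ℝ := ⟨gaussianReal 0 1, inferInstance⟩
  have hμ : Tendsto μ atTop (𝓝 γ) := by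
    refine ProbabilityMeasure.tendsto_of_tendsto_charFun fun ξ ↦ ?_
    have h1 := (tendsto_add_atTop_iff_nat 1).2 (tendsto_average_exp_normalizedOmega ξ)
    have h2 : charFun (γ : Measure ℝ) ξ = Complex.exp (-(ξ ^ 2 / 2 : ℝ)) := by
      change charFun (gaussianReal 0 1) ξ = _
      rw [charFun_gaussianReal]
      congr 1
      push_cast
      ring
    rw [h2]
    exact h1.congr fun N ↦ (charFun_normalizedOmegaLaw (N + 1) ξ).symm
  -- The Gaussian has no atoms, so the portmanteau theorem applies to [A, B].
  have hnull : (γ : Measure ℝ) (frontier (Set.Icc A B)) = 0 := by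
    rw [frontier_Icc hAB]
    have : NullSingletonClass (gaussianReal 0 1) := nullSingletonClass_gaussianReal one_ne_zero
    exact (Set.toFinite {A, B}).measure_zero (gaussianReal 0 1)
  have h := ProbabilityMeasure.tendsto_measure_of_null_frontier_of_tendsto' hμ hnull
  exact (ENNReal.tendsto_toReal (measure_ne_top _ _)).comp h

/-! ### Liouville-weighted distribution of `Ω` -/

theorem gaussianMass_le {A B : ℝ} (hAB : A ≤ B) :
    (1 / Real.sqrt (2 * Real.pi)) * ∫ t in A..B, Real.exp (-t ^ 2 / 2) ≤ B - A := by
  have h1 : ∫ t in A..B, Real.exp (-t ^ 2 / 2) ≤ ∫ _ in A..B, (1 : ℝ) :=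
    intervalIntegral.integral_mono_on hAB (Continuous.intervalIntegrable (by fun_prop) _ _)
      (Continuous.intervalIntegrable (by fun_prop) _ _)
      fun t _ ↦ Real.exp_le_one_iff.2 (by have := sq_nonneg t; linarith)
  rw [intervalIntegral.integral_const, smul_eq_mul, mul_one] at h1
  have h2 : 1 / Real.sqrt (2 * Real.pi) ≤ 1 := by
    rw [div_le_one (Real.sqrt_pos.2 (by positivity))]
    exact Real.one_le_sqrt.2 (by linarith [Real.pi_gt_three])
  have h3 : 0 ≤ ∫ t in A..B, Real.exp (-t ^ 2 / 2) :=
    intervalIntegral.integral_nonneg hAB fun t _ ↦ (Real.exp_pos _).le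
  calc _ ≤ 1 * ∫ t in A..B, Real.exp (-t ^ 2 / 2) := by gcongr
    _ ≤ _ := by linarith

/-- The continuous trapezoid equal to `1` on `[A, B]` and to `0` off `[A - δ, B + δ]`. -/
noncomputable def trapezoid (A B δ x : ℝ) : ℝ :=
  max 0 (1 - max 0 (max (A - x) (x - B)) / δ)

theorem trapezoid_nonneg (A B δ x : ℝ) : 0 ≤ trapezoid A B δ x := le_max_left _ _

theorem trapezoid_le_one {δ : ℝ} (hδ : 0 < δ) (A B x : ℝ) : trapezoid A B δ x ≤ 1 := by
  have : 0 ≤ max 0 (max (A - x) (x - B)) / δ := by positivity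
  exact max_le zero_le_one (by linarith)

theorem trapezoid_eq_one {A B x : ℝ} (δ : ℝ) (hx : A ≤ x ∧ x ≤ B) : trapezoid A B δ x = 1 := by
  have : max 0 (max (A - x) (x - B)) = 0 :=
    max_eq_left (max_le (by linarith [hx.1]) (by linarith [hx.2]))
  rw [trapezoid, this, zero_div, sub_zero]
  exact max_eq_right zero_le_one

theorem trapezoid_eq_zero {A B δ x : ℝ} (hδ : 0 < δ) (hx : x < A - δ ∨ B + δ < x) :
    trapezoid A B δ x = 0 := by
  refine max_eq_left ?_
  have : δ ≤ max 0 (max (A - x) (x - B)) := by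
    rcases hx with h | h
    · exact le_max_of_le_right (le_max_of_le_left (by linarith))
    · exact le_max_of_le_right (le_max_of_le_right (by linarith))
  have := (one_le_div hδ).2 this
  linarith

theorem uniformContinuous_trapezoid {δ : ℝ} (hδ : 0 < δ) (A B : ℝ) :
    UniformContinuous (trapezoid A B δ) := by
  have hcont : Continuous (trapezoid A B δ) := by
    unfold trapezoid
    fun_prop
  refine HasCompactSupport.uniformContinuous_of_continuous ?_ hcont
  refine HasCompactSupport.intro (isCompact_Icc (a := A - δ) (b := B + δ)) fun x hx ↦ ?_
  rw [Set.mem_Icc, not_and_or, not_le, not_le] at hx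
  exact trapezoid_eq_zero hδ hx

open Classical in
theorem abs_indicator_sub_trapezoid_le {δ : ℝ} (hδ : 0 < δ) (A B x : ℝ) :
    |(if A ≤ x ∧ x ≤ B then 1 else 0) - trapezoid A B δ x| ≤
      (if A - δ ≤ x ∧ x ≤ A then 1 else 0) + (if B ≤ x ∧ x ≤ B + δ then 1 else 0) := by
  have h0 := trapezoid_nonneg A B δ x
  have h1 := trapezoid_le_one hδ A B x
  have hnn1 : (0 : ℝ) ≤ if A - δ ≤ x ∧ x ≤ A then 1 else 0 := by positivity
  have hnn2 : (0 : ℝ) ≤ if B ≤ x ∧ x ≤ B + δ then 1 else 0 := by positivity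
  by_cases hx : A ≤ x ∧ x ≤ B
  · rw [if_pos hx, trapezoid_eq_one δ hx, sub_self, abs_zero]
    linarith
  rw [if_neg hx, zero_sub, abs_neg, abs_of_nonneg h0]
  by_cases hA : A - δ ≤ x ∧ x ≤ A
  · rw [if_pos hA]; linarith
  by_cases hB : B ≤ x ∧ x ≤ B + δ
  · rw [if_pos hB]; linarith
  rw [trapezoid_eq_zero hδ ?_]
  · linarith
  · by_contra! hcon
    rcases le_total x A with h | h
    · exact hA ⟨hcon.1, h⟩
    · exact hx ⟨h, (not_le.1 fun h' ↦ hB ⟨h', hcon.2⟩).le⟩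

open Classical in
-- Indicator and trapezoid differ only on two windows of width δ, whose densities tend to Gaussian
-- masses at most δ each; with δ = ε/4 the limiting error is at most ε/2.
theorem tendsto_average_indicator_mul_liouville {A B : ℝ} :
    Tendsto (fun N : ℕ ↦ (∑ n ∈ Finset.Ioc 0 N,
      (if A ≤ normalizedOmega N n ∧ normalizedOmega N n ≤ B then (1 : ℝ) else 0) *
        (ArithmeticFunction.liouville n : ℝ)) / N) atTop (𝓝 0) := by
  rw [Metric.tendsto_atTop']
  intro ε hε
  set δ := ε / 4 with hδdef
  have hδ : 0 < δ := by positivity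
  have h1 := (tendsto_average_mul_liouville (uniformContinuous_trapezoid hδ A B) (K := 1)
    fun x ↦ by
      rw [abs_of_nonneg (trapezoid_nonneg A B δ x)]; exact trapezoid_le_one hδ A B x).abs
  have h2 := tendsto_card_normalizedOmega_mem_Icc (A := A - δ) (B := A) (by linarith)
  have h3 := tendsto_card_normalizedOmega_mem_Icc (A := B) (B := B + δ) (by linarith)
  have hlim := (h1.add h2).add h3
  have hlt : |(0 : ℝ)| + (1 / Real.sqrt (2 * Real.pi)) * (∫ t in (A - δ)..A, Real.exp (-t ^ 2 / 2)) +
      (1 / Real.sqrt (2 * Real.pi)) * (∫ t in B..(B + δ), Real.exp (-t ^ 2 / 2)) < ε := by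
    have e1 := gaussianMass_le (A := A - δ) (B := A) (by linarith)
    have e2 := gaussianMass_le (A := B) (B := B + δ) (by linarith)
    rw [abs_zero]
    linarith
  obtain ⟨n₀, hn₀⟩ := eventually_atTop.1 (hlim.eventually_lt_const hlt)
  refine ⟨n₀, fun N hN ↦ ?_⟩
  rw [Real.dist_eq, sub_zero]
  refine lt_of_le_of_lt ?_ (hn₀ N hN.le)
  have hN0 : (0 : ℝ) ≤ N := Nat.cast_nonneg N
  rw [abs_div, abs_div, abs_of_nonneg hN0, ← add_div, ← add_div]
  refine div_le_div_of_nonneg_right ?_ hN0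
  rw [Finset.card_filter, Finset.card_filter, Nat.cast_sum, Nat.cast_sum, add_assoc,
    ← Finset.sum_add_distrib, ← sub_le_iff_le_add']
  refine (abs_sub_abs_le_abs_sub _ _).trans ?_
  rw [← Finset.sum_sub_distrib]
  refine (Finset.abs_sum_le_sum_abs _ _).trans (Finset.sum_le_sum fun n _ ↦ ?_)
  rw [← sub_mul, abs_mul]
  have h4 := abs_indicator_sub_trapezoid_le hδ A B (normalizedOmega N n)
  have h5 := abs_liouville_le_one n
  push_cast
  refine le_trans ?_ h4
  calc _ ≤ _ * (1 : ℝ) := mul_le_mul_of_nonneg_left h5 (abs_nonneg _)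
    _ = _ := mul_one _

theorem even_boole_eq {n : ℕ} (hn : 0 < n) :
    (if Even (ArithmeticFunction.cardFactors n) then (1 : ℝ) else 0) =
      (1 + (ArithmeticFunction.liouville n : ℝ)) / 2 := by
  rw [ArithmeticFunction.liouville_apply hn.ne']
  split_ifs with h
  · rw [h.neg_one_pow]; norm_num
  · rw [(Nat.not_even_iff_odd.1 h).neg_one_pow]; norm_num

theorem card_evenOmega_eq (N : ℕ) :
    ((evenOmega N).card : ℝ) =
      (N + ∑ n ∈ Finset.Ioc 0 N, (ArithmeticFunction.liouville n : ℝ)) / 2 := by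
  rw [evenOmega, Finset.card_filter, Nat.cast_sum]
  change ∑ n ∈ Finset.Ioc 0 N, _ = _
  have : ∀ n ∈ Finset.Ioc 0 N,
      (((if Even (ArithmeticFunction.cardFactors n) then 1 else 0 : ℕ)) : ℝ) =
      (1 + (ArithmeticFunction.liouville n : ℝ)) / 2 := by
    intro n hn
    rw [← even_boole_eq (Finset.mem_Ioc.1 hn).1]
    push_cast
    rfl
  rw [Finset.sum_congr rfl this, ← Finset.sum_div, Finset.sum_add_distrib]
  simp

open Classical in
theorem ncard_evenOmega_normalizedOmega_eq (N : ℕ) (A B : ℝ) :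
    (Set.ncard {n : ℕ | n ∈ evenOmega N ∧
        A ≤ normalizedOmega N n ∧ normalizedOmega N n ≤ B} : ℝ) =
      ((((Finset.Ioc 0 N).filter
        fun n ↦ A ≤ normalizedOmega N n ∧ normalizedOmega N n ≤ B).card : ℝ) +
      ∑ n ∈ Finset.Ioc 0 N,
        (if A ≤ normalizedOmega N n ∧ normalizedOmega N n ≤ B then (1 : ℝ) else 0) *
          (ArithmeticFunction.liouville n : ℝ)) / 2 := by
  have hset : {n : ℕ | n ∈ evenOmega N ∧ A ≤ normalizedOmega N n ∧ normalizedOmega N n ≤ B} =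
      (((Finset.Ioc 0 N).filter fun n ↦ Even (ArithmeticFunction.cardFactors n) ∧
        A ≤ normalizedOmega N n ∧ normalizedOmega N n ≤ B : Finset ℕ) : Set ℕ) := by
    ext n
    simp only [evenOmega, Set.mem_ofPred_eq, Finset.mem_filter, Finset.mem_Icc, Finset.coe_filter,
      Finset.mem_Ioc, and_assoc]
    rfl
  rw [hset, Set.ncard_coe_finset, Finset.card_filter, Finset.card_filter, Nat.cast_sum,
    Nat.cast_sum, ← Finset.sum_add_distrib, Finset.sum_div]
  refine Finset.sum_congr rfl fun n hn ↦ ?_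
  have h := even_boole_eq (Finset.mem_Ioc.1 hn).1
  by_cases h1 : A ≤ normalizedOmega N n ∧ normalizedOmega N n ≤ B
  · simp only [h1, and_self, and_true, if_true, Nat.cast_one, one_mul]
    rw [← h]
    push_cast
    rfl
  · simp only [h1, and_false, if_false, Nat.cast_zero, zero_mul, add_zero, zero_div]

theorem tendsto_average_compactlySupported_mul_liouville
    (F : CompactlySupportedContinuousMap ℝ ℂ) :
    Tendsto (fun N : ℕ ↦ (1 / (N : ℂ)) * ∑ n ∈ Finset.Icc 1 N,
      F (normalizedOmega N n) * ((ArithmeticFunction.liouville n : ℤ) : ℂ)) atTop (𝓝 0) := by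
  have huc : UniformContinuous F :=
    HasCompactSupport.uniformContinuous_of_continuous F.hasCompactSupport' F.continuous
  obtain ⟨K, hK⟩ := HasCompactSupport.exists_bound_of_continuous F.hasCompactSupport' F.continuous
  have hre := tendsto_average_mul_liouville (F := fun x ↦ (F x).re)
    (Complex.uniformContinuous_re.comp huc)
    (K := K) fun x ↦ (Complex.abs_re_le_norm _).trans (hK x)
  have him := tendsto_average_mul_liouville (F := fun x ↦ (F x).im)
    (Complex.uniformContinuous_im.comp huc)
    (K := K) fun x ↦ (Complex.abs_im_le_norm _).trans (hK x)
  have hre' := (Complex.continuous_ofReal.tendsto _).comp hre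
  have him' := ((Complex.continuous_ofReal.tendsto _).comp him).mul_const Complex.I
  have h := hre'.add him'
  simp only [Complex.ofReal_zero, zero_mul, add_zero] at h
  refine h.congr fun N ↦ ?_
  simp only [Function.comp_apply]
  change _ = (1 / (N : ℂ)) * ∑ n ∈ Finset.Ioc 0 N, _
  push_cast
  rw [div_mul_eq_mul_div, ← add_div, one_div_mul_eq_div, Finset.sum_mul, ← Finset.sum_add_distrib]
  congr 1
  refine Finset.sum_congr rfl fun n _ ↦ ?_
  conv_rhs => rw [← Complex.re_add_im (F (normalizedOmega N n))]
  ring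

theorem corollary1p4 :
    (∀ F : CompactlySupportedContinuousMap ℝ ℂ,
      Filter.Tendsto
        (fun N : ℕ => (1 / (N : ℂ)) * ∑ n ∈ Finset.Icc 1 N,
          F (normalizedOmega N n) * ((ArithmeticFunction.liouville n : ℤ) : ℂ))
        Filter.atTop (nhds 0)) ∧
    (∀ A B : ℝ, A ≤ B →
      Filter.Tendsto
        (fun N : ℕ =>
          (Set.ncard {n : ℕ | n ∈ evenOmega N ∧
              A ≤ normalizedOmega N n ∧ normalizedOmega N n ≤ B} : ℝ) /
            ((evenOmega N).card : ℝ))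
        Filter.atTop
        (nhds ((1 / Real.sqrt (2 * Real.pi)) * ∫ t in A..B, Real.exp (-t ^ 2 / 2)))) := by
  refine ⟨tendsto_average_compactlySupported_mul_liouville, fun A B hAB ↦ ?_⟩
  have hnum := (tendsto_card_normalizedOmega_mem_Icc hAB).add
    (tendsto_average_indicator_mul_liouville (A := A) (B := B))
  -- With F = 1 the mean of λ tends to 0. Numerator and denominator carry the same factor N/2, which
  -- cancels, so the quotient tends to the Gaussian mass divided by 1.
  have hden := (tendsto_average_mul_liouville (F := fun _ ↦ 1) uniformContinuous_const (K := 1)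
    (fun _ ↦ by simp)).const_add 1
  simp only [add_zero, one_mul] at hnum hden
  have h := hnum.div hden one_ne_zero
  rw [div_one] at h
  refine h.congr' ?_
  filter_upwards [eventually_gt_atTop 0] with N hN
  have hN0 : (N : ℝ) ≠ 0 := by positivity
  rw [ncard_evenOmega_normalizedOmega_eq, card_evenOmega_eq, Pi.div_apply, ← add_div,
    div_div_div_cancel_right₀ two_ne_zero, one_add_div hN0, div_div_div_cancel_right₀ hN0]
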